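/- Conventions. Manifolds are connected. "Triangulated with at most $N$ simplices" refers to a finite simplicial complex with at most $N$ simplices, counted in all dimensions. For a continuous map $f:M\to\Sigma$ from a closed oriented 3-manifold to a closed oriented surface, let $\omega$ be a real 2-cocycle representing the fundamental cohomology class of $\Sigma$. If $f^*[\omega]=0$ in $H^2(M;\mathbb R)$, the Hopf invariant of $f$ is $$\mathrm{Hopf}(f)=\langle a\cup f^*\omega,[M]\rangle ,\qquad \delta a=f^*\omega ,$$ computed simplicially after replacing $f$ by a homotopic simplicial map that preserves chosen vertex orders of triangulations of $M$ and $\Sigma$. Up to an orientation-dependent sign it is the degree of $f:(z,\partial z)\to(\Sigma,q)$, where $z$ is a real 2-chain bounded by a generic fibre $f^{-1}(q)$. The Hopf size of a closed 3-manifold $M$ with a path metric $g$ is $$\mathrm{HopfSize}(M,g)=\sup_{L>0}\ \sup_{\mathrm{Lip}(F)\le L}|\mathrm{Hopf}(F)|\,L^{-4},$$ over the $L$-Lipschitz maps $F$ from $(M,g)$ to the unit 2-sphere (with its great-circle metric) whose Hopf invariant is defined. Theorem. (1) There are a closed orientable surface $\Sigma$ of genus 2 and constants $c>0$ and $N_0$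 such that for every $N\ge N_0$ there is a closed orientable 3-manifold $M$ which can be triangulated with at most $N$ simplices and which admits a continuous map $f:M\to\Sigma$ whose Hopf invariant is defined and satisfies $|\mathrm{Hopf}(f)|\ge \exp(cN)$. (Thus an upper bound of the form $C^N$ for the Hopf invariant of maps from closed oriented 3-manifolds with $N$ simplices to a genus-2 surface cannot be improved to a subexponential one.) (2) There are constants $c>0$ and $N_0$ such that for every $N\ge N_0$ there is a triangulation of $S^3$ with at most $N$ simplices for which the length metric that makes every simplex a regular Euclidean simplex of edge length 1 has Hopf size greater than $\exp(cN)$. -/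

import Mathlib

noncomputable section

namespace HopfBound

open Finset

/-! ### Finite simplicial complexes and their realizations -/

section Complexes

variable {V : Type} [Fintype V]

/-- `x` is (the tuple of barycentric coordinates of) a point of the closed simplex spanned by
the vertex set `s`. -/
def InSimplex (s : Finset V) (x : V → ℝ) : Prop :=
  x ∈ stdSimplex ℝ V ∧ ∀ v, v ∉ s → x v = 0

/-- The geometric realization `|K|` of a finite simplicial complex, as a subspace of `ℝ^V`. -/
def realization (K : AbstractSimplicialComplex V) : Set (V → ℝ) :=
  {x | ∃ s ∈ K.faces, InSimplex s x}

/-- The number of simplices (of all dimensions) of `K`. -/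
def numSimplices (K : AbstractSimplicialComplex V) : ℕ := K.faces.ncard

open Classical in
/-- The Euler characteristic of `K`. -/
def eulerChar (K : AbstractSimplicialComplex V) : ℤ :=
  ∑ s : Finset V with s ∈ K.faces, (-1) ^ (s.card + 1)

/-- Euclidean distance of two points lying in a common simplex, when every simplex is given the
metric of the regular Euclidean simplex of edge length `1`. -/
def unitDist (x y : V → ℝ) : ℝ := √((∑ v, (x v - y v) ^ 2) / 2)

/-- The length metric on `|K|` for which each simplex is a regular Euclidean simplex of edge
length `1`: the infimum of the lengths of all polygonal paths `p 0, p 1, …, p n` from `x` to `y`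
each of whose steps stays in one simplex of `K`. -/
def unitEDist (K : AbstractSimplicialComplex V) (x y : realization K) : ENNReal :=
  ⨅ (n : ℕ) (p : ℕ → realization K) (_ : p 0 = x) (_ : p n = y)
    (_ : ∀ i < n, ∃ s ∈ K.faces, InSimplex s (p i).1 ∧ InSimplex s (p (i + 1)).1),
      ∑ i ∈ Finset.range n, ENNReal.ofReal (unitDist (p i).1 (p (i + 1)).1)

end Complexes

/-! ### Cochains of ordered simplicial complexes -/

section Cochains

variable {V W : Type} [Fintype V] [LinearOrder V] [Fintype W] [LinearOrder W]

open Classical in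
/-- The `n`-simplices of `K`, each written as the increasing tuple of its vertices. -/
def simplices (K : AbstractSimplicialComplex V) (n : ℕ) : Finset (Fin (n + 1) → V) :=
  Finset.univ.filter fun s => StrictMono s ∧ Finset.univ.image s ∈ K.faces

/-- The simplicial coboundary of a real cochain; cochains are functions on vertex tuples, of which
only the values on the simplices of the complex in question matter. -/
def coboundary {n : ℕ} (b : (Fin n → V) → ℝ) (s : Fin (n + 1) → V) : ℝ :=
  ∑ i : Fin (n + 1), (-1) ^ (i : ℕ) * b (s ∘ i.succAbove)

/-- The value `⟨b, c⟩` of the `n`-cochain `b` on the `n`-chain `∑ₛ c(s) s` of `K`. -/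
def pairing (K : AbstractSimplicialComplex V) {n : ℕ} (b c : (Fin (n + 1) → V) → ℝ) : ℝ :=
  ∑ s ∈ simplices K n, c s * b s

/-- `o` is a coherent orientation of the `n`-simplices of `K`: a choice of signs for which
`∑ₛ o(s) s` is a cycle, that is, vanishes on every coboundary.  If `|K|` is a connected closed
`n`-manifold, then this cycle is a fundamental cycle for one of the two orientations. -/
def IsOrientation (K : AbstractSimplicialComplex V) (n : ℕ) (o : (Fin (n + 1) → V) → ℝ) : Prop :=
  (∀ s ∈ simplices K n, o s = 1 ∨ o s = -1) ∧
    ∀ b : (Fin n → V) → ℝ, pairing K (coboundary b) o = 0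

open Classical in
/-- The pull-back of a cochain under an order preserving simplicial map; it vanishes on the
simplices that are collapsed by the map. -/
def pullback (φ : V → W) {n : ℕ} (w : (Fin (n + 1) → W) → ℝ) (s : Fin (n + 1) → V) : ℝ :=
  if StrictMono (φ ∘ s) then w (φ ∘ s) else 0

/-- The (Alexander–Whitney) cup product of a `1`-cochain with a `2`-cochain. -/
def cup (a : (Fin 2 → V) → ℝ) (b : (Fin 3 → V) → ℝ) (s : Fin 4 → V) : ℝ :=
  a ![s 0, s 1] * b ![s 1, s 2, s 3]

/-- `φ` is a simplicial map from `K` to `L` which preserves the vertex orders. -/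
def IsOrderedSimplicialMap (K : AbstractSimplicialComplex V) (L : AbstractSimplicialComplex W)
    (φ : V → W) : Prop :=
  Monotone φ ∧ ∀ s ∈ K.faces, s.image φ ∈ L.faces

/-- `h` is the Hopf invariant of the order preserving simplicial map `φ` from the oriented closed
`3`-manifold `K` to the oriented closed surface `L`:
`h = ⟨a ∪ φ^*w, [K]⟩`, where the `2`-cocycle `w` represents the fundamental cohomology class of `L`,
i.e. `⟨w, [L]⟩ = 1`, and `a` is a real `1`-cochain with `δa = φ^*w`.  (Such an `a` exists if and
only if the pull-back of the fundamental class vanishes in `H²(K; ℝ)`.)  Each of the two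
orientations of `K` and of `L` is allowed, so that `h` is determined up to its sign.  Because `φ`
is order preserving, the Alexander–Whitney product is natural for `φ`, and `|h|` depends
only on the homotopy class of the affine extension of `φ`. -/
def IsSimplicialHopfInvariant (K : AbstractSimplicialComplex V) (L : AbstractSimplicialComplex W)
    (φ : V → W) (h : ℝ) : Prop :=
  ∃ (oK : (Fin 4 → V) → ℝ) (oL : (Fin 3 → W) → ℝ) (w : (Fin 3 → W) → ℝ) (a : (Fin 2 → V) → ℝ),
    IsOrientation K 3 oK ∧ IsOrientation L 2 oL ∧ pairing L w oL = 1 ∧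
    (∀ s ∈ simplices K 2, coboundary a s = pullback φ w s) ∧
    h = pairing K (cup a (pullback φ w)) oK

end Cochains

/-! ### Closed manifolds and the Hopf invariant of a continuous map -/

/-- `M` is a closed connected orientable (triangulable) `n`-manifold.  Orientability is expressed
by a coherent orientation of the top-dimensional simplices of a triangulation. -/
structure IsClosedOrientable (n : ℕ) (M : Type) [TopologicalSpace M] : Prop where
  t2 : T2Space M
  compact : CompactSpace M
  connected : ConnectedSpace M
  charted : Nonempty (ChartedSpace (EuclideanSpace ℝ (Fin n)) M)
  orientable : ∃ (V : Type) (_ : Fintype V) (_ : LinearOrder V) (K : AbstractSimplicialComplex V)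
    (o : (Fin (n + 1) → V) → ℝ), Nonempty (realization K ≃ₜ M) ∧ IsOrientation K n o

/-- `S` is a closed connected orientable surface of genus `g`, i.e. of Euler characteristic
`2 - 2g`. -/
def IsSurfaceOfGenus (g : ℕ) (S : Type) [TopologicalSpace S] : Prop :=
  IsClosedOrientable 2 S ∧
    ∃ (V : Type) (_ : Fintype V) (K : AbstractSimplicialComplex V),
      Nonempty (realization K ≃ₜ S) ∧ eulerChar K = 2 - 2 * (g : ℤ)

/-- `h` is, up to sign (that is, for one of the orientations of `M`), the Hopf invariant of the
continuous map `f` from the closed orientable `3`-manifold `M` to the closed orientable surface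
`S`.  By simplicial approximation `f` is homotopic to a map `g` which, for suitable triangulations
`K` of `M` and `L` of `S` with ordered vertices, is (the affine extension of) an order preserving
simplicial map `φ`; `h` is the Hopf invariant of `φ`.  There is such an `h` if and only if `f` pulls
the fundamental cohomology class of `S` back to zero in `H²(M; ℝ)`. -/
def IsHopfInvariant {M S : Type} [TopologicalSpace M] [TopologicalSpace S] (f : C(M, S)) (h : ℝ) :
    Prop :=
  ∃ (V W : Type) (_ : Fintype V) (_ : LinearOrder V) (_ : Fintype W) (_ : LinearOrder W)
    (K : AbstractSimplicialComplex V) (L : AbstractSimplicialComplex W)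
    (eK : realization K ≃ₜ M) (eL : realization L ≃ₜ S) (φ : V → W) (g : C(M, S)),
    IsOrderedSimplicialMap K L φ ∧
    (∀ (x : realization K) (w : W),
      (eL.symm (g (eK x))).1 w = ∑ v with φ v = w, x.1 v) ∧
    g.Homotopic f ∧
    IsSimplicialHopfInvariant K L φ h

/-! ### The Hopf size -/

/-- The unit sphere in `ℝ^(n+1)`. -/
abbrev UnitSphere (n : ℕ) : Type := Metric.sphere (0 : EuclideanSpace ℝ (Fin (n + 1))) 1

/-- `F` is `L`-Lipschitz from `|K|`, with the length metric in which each simplex is a unit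
Euclidean simplex, to the unit `2`-sphere with its Riemannian (great circle) distance. -/
def IsLipschitzToSphere {V : Type} [Fintype V] (K : AbstractSimplicialComplex V) (L : ℝ)
    (F : C(realization K, UnitSphere 2)) : Prop :=
  ∀ x y, ENNReal.ofReal (InnerProductGeometry.angle (F x).1 (F y).1) ≤
    ENNReal.ofReal L * unitEDist K x y

/-- The Hopf size of the triangulated `3`-manifold `|K|` in which each simplex is a unit Euclidean
simplex: the supremum of `|Hopf F| L⁻⁴` over all `L > 0` and all `L`-Lipschitz maps `F` to the unit
`2`-sphere whose Hopf invariant is defined. -/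
def hopfSize {V : Type} [Fintype V] (K : AbstractSimplicialComplex V) : ENNReal :=
  ⨆ (L : ℝ) (_ : 0 < L) (F : C(realization K, UnitSphere 2)) (_ : IsLipschitzToSphere K L F)
    (h : ℝ) (_ : IsHopfInvariant F h), ENNReal.ofReal (|h| * (L ^ 4)⁻¹)

end HopfBound

end

/-! Take a compact oriented surface B with two boundary triangles and close up B × S¹ by a solid
torus on each boundary torus. Each solid torus consists of a core and n layers annulus × circle, and
the bottom of a layer is glued to the preceding torus by (x, j) ↦ (j, x + j). This matrix is
hyperbolic of determinant -1 and preserves the nine-vertex triangulation of the torus, so a bounded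
number of simplices multiplies the gluing map by a fixed hyperbolic matrix. With n = l + 1, the
generators of the first cohomology of the two solid tori, read on the boundary tori in the
coordinates (∂B, S¹), are (F_l, F_{l+1}) and (F_{l+1}, F_{l+2}) with F the Fibonacci numbers
(`lam_false_succ`, `lam_true`).

The map forgets the circle factor on B × S¹, sends all vertices of a solid torus off its boundary to
a pole, and so maps the outermost layer onto a cone over a boundary circle of B. Spread the
fundamental class of the target over the three triangles of the cone at the first pole. A primitive
a of its pull-back is sought as ρη + γ dθ on B × S¹ and as μ_σ times the generator λ_σ on each solid
torus. Matching along the boundary tori (`closed_primitive`) requires γ = μ_σ λ_σ.2 for both σ, and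
that ρ - μ_σ λ_σ.1 be 1/3 for the first torus and 0 for the second. The two generators have
determinant ±1 by Cassini's identity (`fib_cassini`), which gives 3γ = ±F_{l+1} F_{l+2}. A generic
fibre near the first pole is parallel to the S¹ factor and has three edges, so the Hopf invariant
is, up to sign, the integral 3γ of a over it; `sum_altExt_cup` computes the cup product directly.
This is at least 2^l, while the number of simplices is linear in l.

For the Hopf size, B is an annulus. Both solid tori have the same layers, hence the same boundary
parametrization χ, except that their cores fill opposite circle factors (`isSolid_layered`); their
union is the boundary of disc × disc, a 3-sphere. The map goes to a bipyramid, identified with the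
round sphere by a fixed Lipschitz homeomorphism. Being simplicial, it has a Lipschitz constant
independent of l.

For the genus two statement, B is a triangulated genus two surface without two triangles. The filled
space is a manifold: a point near a solid torus has a chart in an enlarged solid torus, and every
other point has one in closed surface × circle (`locEuc_filling`). The properties of the specific
surface are finite checks. -/

noncomputable section
namespace HopfBound
open Finset

/-! ### Complexes generated by a family of facets -/

section Facets

variable {V ι : Type} {d : ℕ}

/-- The simplicial complex whose facets are the vertex sets of the tuples `τ i`. -/
def facetComplex (τ : ι → Fin (d + 1) → V) (h : ∀ v, ∃ i p, τ i p = v) :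
    AbstractSimplicialComplex V where
  faces := {s | s.Nonempty ∧ ∃ i, ∀ v ∈ s, ∃ p, τ i p = v}
  isRelLowerSet_faces := by
    rintro s ⟨hs, i, hi⟩
    exact ⟨hs, fun t hts ht => ⟨ht, i, fun v hv => hi v (hts hv)⟩⟩
  singleton_mem v := by
    obtain ⟨i, p, hp⟩ := h v
    exact ⟨singleton_nonempty v, i, fun u hu => ⟨p, by rw [hp, mem_singleton.1 hu]⟩⟩

variable {τ : ι → Fin (d + 1) → V} {h : ∀ v, ∃ i p, τ i p = v}

/-- A face is determined by a facet and a subset of its d + 1 positions. Only linearity in the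
number of facets matters later. -/
theorem numSimplices_facetComplex_le [Fintype V] [Fintype ι] :
    numSimplices (facetComplex τ h) ≤ Fintype.card ι * 2 ^ (d + 1) := by
  classical
  have hsub : (facetComplex τ h).faces ⊆
      ((univ : Finset (ι × Finset (Fin (d + 1)))).image fun x => x.2.image (τ x.1) :
        Finset (Finset V)) := by
    rintro s ⟨-, i, hi⟩
    simp only [coe_image, Set.mem_image, coe_univ, Set.mem_univ, true_and, Prod.exists]
    refine ⟨i, univ.filter fun p => τ i p ∈ s, ?_⟩
    ext v
    simp only [mem_image, mem_filter, mem_univ, true_and]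
    constructor
    · rintro ⟨p, hp, rfl⟩; exact hp
    · intro hv
      obtain ⟨p, rfl⟩ := hi v hv
      exact ⟨p, hv, rfl⟩
  calc numSimplices (facetComplex τ h) ≤ _ := Set.ncard_le_ncard hsub (finite_toSet _)
    _ ≤ (univ : Finset (ι × Finset (Fin (d + 1)))).card := by
        rw [Set.ncard_coe_finset]; exact card_image_le
    _ = _ := by simp

/-- The points of the simplex spanned by a tuple. -/
def cell [Fintype V] (t : Fin (d + 1) → V) : Set (V → ℝ) :=
  {x | x ∈ stdSimplex ℝ V ∧ ∀ v, (∀ p, t p ≠ v) → x v = 0}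

theorem realization_facetComplex [Fintype V] :
    realization (facetComplex τ h) = ⋃ i, cell (τ i) := by
  classical
  ext x
  simp only [realization, Set.mem_ofPred_eq, Set.mem_iUnion, cell, InSimplex]
  constructor
  · rintro ⟨s, ⟨-, i, hi⟩, hx, hs⟩
    refine ⟨i, hx, fun v hv => hs v fun hvs => ?_⟩
    obtain ⟨p, hp⟩ := hi v hvs
    exact hv p hp
  · rintro ⟨i, hx, hi⟩
    refine ⟨univ.image (τ i), ⟨⟨τ i 0, by simp⟩, i, by simp⟩, hx, fun v hv => hi v ?_⟩
    simpa using hv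

end Facets

/-! ### Alternating cochains -/

section Alternating

variable {V : Type} {n : ℕ}

/-- Cochains which are alternating functions of the vertices. -/
def IsAlternating (c : (Fin n → V) → ℝ) : Prop :=
  ∀ (t : Fin n → V) (π : Equiv.Perm (Fin n)), c (t ∘ π) = (Equiv.Perm.sign π : ℤ) * c t

theorem isAlternating_of_swap {c : (Fin n → V) → ℝ}
    (h : ∀ t i j, i ≠ j → c (t ∘ Equiv.swap i j) = -c t) : IsAlternating c := by
  intro t π
  induction π using Equiv.Perm.swap_induction_on' generalizing t with
  | one => simp
  | mul_swap f x y hxy ih =>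
    rw [Equiv.Perm.sign_mul, Equiv.Perm.sign_swap hxy, Equiv.Perm.coe_mul, ← Function.comp_assoc,
      h _ _ _ hxy, ih]
    push_cast
    ring

theorem IsAlternating.swap {c : (Fin n → V) → ℝ} (h : IsAlternating c) (t : Fin n → V)
    {i j : Fin n} (hij : i ≠ j) : c (t ∘ Equiv.swap i j) = -c t := by
  rw [h, Equiv.Perm.sign_swap hij]; simp

/-- The alternating extension of a cochain on increasing tuples. -/
def altExt [LinearOrder V] (f : (Fin n → V) → ℝ) (t : Fin n → V) : ℝ :=
  ∑ π : Equiv.Perm (Fin n),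
    if StrictMono (t ∘ π) then ((Equiv.Perm.sign π : ℤ) : ℝ) * f (t ∘ π) else 0

theorem isAlternating_altExt [LinearOrder V] (f : (Fin n → V) → ℝ) :
    IsAlternating (altExt f) := by
  intro t π
  rw [altExt, altExt, mul_sum]
  refine Fintype.sum_equiv (Equiv.mulLeft π) _ _ fun ρ => ?_
  simp only [Equiv.coe_mulLeft, Equiv.Perm.coe_mul, ← Function.comp_assoc, mul_ite, mul_zero,
    Equiv.Perm.sign_mul]
  split_ifs with h
  · rw [← mul_assoc, ← Int.cast_mul, ← Units.val_mul, ← mul_assoc, Int.units_mul_self, one_mul]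
  · rfl

theorem exists_strictMono_comp [LinearOrder V] {t : Fin n → V} (ht : Function.Injective t) :
    ∃ π : Equiv.Perm (Fin n), StrictMono (t ∘ π) :=
  ⟨Tuple.sort t, (Tuple.monotone_sort t).strictMono_of_injective
    (ht.comp (Tuple.sort t).injective)⟩

theorem perm_eq_one_of_strictMono [LinearOrder V] {t : Fin n → V} (ht : StrictMono t)
    {π : Equiv.Perm (Fin n)} (h : StrictMono (t ∘ π)) : π = 1 := by
  have hπ : StrictMono π := fun a b hab => ht.lt_iff_lt.1 (h hab)
  have := (StrictMono.range_inj hπ strictMono_id).1 (by simp)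
  ext a
  simp [this]

theorem altExt_of_strictMono [LinearOrder V] (f : (Fin n → V) → ℝ) {t : Fin n → V}
    (ht : StrictMono t) : altExt f t = f t := by
  rw [altExt, sum_eq_single 1]
  · simp [ht]
  · intro π _ hπ
    exact if_neg fun h => hπ (perm_eq_one_of_strictMono ht h)
  · simp

theorem coboundary_eq_two (c : (Fin 2 → V) → ℝ) (s : Fin 3 → V) :
    coboundary c s = c ![s 1, s 2] - c ![s 0, s 2] + c ![s 0, s 1] := by
  have h0 : s ∘ (0 : Fin 3).succAbove = ![s 1, s 2] := by ext i; fin_cases i <;> rfl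
  have h1 : s ∘ (1 : Fin 3).succAbove = ![s 0, s 2] := by ext i; fin_cases i <;> rfl
  have h2 : s ∘ (2 : Fin 3).succAbove = ![s 0, s 1] := by ext i; fin_cases i <;> rfl
  refine (Fin.sum_univ_three _).trans ?_
  rw [h0, h1, h2]
  simp; ring

theorem coboundary_eq_three (c : (Fin 3 → V) → ℝ) (s : Fin 4 → V) :
    coboundary c s = c ![s 1, s 2, s 3] - c ![s 0, s 2, s 3] + c ![s 0, s 1, s 3]
      - c ![s 0, s 1, s 2] := by
  have h0 : s ∘ (0 : Fin 4).succAbove = ![s 1, s 2, s 3] := by ext i; fin_cases i <;> rfl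
  have h1 : s ∘ (1 : Fin 4).succAbove = ![s 0, s 2, s 3] := by ext i; fin_cases i <;> rfl
  have h2 : s ∘ (2 : Fin 4).succAbove = ![s 0, s 1, s 3] := by ext i; fin_cases i <;> rfl
  have h3 : s ∘ (3 : Fin 4).succAbove = ![s 0, s 1, s 2] := by ext i; fin_cases i <;> rfl
  refine (Fin.sum_univ_four _).trans ?_
  rw [h0, h1, h2, h3]
  simp; ring

theorem IsAlternating.swap_two {c : (Fin 2 → V) → ℝ} (h : IsAlternating c) (x y : V) :
    c ![y, x] = -c ![x, y] := by
  rw [← h.swap ![x, y] (i := 0) (j := 1) (by decide)]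
  congr 1; ext i; fin_cases i <;> rfl

theorem IsAlternating.swap_three {c : (Fin 3 → V) → ℝ} (h : IsAlternating c) (x y z : V) :
    c ![y, x, z] = -c ![x, y, z] := by
  rw [← h.swap ![x, y, z] (i := 0) (j := 1) (by decide)]
  congr 1; ext i; fin_cases i <;> rfl

theorem IsAlternating.swap_three' {c : (Fin 3 → V) → ℝ} (h : IsAlternating c) (x y z : V) :
    c ![x, z, y] = -c ![x, y, z] := by
  rw [← h.swap ![x, y, z] (i := 1) (j := 2) (by decide)]
  congr 1; ext i; fin_cases i <;> rfl

theorem IsAlternating.coboundary_two {c : (Fin 2 → V) → ℝ} (h : IsAlternating c) :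
    IsAlternating (coboundary c) := by
  refine isAlternating_of_swap fun t i j hij => ?_
  have h01 := h.swap_two (t 0) (t 1)
  have h02 := h.swap_two (t 0) (t 2)
  have h12 := h.swap_two (t 1) (t 2)
  rw [coboundary_eq_two, coboundary_eq_two]
  fin_cases i <;> fin_cases j <;> first | exact absurd rfl hij | skip
  all_goals simp [Equiv.swap_apply_def]; linarith

theorem IsAlternating.coboundary_three {c : (Fin 3 → V) → ℝ} (h : IsAlternating c) :
    IsAlternating (coboundary c) := by
  refine isAlternating_of_swap fun t i j hij => ?_
  have h1 := h.swap_three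
  have h2 := h.swap_three'
  rw [coboundary_eq_three, coboundary_eq_three]
  have h3 := fun x y z => (h1 x z y).trans (congrArg Neg.neg (h2 x y z))
  have h4 := fun x y z => (h2 y x z).trans (congrArg Neg.neg (h1 x y z))
  have h5 := fun x y z => (h2 z x y).trans (congrArg Neg.neg (h3 x y z))
  fin_cases i <;> fin_cases j <;> first | exact absurd rfl hij | skip
  all_goals
    simp [Equiv.swap_apply_def]
    linarith [h1 (t 0) (t 1) (t 2), h2 (t 0) (t 1) (t 2), h3 (t 0) (t 1) (t 2),
      h4 (t 0) (t 1) (t 2), h5 (t 0) (t 1) (t 2), h1 (t 0) (t 1) (t 3), h2 (t 0) (t 1) (t 3),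
      h3 (t 0) (t 1) (t 3), h4 (t 0) (t 1) (t 3), h5 (t 0) (t 1) (t 3), h1 (t 0) (t 2) (t 3),
      h2 (t 0) (t 2) (t 3), h3 (t 0) (t 2) (t 3), h4 (t 0) (t 2) (t 3), h5 (t 0) (t 2) (t 3),
      h1 (t 1) (t 2) (t 3), h2 (t 1) (t 2) (t 3), h3 (t 1) (t 2) (t 3), h4 (t 1) (t 2) (t 3),
      h5 (t 1) (t 2) (t 3)]

end Alternating
/-! ### Orientations from coherently signed facets -/

section Orientation

variable {V ι : Type} [Fintype V] [LinearOrder V] {d : ℕ}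
  {τ : ι → Fin (d + 1) → V} {h : ∀ v, ∃ i p, τ i p = v}

open Classical in
/-- The top-dimensional chain `∑ i, ε i • τ i` as a function on increasing tuples. -/
def signedChain [Fintype ι] (τ : ι → Fin (d + 1) → V) (ε : ι → ℝ) (s : Fin (d + 1) → V) : ℝ :=
  ∑ i, ∑ π : Equiv.Perm (Fin (d + 1)),
    if τ i ∘ π = s then ((Equiv.Perm.sign π : ℤ) : ℝ) * ε i else 0

theorem comp_perm_mem_simplices (i : ι)
    (π : Equiv.Perm (Fin (d + 1))) :
    τ i ∘ π ∈ simplices (facetComplex τ h) d ↔ StrictMono (τ i ∘ π) := by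
  simp only [simplices, mem_filter, mem_univ, true_and, and_iff_left_iff_imp]
  intro _
  exact ⟨⟨τ i (π 0), by simp⟩, i, by simp⟩

/-- The pairing is defined through increasing tuples and so refers to a vertex order. The
alternating extension turns it into a sum over the facets written in their natural order, where
cycle conditions and cup products can be computed without knowing the order. -/
theorem pairing_signedChain [Fintype ι] (ε : ι → ℝ)
    (f : (Fin (d + 1) → V) → ℝ) :
    pairing (facetComplex τ h) f (signedChain τ ε) = ∑ i, ε i * altExt f (τ i) := by
  classical
  simp only [pairing, signedChain, sum_mul, altExt, mul_sum]
  rw [sum_comm]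
  refine sum_congr rfl fun i _ => ?_
  rw [sum_comm]
  refine sum_congr rfl fun π _ => ?_
  simp only [ite_mul, zero_mul]
  rw [sum_ite_eq]
  simp only [comp_perm_mem_simplices]
  split_ifs <;> ring

theorem exists_of_mem_simplices {s : Fin (d + 1) → V}
    (hs : s ∈ simplices (facetComplex τ h) d) :
    ∃ i, ∃ π : Equiv.Perm (Fin (d + 1)), τ i ∘ π = s := by
  classical
  simp only [simplices, mem_filter, mem_univ, true_and] at hs
  obtain ⟨hm, -, i, hi⟩ := hs
  choose f hf using fun p => hi (s p) (by simp)
  have hfi : Function.Injective f := fun a b hab => hm.injective (by rw [← hf a, ← hf b, hab])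
  exact ⟨i, Equiv.ofBijective f (Finite.injective_iff_bijective.1 hfi), by
    ext p; exact hf p⟩

/-- Distinct facets have distinct vertex sets, so no coefficients add up or cancel. It suffices to
test the cycle on alternating cochains, because a cochain and its alternating extension agree on all
increasing tuples. -/
theorem isOrientation_signedChain [Fintype ι] (hinj : ∀ i, Function.Injective (τ i))
    (hdist : ∀ i j, Set.range (τ i) = Set.range (τ j) → i = j) {ε : ι → ℝ}
    (hε : ∀ i, ε i = 1 ∨ ε i = -1)
    (hδ : ∀ c : (Fin d → V) → ℝ, IsAlternating c → IsAlternating (coboundary c))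
    (hcyc : ∀ c : (Fin d → V) → ℝ, IsAlternating c → ∑ i, ε i * coboundary c (τ i) = 0) :
    IsOrientation (facetComplex τ h) d (signedChain τ ε) := by
  classical
  constructor
  · intro s hs
    obtain ⟨i, π, rfl⟩ := exists_of_mem_simplices hs
    have key : signedChain τ ε (τ i ∘ π) = ((Equiv.Perm.sign π : ℤ) : ℝ) * ε i := by
      rw [signedChain, sum_eq_single i, sum_eq_single π]
      · simp
      · intro ρ _ hρ
        refine if_neg fun e => hρ ?_
        ext p
        exact congrArg Fin.val (hinj i (congrFun e p))
      · simp
      · intro j _ hj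
        refine sum_eq_zero fun ρ _ => if_neg fun e => hj (hdist j i ?_)
        rw [← EquivLike.range_comp (τ i) π, ← e, EquivLike.range_comp]
      · simp
    rw [key]
    rcases Int.units_eq_one_or (Equiv.Perm.sign π) with hp | hp <;> rcases hε i with he | he <;>
      simp [hp, he]
  · intro b
    rw [pairing_signedChain, ← hcyc _ (isAlternating_altExt b)]
    refine sum_congr rfl fun i _ => ?_
    congr 1
    obtain ⟨π, hπ⟩ := exists_strictMono_comp (hinj i)
    have h1 := isAlternating_altExt (coboundary b) (τ i) π
    have h2 := hδ _ (isAlternating_altExt b) (τ i) π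
    -- Faces of an increasing tuple are increasing, so on such tuples coboundary and alternating
    -- extension commute; the sign of π then carries this to `τ i`.
    have h3 : altExt (coboundary b) (τ i ∘ π) = coboundary (altExt b) (τ i ∘ π) := by
      rw [altExt_of_strictMono _ hπ]
      refine sum_congr rfl fun k _ => ?_
      rw [altExt_of_strictMono]
      exact hπ.comp (Fin.strictMono_succAbove k)
    have h4 : ((Equiv.Perm.sign π : ℤ) : ℝ) ≠ 0 := by
      exact_mod_cast (Equiv.Perm.sign π).ne_zero
    exact mul_left_cancel₀ h4 (h1.symm.trans (h3.trans h2))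

end Orientation
end HopfBound
end

noncomputable section
namespace HopfBound
open Finset

/-! ### The Hopf invariant of a monotone simplicial map -/

section Hopf

theorem IsAlternating.eq_zero {V : Type} {n : ℕ} {c : (Fin n → V) → ℝ} (hc : IsAlternating c)
    {t : Fin n → V} {i j : Fin n} (hij : i ≠ j) (h : t i = t j) : c t = 0 := by
  have h1 := hc.swap t hij
  have h2 : t ∘ Equiv.swap i j = t := by
    ext k
    simp only [Function.comp, Equiv.swap_apply_def]
    split_ifs with h3 h4
    · rw [h3, h]
    · rw [h4, h]
    · rfl
  rw [h2] at h1
  linarith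

variable {V W ι : Type} [LinearOrder V] [LinearOrder W] {φ : V → W}

/-- An alternating cochain already vanishes on tuples with a repeated vertex, so the exceptional
value 0 in `pullback` needs no separate treatment. -/
theorem pullback_eq_of_monotone {n : ℕ} (hφ : Monotone φ) {ω : (Fin (n + 1) → W) → ℝ}
    (hω : IsAlternating ω) {s : Fin (n + 1) → V} (hs : StrictMono s) :
    pullback φ ω s = ω (φ ∘ s) := by
  classical
  rw [pullback]
  split_ifs with h
  · rfl
  · have hninj : ¬ Function.Injective (φ ∘ s) := fun hi =>
      h ((hφ.comp hs.monotone).strictMono_of_injective hi)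
    simp only [Function.Injective, not_forall] at hninj
    obtain ⟨i, j, hij, hne⟩ := hninj
    exact (hω.eq_zero hne hij).symm

variable {τ : ι → Fin 4 → V} {h : ∀ v, ∃ i p, τ i p = v}

theorem exists_face_of_mem_simplices_two [Fintype V] {s : Fin 3 → V}
    (hs : s ∈ simplices (facetComplex τ h) 2) :
    ∃ i, ∃ k : Fin 4, ∃ π : Equiv.Perm (Fin 3), s = (τ i ∘ k.succAbove) ∘ π := by
  classical
  simp only [simplices, mem_filter, mem_univ, true_and] at hs
  obtain ⟨hm, -, i, hi⟩ := hs
  choose f hf using fun p => hi (s p) (by simp)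
  have hfi : Function.Injective f := fun a b hab => hm.injective (by rw [← hf a, ← hf b, hab])
  obtain ⟨k, hk⟩ : ∃ k, k ∉ univ.image f := by
    by_contra! hall
    have h1 : (univ : Finset (Fin 4)).card ≤ (univ.image f).card :=
      card_le_card fun x _ => hall x
    have h2 : (univ.image f).card ≤ (univ : Finset (Fin 3)).card := card_image_le
    simp at h1 h2
    omega
  have hne : ∀ p, f p ≠ k := fun p e => hk (by simp [← e])
  choose g hg using fun p => Fin.exists_succAbove_eq (hne p)
  have hgi : Function.Injective g := fun a b hab => hfi (by rw [← hg a, ← hg b, hab])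
  refine ⟨i, k, Equiv.ofBijective g (Finite.injective_iff_bijective.1 hgi), ?_⟩
  ext p
  simp [hg, hf]

/-- Both sides are alternating, so the equation can be checked on the faces of the facets in the
order in which they are given. -/
theorem coboundary_eq_pullback [Fintype V] (hφ : Monotone φ) {a : (Fin 2 → V) → ℝ} (ha : IsAlternating a)
    {ω : (Fin 3 → W) → ℝ} (hω : IsAlternating ω)
    (hclosed : ∀ i (k : Fin 4),
      coboundary a (τ i ∘ k.succAbove) = ω (φ ∘ τ i ∘ k.succAbove))
    {s : Fin 3 → V} (hs : s ∈ simplices (facetComplex τ h) 2) :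
    coboundary a s = pullback φ ω s := by
  have hm : StrictMono s := by
    simp only [simplices, mem_filter] at hs
    exact hs.2.1
  rw [pullback_eq_of_monotone hφ hω hm]
  obtain ⟨i, k, π, rfl⟩ := exists_face_of_mem_simplices_two hs
  rw [ha.coboundary_two, hclosed]
  exact (hω (φ ∘ τ i ∘ k.succAbove) π).symm

/-- In an increasing tuple the second factor sees the vertices 1, 2, 3. If it is nonzero, one of
them lies over the minimum `s₀`; monotonicity forces vertex 1, hence also vertex 0, to lie over
`s₀`, and alternation forbids this for 2 and 3. So only tetrahedra with exactly two vertices over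
`s₀` can contribute. -/
theorem altExt_cup_eq_zero (hφ : Monotone φ) {a : (Fin 2 → V) → ℝ}
    {ω : (Fin 3 → W) → ℝ} (hω : IsAlternating ω) {s₀ : W} (hs₀ : ∀ x, s₀ ≤ x)
    (hsupp : ∀ u, ω u ≠ 0 → ∃ q, u q = s₀) {t : Fin 4 → V}
    (ht : (univ.filter fun p => φ (t p) = s₀).card ≠ 2) :
    altExt (cup a (pullback φ ω)) t = 0 := by
  refine sum_eq_zero fun π _ => ?_
  split_ifs with hm
  · rw [mul_eq_zero]
    right
    rw [cup]
    by_contra hne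
    have hp := right_ne_zero_of_mul hne
    have hm3 : StrictMono ![(t ∘ π) 1, (t ∘ π) 2, (t ∘ π) 3] := by
      have : ![(t ∘ π) 1, (t ∘ π) 2, (t ∘ π) 3] = (t ∘ π) ∘ Fin.succ := by
        ext i; fin_cases i <;> rfl
      rw [this]
      exact hm.comp (Fin.strictMono_succ)
    rw [pullback_eq_of_monotone hφ hω hm3] at hp
    obtain ⟨q, hq⟩ := hsupp _ hp
    have e1 : φ (t (π 1)) = s₀ := by
      refine le_antisymm ?_ (hs₀ _)
      rw [← hq]
      exact hφ (hm3.monotone (Fin.zero_le q))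
    have e0 : φ (t (π 0)) = s₀ := by
      refine le_antisymm ?_ (hs₀ _)
      rw [← e1]
      exact hφ (hm.monotone (by decide : (0 : Fin 4) ≤ 1))
    have e2 : φ (t (π 2)) ≠ s₀ := fun e =>
      hp (hω.eq_zero (i := 0) (j := 1) (by decide) (by simp [e, e1]))
    have e3 : φ (t (π 3)) ≠ s₀ := fun e =>
      hp (hω.eq_zero (i := 0) (j := 2) (by decide) (by simp [e, e1]))
    apply ht
    have : (univ.filter fun p => φ (t p) = s₀) = {π 0, π 1} := by
      ext p
      obtain ⟨p, rfl⟩ := π.surjective p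
      simp only [mem_filter, mem_univ, true_and, mem_insert, mem_singleton,
        EmbeddingLike.apply_eq_iff_eq]
      fin_cases p <;> simp [e0, e1, e2, e3]
    rw [this, card_pair]
    simp
  · rfl

/-- The two vertices over the minimum precede the other two in any order for which φ is monotone.
The only freedom left is a swap within each pair, and both sides change sign under either swap. -/
theorem altExt_cup_eq (hφ : Monotone φ) {a : (Fin 2 → V) → ℝ} (ha : IsAlternating a)
    {ω : (Fin 3 → W) → ℝ} (hω : IsAlternating ω) {s₀ : W} (hs₀ : ∀ x, s₀ ≤ x)
    {t : Fin 4 → V} (hinj : Function.Injective t) (h0 : φ (t 0) = s₀) (h1 : φ (t 1) = s₀)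
    (h2 : φ (t 2) ≠ s₀) (h3 : φ (t 3) ≠ s₀) :
    altExt (cup a (pullback φ ω)) t = a ![t 0, t 1] * ω ![s₀, φ (t 2), φ (t 3)] := by
  have sorted : ∀ t : Fin 4 → V, φ (t 0) = s₀ → φ (t 1) = s₀ →
      φ (t 2) ≠ s₀ → t 0 < t 1 → t 2 < t 3 →
      altExt (cup a (pullback φ ω)) t = a ![t 0, t 1] * ω ![s₀, φ (t 2), φ (t 3)] := by
    intro t h0 h1 h2 l01 l23
    have l12 : t 1 < t 2 := by
      by_contra hle
      exact h2 (le_antisymm ((hφ (not_lt.1 hle)).trans h1.le) (hs₀ _))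
    have hm : StrictMono t := by
      refine Fin.strictMono_iff_lt_succ.2 fun i => ?_
      fin_cases i
      · exact l01
      · exact l12
      · exact l23
    have hm3 : StrictMono ![t 1, t 2, t 3] := by
      refine Fin.strictMono_iff_lt_succ.2 fun i => ?_
      fin_cases i
      · exact l12
      · exact l23
    rw [altExt_of_strictMono _ hm, cup, pullback_eq_of_monotone hφ hω hm3]
    congr 2
    ext i; fin_cases i
    · exact h1
    · rfl
    · rfl
  have half : ∀ t : Fin 4 → V, Function.Injective t → φ (t 0) = s₀ → φ (t 1) = s₀ →
      φ (t 2) ≠ s₀ → φ (t 3) ≠ s₀ → t 2 < t 3 →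
      altExt (cup a (pullback φ ω)) t = a ![t 0, t 1] * ω ![s₀, φ (t 2), φ (t 3)] := by
    intro t hinj h0 h1 h2 h3 l23
    rcases lt_or_gt_of_ne (hinj.ne (by decide : (0 : Fin 4) ≠ 1)) with l | l
    · exact sorted t h0 h1 h2 l l23
    · have := sorted (t ∘ Equiv.swap 0 1) h1 h0 h2 l l23
      rw [(isAlternating_altExt _).swap _ (by decide)] at this
      have e : ((t ∘ Equiv.swap 0 1) 0 = t 1) ∧ ((t ∘ Equiv.swap 0 1) 1 = t 0) ∧
        ((t ∘ Equiv.swap 0 1) 2 = t 2) ∧ ((t ∘ Equiv.swap 0 1) 3 = t 3) := ⟨rfl, rfl, rfl, rfl⟩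
      rw [e.1, e.2.1, e.2.2.1, e.2.2.2, ha.swap_two] at this
      linarith
  rcases lt_or_gt_of_ne (hinj.ne (by decide : (2 : Fin 4) ≠ 3)) with l | l
  · exact half t hinj h0 h1 h2 h3 l
  · have := half (t ∘ Equiv.swap 2 3) (hinj.comp (Equiv.injective _)) h0 h1 h3 h2 l
    rw [(isAlternating_altExt _).swap _ (by decide)] at this
    have e : ((t ∘ Equiv.swap 2 3) 0 = t 0) ∧ ((t ∘ Equiv.swap 2 3) 1 = t 1) ∧
      ((t ∘ Equiv.swap 2 3) 2 = t 3) ∧ ((t ∘ Equiv.swap 2 3) 3 = t 2) := ⟨rfl, rfl, rfl, rfl⟩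
    rw [e.1, e.2.1, e.2.2.1, e.2.2.2, hω.swap_three'] at this
    linarith

end Hopf
end HopfBound
end

noncomputable section
namespace HopfBound
open Finset

/-! ### Staircase triangulations of products with a circle -/

section Staircase

variable {B : Type}

/-- The `p`-th vertex of the `m`-th tetrahedron of the triangulated prism over an edge
`j → j + 1` of the triangle `ZMod 3`. -/
def stair (m : Fin 3) (j : ZMod 3) (p : Fin 4) : Fin 3 × ZMod 3 :=
  (m.predAbove p, if p ≤ m.castSucc then j else j + 1)

theorem stair_zero (j : ZMod 3) : stair 0 j = ![(0, j), (0, j + 1), (1, j + 1), (2, j + 1)] := by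
  ext p <;> fin_cases p <;> rfl

theorem stair_one (j : ZMod 3) : stair 1 j = ![(0, j), (1, j), (1, j + 1), (2, j + 1)] := by
  ext p <;> fin_cases p <;> rfl

theorem stair_two (j : ZMod 3) : stair 2 j = ![(0, j), (1, j), (2, j), (2, j + 1)] := by
  ext p <;> fin_cases p <;> rfl

theorem stair_injective (m : Fin 3) (j : ZMod 3) : Function.Injective (stair m j) := by
  revert m j; decide

theorem sum_zmod_three_add_one (f : ZMod 3 → ℝ) : ∑ j, f (j + 1) = ∑ j, f j :=
  Equiv.sum_comp (Equiv.addRight (1 : ZMod 3)) f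

/-- The cochain on edges which integrates `c` over the triangulated annulus over the edge. -/
def fibreSum {V : Type} (c : (Fin 3 → V) → ℝ) (x y : ZMod 3 → V) : ℝ :=
  ∑ j, (c ![x j, x (j + 1), y (j + 1)] - c ![x j, y j, y (j + 1)])

/-- This is ∂(Δ × S¹) = ±∂Δ × S¹. Inner triangles between consecutive tetrahedra cancel, and the
horizontal triangles cancel after a shift around the circle. -/
theorem sum_stair {V : Type} (c : (Fin 3 → V) → ℝ) (v : Fin 3 → ZMod 3 → V) :
    ∑ j, ∑ m : Fin 3, (-1) ^ (m : ℕ) *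
      coboundary c (fun p => v (stair m j p).1 (stair m j p).2) =
    -(fibreSum c (v 1) (v 2) - fibreSum c (v 0) (v 2) + fibreSum c (v 0) (v 1)) := by
  have h := sum_zmod_three_add_one fun j => c ![v 0 j, v 1 j, v 2 j]
  simp only [Fin.sum_univ_three, coboundary_eq_three, stair_zero, stair_one, stair_two, fibreSum]
  rw [← sum_sub_distrib, ← sum_add_distrib, ← sum_neg_distrib, ← sub_eq_zero, ← sum_sub_distrib]
  rw [← sub_eq_zero, ← sum_sub_distrib] at h
  rw [← h]
  refine sum_congr rfl fun j _ => ?_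
  simp
  ring

end Staircase

/-! ### Surfaces with two boundary triangles -/

/-- A triangulated compact oriented surface with two boundary triangles `c false` and `c true`,
together with an orientation `lt` of the edges that is acyclic on each triangle, and a closed
cochain `η` which has integral `3` over the boundary triangles. -/
structure Band (W Tri : Type) [Fintype Tri] where
  tri : Tri → Fin 3 → W
  sgn : Tri → ℤ
  c : Bool → ZMod 3 → W
  idx : W → ZMod 3
  lt : W → W → Prop
  η : W → W → ℤ
  c_inj : ∀ σ σ' i i', c σ i = c σ' i' → σ = σ' ∧ i = i'
  idx_c : ∀ σ i, idx (c σ i) = i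
  tri_inj : ∀ T, Function.Injective (tri T)
  tri_dist : ∀ T T', Set.range (tri T) = Set.range (tri T') → T = T'
  cover : ∀ w, ∃ T p, tri T p = w
  lt_asymm : ∀ w w', lt w w' → ¬ lt w' w
  tri_lt : ∀ T p q, p < q → lt (tri T p) (tri T q)
  c_edge : ∀ σ i, ∃ T p q, p < q ∧ tri T p = c σ i ∧ tri T q = c σ (i + 1)
  sgn_eq : ∀ T, sgn T = 1 ∨ sgn T = -1
  bdry : ∀ q : W → W → ℝ, (∀ x y, q y x = -q x y) →
    ∑ T, sgn T * (q (tri T 1) (tri T 2) - q (tri T 0) (tri T 2) + q (tri T 0) (tri T 1)) =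
      ∑ i, q (c false i) (c false (i + 1)) - ∑ i, q (c true i) (c true (i + 1))
  η_anti : ∀ x y, η y x = -η x y
  η_closed : ∀ T, η (tri T 1) (tri T 2) - η (tri T 0) (tri T 2) + η (tri T 0) (tri T 1) = 0
  η_c : ∀ σ i, η (c σ i) (c σ (i + 1)) = 1

/-! ### Filling the boundary tori by layered solid tori -/

/-- The vertices of the closed `3`-manifold made of `band × circle` and two layered solid tori
with `n` layers each. -/
inductive Vert (W : Type) (n : ℕ) : Type
  | base : W → ZMod 3 → Vert W n
  | inn : Bool → Fin n → ZMod 3 → ZMod 3 → Vert W n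
  | core : Bool → ZMod 3 → Vert W n

/-- Vertices as a disjoint union. -/
def Vert.toSum {W : Type} {n : ℕ} :
    Vert W n → (W × ZMod 3) ⊕ (Bool × Fin n × ZMod 3 × ZMod 3) ⊕ (Bool × ZMod 3)
  | .base w j => .inl (w, j)
  | .inn σ k i j => .inr (.inl (σ, k, i, j))
  | .core σ j => .inr (.inr (σ, j))

theorem Vert.toSum_injective {W : Type} {n : ℕ} : Function.Injective (@Vert.toSum W n) := by
  intro x y h
  cases x <;> cases y <;> simp_all [Vert.toSum]

instance {W : Type} [Fintype W] {n : ℕ} : Fintype (Vert W n) :=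
  Fintype.ofInjective _ Vert.toSum_injective

section Filling

variable {W Tri : Type} [Fintype Tri] (D : Band W Tri) (n : ℕ)

/-- The vertices of the `k`-th level torus of a layered solid torus. -/
def lv (σ : Bool) (k : ℕ) (i j : ZMod 3) : Vert W n :=
  if h : k < n then .inn σ ⟨k, h⟩ i j else .base (D.c σ i) j

/-- The prisms of the triangulation: those over triangles of the band, those of the layers, and
those around the two core circles. -/
abbrev Tag (Tri : Type) (n : ℕ) : Type := Tri ⊕ (Bool × Fin n × ZMod 3 × Bool) ⊕ (Bool × ZMod 3)

/-- The vertices of the prisms. -/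
def prism : Tag Tri n → Fin 3 → ZMod 3 → Vert W n
  | .inl T => fun p j => .base (D.tri T p) j
  | .inr (.inl (σ, k, i, false)) =>
      ![fun j => lv D n σ k j (i + 1 + j), fun j => lv D n σ k j (i + j),
        fun j => lv D n σ (k + 1) (i + 1) j]
  | .inr (.inl (σ, k, i, true)) =>
      ![fun j => lv D n σ k j (i + j), fun j => lv D n σ (k + 1) i j,
        fun j => lv D n σ (k + 1) (i + 1) j]
  | .inr (.inr (false, j)) =>
      ![fun i => .core false i, fun i => lv D n false 0 i j, fun i => lv D n false 0 i (j + 1)]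
  | .inr (.inr (true, i)) =>
      ![fun j => .core true j, fun j => lv D n true 0 i j, fun j => lv D n true 0 (i + 1) j]

/-- The sign of a prism. -/
def prismSign : Tag Tri n → ℤ
  | .inl T => D.sgn T
  | .inr (.inl (σ, k, _, _)) => (if σ then -1 else 1) * (-1) ^ (n + (k : ℕ))
  | .inr (.inr _) => (-1) ^ n

/-- Indices of the tetrahedra. -/
abbrev TetIndex (Tri : Type) (n : ℕ) : Type := Tag Tri n × ZMod 3 × Fin 3

/-- The tetrahedra. -/
def tet (x : TetIndex Tri n) (p : Fin 4) : Vert W n :=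
  prism D n x.1 (stair x.2.2 x.2.1 p).1 (stair x.2.2 x.2.1 p).2

/-- The signs of the tetrahedra. -/
def tetSign (x : TetIndex Tri n) : ℝ := prismSign D n x.1 * (-1) ^ (x.2.2 : ℕ)

/-- The value of `c` on the fundamental cycle of a level torus. -/
def levelSum (c : (Fin 3 → Vert W n) → ℝ) (σ : Bool) (k : ℕ) : ℝ :=
  ∑ i, ∑ j, (c ![lv D n σ k i j, lv D n σ k i (j + 1), lv D n σ k (i + 1) (j + 1)] -
    c ![lv D n σ k i j, lv D n σ k (i + 1) j, lv D n σ k (i + 1) (j + 1)])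

variable {c : (Fin 3 → Vert W n) → ℝ}

/-- Integrating over the circle factor reduces the cycle condition in dimension three to a boundary
computation for the triangles of the cross-sections. -/
theorem sum_tet (c : (Fin 3 → Vert W n) → ℝ) :
    ∑ x, tetSign D n x * coboundary c (tet D n x) =
      -∑ T, prismSign D n T * (fibreSum c (prism D n T 1) (prism D n T 2) -
        fibreSum c (prism D n T 0) (prism D n T 2) +
        fibreSum c (prism D n T 0) (prism D n T 1)) := by
  rw [Fintype.sum_prod_type, ← sum_neg_distrib]
  refine sum_congr rfl fun T _ => ?_
  rw [Fintype.sum_prod_type, ← mul_neg, ← sum_stair, mul_sum]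
  refine sum_congr rfl fun j _ => ?_
  rw [mul_sum]
  refine sum_congr rfl fun m _ => ?_
  rw [tetSign, mul_assoc]
  rfl

theorem sum_band :
    ∑ T, (D.sgn T : ℝ) * (fibreSum c (prism D n (.inl T) 1) (prism D n (.inl T) 2) -
      fibreSum c (prism D n (.inl T) 0) (prism D n (.inl T) 2) +
      fibreSum c (prism D n (.inl T) 0) (prism D n (.inl T) 1)) =
    levelSum D n c false n - levelSum D n c true n := by
  classical
  -- `fibreSum` is not antisymmetric, since the diagonals of the annulus over an edge depend on its
  -- direction. The edge orientation `lt` selects the direction that occurs, and q is extended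
  -- antisymmetrically so that `bdry` applies.
  let q : W → W → ℝ := fun x y =>
    if D.lt x y then fibreSum c (Vert.base x) (Vert.base y)
    else if D.lt y x then -fibreSum c (Vert.base y) (Vert.base x) else 0
  have hq : ∀ x y, q y x = -q x y := by
    intro x y
    simp only [q]
    split_ifs with h1 h2
    · exact absurd h2 (D.lt_asymm _ _ h1)
    all_goals simp
  have hlt : ∀ x y, D.lt x y → q x y = fibreSum c (Vert.base x) (Vert.base y) :=
    fun x y h => if_pos h
  have hc : ∀ σ i, D.lt (D.c σ i) (D.c σ (i + 1)) := by
    intro σ i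
    obtain ⟨T, p, q, hpq, hp, hq⟩ := D.c_edge σ i
    rw [← hp, ← hq]
    exact D.tri_lt T p q hpq
  have h := D.bdry q hq
  simp only [hlt _ _ (D.tri_lt _ _ _ (by decide : (0 : Fin 3) < 1)),
    hlt _ _ (D.tri_lt _ _ _ (by decide : (0 : Fin 3) < 2)),
    hlt _ _ (D.tri_lt _ _ _ (by decide : (1 : Fin 3) < 2)), hlt _ _ (hc _ _)] at h
  refine h.trans ?_
  simp only [fibreSum, levelSum, lv, lt_irrefl, dite_false]

/-- The edges joining the two boundary circles cancel. Under (x, j) ↦ (j, x + j) the reversed lower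
edges make the three edge directions of the lower torus correspond to (0, 1), (1, 1) and (1, 0), so
its triangles are those of the level torus. The gluing reverses orientation; hence the plus sign
here and the alternating signs of the layers in `prismSign`. -/
theorem sum_slab (hc : IsAlternating c) (σ : Bool) (k : Fin n) :
    ∑ i, ∑ u, (fibreSum c (prism D n (.inr (.inl (σ, k, i, u))) 1)
        (prism D n (.inr (.inl (σ, k, i, u))) 2) -
      fibreSum c (prism D n (.inr (.inl (σ, k, i, u))) 0)
        (prism D n (.inr (.inl (σ, k, i, u))) 2) +
      fibreSum c (prism D n (.inr (.inl (σ, k, i, u))) 0)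
        (prism D n (.inr (.inl (σ, k, i, u))) 1)) =
    levelSum D n c σ (k + 1) + levelSum D n c σ k := by
  have e1 := sum_zmod_three_add_one fun i =>
    fibreSum c (fun j => lv D n σ k j (i + j)) (fun j => lv D n σ (k + 1) i j)
  have e2 : ∑ i, fibreSum c (fun j => lv D n σ k j (i + 1 + j)) (fun j => lv D n σ k j (i + j)) =
      levelSum D n c σ k := by
    have s1 := hc.swap_three'
    have s2 := hc.swap_three
    simp only [fibreSum, levelSum, sum_sub_distrib]
    have f1 : ∑ i, ∑ j, c ![lv D n σ k j (i + 1 + j), lv D n σ k (j + 1) (i + 1 + (j + 1)),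
        lv D n σ k (j + 1) (i + (j + 1))] =
        -∑ i, ∑ j, c ![lv D n σ k i j, lv D n σ k (i + 1) j, lv D n σ k (i + 1) (j + 1)] := by
      rw [sum_comm, ← sum_neg_distrib]
      refine sum_congr rfl fun j _ => ?_
      rw [← sum_neg_distrib]
      refine Fintype.sum_equiv (Equiv.addRight (1 + j)) _ _ fun i => ?_
      rw [s1]
      simp only [Equiv.coe_addRight]
      congr 3
      · ring_nf
      · congr 2 <;> ring_nf
    have f2 : ∑ i, ∑ j, c ![lv D n σ k j (i + 1 + j), lv D n σ k j (i + j),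
        lv D n σ k (j + 1) (i + (j + 1))] =
        -∑ i, ∑ j, c ![lv D n σ k i j, lv D n σ k i (j + 1), lv D n σ k (i + 1) (j + 1)] := by
      rw [sum_comm, ← sum_neg_distrib]
      refine sum_congr rfl fun j _ => ?_
      rw [← sum_neg_distrib]
      refine Fintype.sum_equiv (Equiv.addRight j) _ _ fun i => ?_
      rw [s2]
      simp only [Equiv.coe_addRight]
      congr 3
      congr 2 <;> ring_nf
    rw [f1, f2]
    ring
  rw [← e2, levelSum]
  simp only [Fintype.sum_bool, prism, Matrix.cons_val_zero, Matrix.cons_val_one, Matrix.cons_val]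
  simp only [sum_add_distrib, sum_sub_distrib] at e1 ⊢
  rw [e1]
  simp only [fibreSum, sum_sub_distrib]
  ring

/-- Here the cone is over the second circle factor and the product is with the first. The
interchange of the factors produces the minus sign, in contrast to `sum_core_true`. -/
theorem sum_core_false :
    ∑ j, (fibreSum c (prism D n (.inr (.inr (false, j))) 1)
        (prism D n (.inr (.inr (false, j))) 2) -
      fibreSum c (prism D n (.inr (.inr (false, j))) 0)
        (prism D n (.inr (.inr (false, j))) 2) +
      fibreSum c (prism D n (.inr (.inr (false, j))) 0)
        (prism D n (.inr (.inr (false, j))) 1)) =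
    -levelSum D n c false 0 := by
  have e1 := sum_zmod_three_add_one fun j =>
    fibreSum c (fun i => Vert.core false i) (fun i => lv D n false 0 i j)
  simp only [prism, Matrix.cons_val_zero, Matrix.cons_val_one, Matrix.cons_val]
  simp only [sum_add_distrib, sum_sub_distrib]
  rw [e1, levelSum]
  simp only [fibreSum, sum_sub_distrib]
  rw [sum_comm, sum_comm (f := fun i j =>
    c ![lv D n false 0 i j, lv D n false 0 i (j + 1), lv D n false 0 (i + 1) (j + 1)])]
  rw [sum_comm]
  ring

theorem sum_core_true :
    ∑ i, (fibreSum c (prism D n (.inr (.inr (true, i))) 1)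
        (prism D n (.inr (.inr (true, i))) 2) -
      fibreSum c (prism D n (.inr (.inr (true, i))) 0)
        (prism D n (.inr (.inr (true, i))) 2) +
      fibreSum c (prism D n (.inr (.inr (true, i))) 0)
        (prism D n (.inr (.inr (true, i))) 1)) =
    levelSum D n c true 0 := by
  have e1 := sum_zmod_three_add_one fun i =>
    fibreSum c (fun j => Vert.core true j) (fun j => lv D n true 0 i j)
  simp only [prism, Matrix.cons_val_zero, Matrix.cons_val_one, Matrix.cons_val]
  simp only [sum_add_distrib, sum_sub_distrib]
  rw [e1, levelSum]
  simp only [fibreSum, sum_sub_distrib]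
  ring

theorem sum_tet_eq_zero (hc : IsAlternating c) :
    ∑ x, tetSign D n x * coboundary c (tet D n x) = 0 := by
  -- The sums over the layers telescope, leaving the outer torus, which cancels against the band,
  -- and level 0, which cancels against the core.
  have tele : ∀ σ, ∑ k : Fin n, (-1 : ℝ) ^ (n + (k : ℕ)) *
      (levelSum D n c σ (k + 1) + levelSum D n c σ k) =
      (-1) ^ n * levelSum D n c σ 0 - levelSum D n c σ n := by
    intro σ
    rw [Fin.sum_univ_eq_sum_range fun k => (-1 : ℝ) ^ (n + k) *
      (levelSum D n c σ (k + 1) + levelSum D n c σ k)]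
    have := sum_range_sub' (fun k => (-1 : ℝ) ^ (n + k) * levelSum D n c σ k) n
    rw [← two_mul, pow_mul] at this
    simp only [even_two, Even.neg_pow, one_pow, one_mul, add_zero] at this
    rw [← this]
    refine sum_congr rfl fun k _ => ?_
    rw [← add_assoc, pow_succ]
    ring
  let X : Tag Tri n → ℝ := fun T => fibreSum c (prism D n T 1) (prism D n T 2) -
    fibreSum c (prism D n T 0) (prism D n T 2) + fibreSum c (prism D n T 0) (prism D n T 1)
  have hslab : ∀ σ, ∑ k : Fin n, ∑ i, ∑ u, (prismSign D n (.inr (.inl (σ, k, i, u))) : ℝ) *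
      X (.inr (.inl (σ, k, i, u))) =
      (if σ then -1 else 1) * ((-1) ^ n * levelSum D n c σ 0 - levelSum D n c σ n) := by
    intro σ
    rw [← tele, mul_sum]
    refine sum_congr rfl fun k _ => ?_
    rw [← sum_slab D n hc σ k, mul_sum, mul_sum]
    refine sum_congr rfl fun i _ => ?_
    rw [mul_sum, mul_sum]
    refine sum_congr rfl fun u _ => ?_
    simp only [prismSign, X]
    cases σ <;> push_cast <;> simp [mul_assoc]
  have hband : ∑ T, (prismSign D n (.inl T) : ℝ) * X (.inl T) =
      levelSum D n c false n - levelSum D n c true n := sum_band D n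
  have hcf : ∑ j, (prismSign D n (.inr (.inr (false, j))) : ℝ) * X (.inr (.inr (false, j))) =
      (-1) ^ n * -levelSum D n c false 0 := by
    rw [← sum_core_false, mul_sum]
    simp [prismSign, X]
  have hct : ∑ j, (prismSign D n (.inr (.inr (true, j))) : ℝ) * X (.inr (.inr (true, j))) =
      (-1) ^ n * levelSum D n c true 0 := by
    rw [← sum_core_true, mul_sum]
    simp [prismSign, X]
  rw [sum_tet, neg_eq_zero]
  change ∑ T, (prismSign D n T : ℝ) * X T = 0
  rw [Fintype.sum_sum_type, Fintype.sum_sum_type, hband]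
  simp only [Fintype.sum_prod_type] at hslab ⊢
  rw [Fintype.sum_bool, Fintype.sum_bool, hslab, hslab, hcf, hct]
  simp only [if_true, Bool.false_eq_true, if_false]
  ring

end Filling
end HopfBound
end

noncomputable section
namespace HopfBound
open Finset

/-! ### The filled band as a simplicial complex: tetrahedra are nondegenerate and pairwise distinct
-/

section FillingComplex

variable {W Tri : Type} [Fintype Tri] (D : Band W Tri) (n : ℕ)

/-- The triangles of the annulus `C₃ × [0, 1]`, whose lower boundary edges are reversed. -/
def slabTri (i : ZMod 3) : Bool → Fin 3 → Bool × ZMod 3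
  | false => ![(false, i + 1), (false, i), (true, i + 1)]
  | true => ![(false, i), (true, i), (true, i + 1)]

/-- The triangles of the cone over `C₃`. -/
def coneTri (j : ZMod 3) : Fin 3 → Option (ZMod 3) := ![none, some j, some (j + 1)]

/-- The vertices of a layer. -/
def slabVert (σ : Bool) (k : ℕ) : Bool × ZMod 3 → ZMod 3 → Vert W n
  | (false, x), j => lv D n σ k j (x + j)
  | (true, x), j => lv D n σ (k + 1) x j

/-- The vertices around a core circle. -/
def coneVert : Bool → Option (ZMod 3) → ZMod 3 → Vert W n
  | σ, none, i => .core σ i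
  | false, some j, i => lv D n false 0 i j
  | true, some i, j => lv D n true 0 i j

theorem prism_slab (σ : Bool) (k : Fin n) (i : ZMod 3) (u : Bool) (p : Fin 3) (j : ZMod 3) :
    prism D n (.inr (.inl (σ, k, i, u))) p j = slabVert D n σ k (slabTri i u p) j := by
  cases u <;> fin_cases p <;> rfl

theorem prism_cone (σ : Bool) (i : ZMod 3) (p : Fin 3) (j : ZMod 3) :
    prism D n (.inr (.inr (σ, i))) p j = coneVert D n σ (coneTri i p) j := by
  cases σ <;> fin_cases p <;> rfl

variable {D n}

theorem lv_of_lt {σ : Bool} {k : ℕ} (h : k < n) (i j : ZMod 3) :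
    lv D n σ k i j = .inn σ ⟨k, h⟩ i j := dif_pos h

theorem lv_last (σ : Bool) (i j : ZMod 3) : lv D n σ n i j = .base (D.c σ i) j :=
  dif_neg (lt_irrefl n)

theorem lv_inj {σ σ' : Bool} {k k' : ℕ} (hk : k ≤ n) (hk' : k' ≤ n) {i i' j j' : ZMod 3}
    (h : lv D n σ k i j = lv D n σ' k' i' j') : σ = σ' ∧ k = k' ∧ i = i' ∧ j = j' := by
  rcases hk.lt_or_eq with hk | rfl <;> rcases hk'.lt_or_eq with hk' | hk'
  · rw [lv_of_lt hk, lv_of_lt hk'] at h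
    simpa using h
  · subst hk'
    rw [lv_of_lt hk, lv_last] at h
    cases h
  · rw [lv_of_lt hk', lv_last] at h
    cases h
  · subst hk'
    rw [lv_last, lv_last] at h
    simp only [Vert.base.injEq] at h
    obtain ⟨h1, h2⟩ := D.c_inj _ _ _ _ h.1
    exact ⟨h1, rfl, h2, h.2⟩

theorem slabVert_inj {σ : Bool} {k : ℕ} (hk : k < n) {x x' : Bool × ZMod 3} {j j' : ZMod 3}
    (h : slabVert D n σ k x j = slabVert D n σ k x' j') : x = x' ∧ j = j' := by
  obtain ⟨_ | _, x⟩ := x <;> obtain ⟨_ | _, x'⟩ := x' <;> simp only [slabVert] at h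
  · obtain ⟨-, -, rfl, h⟩ := lv_inj hk.le hk.le h
    exact ⟨by rw [add_right_cancel h], rfl⟩
  · have := (lv_inj hk.le hk h).2.1
    omega
  · have := (lv_inj hk hk.le h).2.1
    omega
  · obtain ⟨-, -, rfl, rfl⟩ := lv_inj hk hk h
    exact ⟨rfl, rfl⟩

theorem coneVert_inj {σ : Bool} {x x' : Option (ZMod 3)} {j j' : ZMod 3}
    (h : coneVert D n σ x j = coneVert D n σ x' j') : x = x' ∧ j = j' := by
  have hne : ∀ σ σ' i j j', lv D n σ 0 i j ≠ .core σ' j' := by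
    intro σ σ' i j j' h
    rw [lv] at h
    split_ifs at h
  rcases σ with _ | _ <;> rcases x with _ | x <;> rcases x' with _ | x' <;>
    simp only [coneVert] at h
  · simpa using h
  · exact absurd h.symm (hne _ _ _ _ _)
  · exact absurd h (hne _ _ _ _ _)
  · obtain ⟨-, -, rfl, rfl⟩ := lv_inj (Nat.zero_le n) (Nat.zero_le n) h
    exact ⟨rfl, rfl⟩
  · simpa using h
  · exact absurd h.symm (hne _ _ _ _ _)
  · exact absurd h (hne _ _ _ _ _)
  · obtain ⟨-, -, rfl, rfl⟩ := lv_inj (Nat.zero_le n) (Nat.zero_le n) h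
    exact ⟨rfl, rfl⟩

theorem slabTri_injective (i : ZMod 3) (u : Bool) : Function.Injective (slabTri i u) := by
  revert i u; decide

theorem coneTri_injective (i : ZMod 3) : Function.Injective (coneTri i) := by
  revert i; decide

theorem prism_inj {T : Tag Tri n} {p p' : Fin 3} {j j' : ZMod 3}
    (h : prism D n T p j = prism D n T p' j') : p = p' ∧ j = j' := by
  rcases T with T | ⟨σ, k, i, u⟩ | ⟨σ, i⟩
  · simp only [prism, Vert.base.injEq] at h
    exact ⟨D.tri_inj T h.1, h.2⟩
  · rw [prism_slab, prism_slab] at h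
    obtain ⟨h1, h2⟩ := slabVert_inj k.2 h
    exact ⟨slabTri_injective i u h1, h2⟩
  · rw [prism_cone, prism_cone] at h
    obtain ⟨h1, h2⟩ := coneVert_inj h
    exact ⟨coneTri_injective i h1, h2⟩

theorem tet_injective (x : TetIndex Tri n) : Function.Injective (tet D n x) := by
  intro p q h
  obtain ⟨h1, h2⟩ := prism_inj h
  exact stair_injective _ _ (Prod.ext h1 h2)

theorem slabTri_dist : ∀ (i : ZMod 3) (u : Bool) (i' : ZMod 3) (u' : Bool),
    (∀ p, ∃ q, slabTri i u p = slabTri i' u' q) → i = i' ∧ u = u' := by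
  decide

theorem coneTri_dist : ∀ i i' : ZMod 3, (∀ p, ∃ q, coneTri i p = coneTri i' q) → i = i' := by
  decide

theorem stair_dist : ∀ (m : Fin 3) (j : ZMod 3) (m' : Fin 3) (j' : ZMod 3),
    (∀ p, ∃ q, stair m j p = stair m' j' q) → m = m' ∧ j = j' := by
  decide

theorem exists_stair_fst : ∀ (m : Fin 3) (j : ZMod 3) (p : Fin 3), ∃ q, (stair m j q).1 = p := by
  decide

theorem prism_slab_zero (σ : Bool) (k : Fin n) (i : ZMod 3) (u : Bool) (j : ZMod 3) :
    ∃ x y, prism D n (.inr (.inl (σ, k, i, u))) 0 j = .inn σ k x y := by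
  cases u
  · exact ⟨_, _, lv_of_lt k.2 _ _⟩
  · exact ⟨_, _, lv_of_lt k.2 _ _⟩

theorem slabVert_eq (σ : Bool) (k : Fin n) (x : Bool × ZMod 3) (j : ZMod 3) :
    (∃ y z, slabVert D n σ k x j = .inn σ k y z) ∨
      (∃ (h : (k : ℕ) + 1 < n), ∃ y z, slabVert D n σ k x j = .inn σ ⟨k + 1, h⟩ y z) ∨
      ∃ w z, slabVert D n σ k x j = .base w z := by
  obtain ⟨_ | _, x⟩ := x
  · exact .inl ⟨_, _, lv_of_lt k.2 _ _⟩
  · right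
    simp only [slabVert, lv]
    split_ifs with h
    · exact .inl ⟨h, _, _, rfl⟩
    · exact .inr ⟨_, _, rfl⟩

/-- The kinds of vertices distinguish band, layers and cores. A prism of layer k has a vertex in
level k and otherwise only vertices in levels k and k + 1, so mutual inclusion forces equal layers;
inside one layer the claim is about the triangles of the annulus. -/
theorem tag_eq {T T' : Tag Tri n} (h : ∀ p, ∃ j q j', prism D n T p j = prism D n T' q j')
    (h' : ∀ p, ∃ j q j', prism D n T' p j = prism D n T q j') : T = T' := by
  rcases T with T | ⟨σ, k, i, u⟩ | ⟨σ, i⟩ <;> rcases T' with T' | ⟨σ', k', i', u'⟩ | ⟨σ', i'⟩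
  · congr 1
    refine D.tri_dist T T' (Set.Subset.antisymm ?_ ?_)
    · rintro _ ⟨p, rfl⟩
      obtain ⟨j, q, j', e⟩ := h p
      simp only [prism, Vert.base.injEq] at e
      exact ⟨q, e.1.symm⟩
    · rintro _ ⟨p, rfl⟩
      obtain ⟨j, q, j', e⟩ := h' p
      simp only [prism, Vert.base.injEq] at e
      exact ⟨q, e.1.symm⟩
  · obtain ⟨j, q, j', e⟩ := h' 0
    obtain ⟨x, y, e'⟩ := prism_slab_zero (D := D) σ' k' i' u' j
    rw [e'] at e
    cases e
  · obtain ⟨j, q, j', e⟩ := h' 0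
    rw [prism_cone] at e
    simp [coneTri, coneVert, prism] at e
  · obtain ⟨j, q, j', e⟩ := h 0
    obtain ⟨x, y, e'⟩ := prism_slab_zero (D := D) σ k i u j
    rw [e'] at e
    cases e
  · obtain ⟨j, q, j', e⟩ := h 0
    obtain ⟨j2, q2, j2', e2⟩ := h' 0
    obtain ⟨x, y, f⟩ := prism_slab_zero (D := D) σ k i u j
    obtain ⟨x', y', f'⟩ := prism_slab_zero (D := D) σ' k' i' u' j2
    rw [f, prism_slab] at e
    rw [f', prism_slab] at e2
    have hσ : σ = σ' ∧ (k = k' ∨ (k : ℕ) = k' + 1) := by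
      rcases slabVert_eq (D := D) σ' k' (slabTri i' u' q) j' with ⟨y, z, g⟩ | ⟨hk, y, z, g⟩ |
        ⟨y, z, g⟩ <;> rw [g] at e <;> simp at e
      · exact ⟨e.1, .inl e.2.1⟩
      · exact ⟨e.1, .inr (congrArg Fin.val e.2.1)⟩
    have hσ' : k' = k ∨ (k' : ℕ) = k + 1 := by
      rcases slabVert_eq (D := D) σ k (slabTri i u q2) j2' with ⟨y, z, g⟩ | ⟨hk, y, z, g⟩ |
        ⟨y, z, g⟩ <;> rw [g] at e2 <;> simp at e2
      · exact .inl e2.2.1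
      · exact .inr (congrArg Fin.val e2.2.1)
    obtain ⟨rfl, hk⟩ := hσ
    have hkk : k = k' := by
      rcases hk with hk | hk
      · exact hk
      · rcases hσ' with h1 | h1
        · exact h1.symm
        · omega
    subst hkk
    obtain ⟨rfl, rfl⟩ := slabTri_dist i u i' u' fun p => by
      obtain ⟨j, q, j', e⟩ := h p
      rw [prism_slab, prism_slab] at e
      exact ⟨q, (slabVert_inj k.2 e).1⟩
    rfl
  · obtain ⟨j, q, j', e⟩ := h' 0
    rw [prism_cone, prism_slab] at e
    rcases slabVert_eq (D := D) σ k (slabTri i u q) j' with ⟨y, z, g⟩ | ⟨hk, y, z, g⟩ |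
        ⟨y, z, g⟩ <;> rw [g] at e <;> simp [coneTri, coneVert] at e
  · obtain ⟨j, q, j', e⟩ := h 0
    rw [prism_cone] at e
    simp [coneTri, coneVert, prism] at e
  · obtain ⟨j, q, j', e⟩ := h 0
    rw [prism_cone, prism_slab] at e
    rcases slabVert_eq (D := D) σ' k' (slabTri i' u' q) j' with ⟨y, z, g⟩ | ⟨hk, y, z, g⟩ |
        ⟨y, z, g⟩ <;> rw [g] at e <;> simp [coneTri, coneVert] at e
  · have hσ : σ = σ' := by
      obtain ⟨j, q, j', e⟩ := h 0
      rw [prism_cone, prism_cone] at e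
      rcases hx : coneTri i' q with _ | x
      · rw [hx] at e
        simp [coneTri, coneVert] at e
        exact e.1
      · rw [hx] at e
        cases σ' <;> simp [coneTri, coneVert, lv] at e <;> split_ifs at e
    subst hσ
    rw [coneTri_dist i i' fun p => ?_]
    obtain ⟨j, q, j', e⟩ := h p
    rw [prism_cone, prism_cone] at e
    exact ⟨q, (coneVert_inj e).1⟩

/-- Each staircase tetrahedron meets all three vertical circles of its prism, so its vertices
determine the prism by `tag_eq`, and then its place in the staircase. -/
theorem tet_dist (x y : TetIndex Tri n) (h : Set.range (tet D n x) = Set.range (tet D n y)) :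
    x = y := by
  have sub : ∀ x y : TetIndex Tri n, Set.range (tet D n x) = Set.range (tet D n y) →
      ∀ p, ∃ j q j', prism D n x.1 p j = prism D n y.1 q j' := by
    rintro ⟨T, j, m⟩ ⟨T', j', m'⟩ h p
    obtain ⟨q, hq⟩ := exists_stair_fst m j p
    obtain ⟨q', hq'⟩ := h ▸ Set.mem_range_self (f := tet D n (T, j, m)) q
    subst hq
    exact ⟨_, _, _, hq'.symm⟩
  have hT := tag_eq (sub x y h) (sub y x h.symm)
  obtain ⟨T, j, m⟩ := x
  obtain ⟨T', j', m'⟩ := y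
  obtain rfl : T = T' := hT
  obtain ⟨rfl, rfl⟩ := stair_dist m j m' j' fun p => by
    obtain ⟨q, hq⟩ := h ▸ Set.mem_range_self (f := tet D n (T, j, m)) p
    obtain ⟨h1, h2⟩ := prism_inj hq
    exact ⟨q, (Prod.ext h1 h2).symm⟩
  rfl

theorem exists_tet_eq (T : Tag Tri n) (p : Fin 3) (j : ZMod 3) :
    ∃ x q, tet D n x q = prism D n T p j := by
  obtain ⟨q, hq⟩ : ∃ q, stair 2 j q = (p, j) := by revert p j; decide
  exact ⟨(T, j, 2), q, by simp only [tet, hq]⟩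

theorem tet_cover (v : Vert W n) : ∃ x p, tet D n x p = v := by
  rcases v with ⟨w, j⟩ | ⟨σ, k, i, j⟩ | ⟨σ, j⟩
  · obtain ⟨T, p, rfl⟩ := D.cover w
    exact exists_tet_eq (.inl T) p j
  -- The vertex (i, j) of level k has the coordinates (j - i, i) in the layer above it.
  · obtain ⟨x, q, h⟩ := exists_tet_eq (D := D) (.inr (.inl (σ, k, j - i, true))) 0 i
    refine ⟨x, q, h.trans ?_⟩
    rw [prism_slab]
    simp [slabTri, slabVert, lv_of_lt k.2]
  · obtain ⟨x, q, h⟩ := exists_tet_eq (D := D) (.inr (.inr (σ, 0))) 0 j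
    exact ⟨x, q, h.trans (by rw [prism_cone]; rfl)⟩

variable (D n)

/-- The filled manifold as a simplicial complex. -/
def filling : AbstractSimplicialComplex (Vert W n) := facetComplex (tet D n) tet_cover

theorem tetSign_eq (x : TetIndex Tri n) : tetSign D n x = 1 ∨ tetSign D n x = -1 := by
  have h1 : prismSign D n x.1 = 1 ∨ prismSign D n x.1 = -1 := by
    rcases x.1 with T | ⟨σ, k, i, u⟩ | ⟨σ, i⟩
    · exact D.sgn_eq T
    · rcases neg_one_pow_eq_or ℤ (n + (k : ℕ)) with h | h <;> cases σ <;> simp [prismSign, h]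
    · exact neg_one_pow_eq_or ℤ n
  rcases neg_one_pow_eq_or ℝ (x.2.2 : ℕ) with h | h <;> rcases h1 with h1 | h1 <;>
    simp [tetSign, h, h1]

theorem isOrientation_filling [Fintype W] [LinearOrder (Vert W n)] :
    IsOrientation (filling D n) 3 (signedChain (tet D n) (tetSign D n)) :=
  isOrientation_signedChain tet_injective tet_dist (tetSign_eq D n)
    (fun _ => IsAlternating.coboundary_three) fun _ => sum_tet_eq_zero D n

theorem numSimplices_filling_le [Fintype W] :
    numSimplices (filling D n) ≤ (Fintype.card Tri + 12 * n + 6) * 144 := by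
  -- The factor 144 is 9 · 2⁴: nine tetrahedra per prism and at most sixteen subsets of each. There
  -- are 12n prisms in the layers and 6 around the cores.
  refine numSimplices_facetComplex_le.trans (le_of_eq ?_)
  simp only [Fintype.card_prod, Fintype.card_sum, Fintype.card_fin, Fintype.card_bool, ZMod.card]
  ring

end FillingComplex
end HopfBound
end

noncomputable section
namespace HopfBound
open Finset

/-! ### The explicit primitive of the pulled-back area cochain -/

section FillingHopf

/-- Representatives `0, 1, -1` of the integers modulo `3`. -/
def lift (x : ZMod 3) : ℤ := if x = 0 then 0 else if x = 1 then 1 else -1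

theorem lift_neg : ∀ x, lift (-x) = -lift x := by decide

theorem lift_sub_comm (x y : ZMod 3) : lift (x - y) = -lift (y - x) := by
  rw [← lift_neg, neg_sub]

/-- The generator of the cohomology of a layered solid torus, in the coordinates of its `k`-th
level torus. -/
def lam : Bool → ℕ → ℤ × ℤ
  | false, 0 => (1, 0)
  | true, 0 => (0, 1)
  | σ, k + 1 => ((lam σ k).2, (lam σ k).1 + (lam σ k).2)

theorem lam_succ (σ : Bool) (k : ℕ) :
    lam σ (k + 1) = ((lam σ k).2, (lam σ k).1 + (lam σ k).2) := by
  cases σ <;> rfl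

theorem lam_true (k : ℕ) : lam true k = ((Nat.fib k : ℤ), (Nat.fib (k + 1) : ℤ)) := by
  induction k with
  | zero => rfl
  | succ k ih => rw [lam_succ, ih, Nat.fib_add_two]; push_cast; rfl

theorem lam_false_succ (k : ℕ) : lam false (k + 1) = ((Nat.fib k : ℤ), (Nat.fib (k + 1) : ℤ)) := by
  induction k with
  | zero => rfl
  | succ k ih => rw [lam_succ, ih, Nat.fib_add_two]; push_cast; rfl

variable {W Tri : Type} [Fintype Tri] (D : Band W Tri) (n : ℕ) (μ : Bool → ℝ) (ρ γ : ℝ)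

/-- Half of the cochain `primitive`. -/
def halfPrimitive : Vert W n → Vert W n → ℝ
  | .base w j, .base w' j' => (ρ * D.η w w' + γ * lift (j' - j)) / 2
  | .inn σ k i j, .inn σ' k' i' j' =>
      if σ = σ' then
        if k = k' then μ σ * ((lam σ k).1 * lift (i' - i) + (lam σ k).2 * lift (j' - j)) / 2
        else if (k : ℕ) + 1 = k' then
          μ σ * ((lam σ k').1 * lift (i' - (j - i)) + (lam σ k').2 * lift (j' - i))
        else 0
      else 0
  | .inn σ _ i j, .base w j' =>
      μ σ * ((lam σ n).1 * lift (D.idx w - (j - i)) + (lam σ n).2 * lift (j' - i))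
  | .core σ x, .core _ x' => μ σ * lift (x' - x) / 2
  | .core σ x, .inn _ _ i j => μ σ * lift ((if σ then j else i) - x)
  | _, _ => 0

/-- A cochain on edges, which on each layered solid torus is a multiple of a generator of its
cohomology. -/
def primitive (e : Fin 2 → Vert W n) : ℝ :=
  halfPrimitive D n μ ρ γ (e 0) (e 1) - halfPrimitive D n μ ρ γ (e 1) (e 0)

theorem isAlternating_primitive : IsAlternating (primitive D n μ ρ γ) := by
  refine isAlternating_of_swap fun t i j hij => ?_
  fin_cases i <;> fin_cases j <;> first | exact absurd rfl hij | skip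
  all_goals simp [primitive]

theorem primitive_base (w w' : W) (j j' : ZMod 3) :
    primitive D n μ ρ γ ![.base w j, .base w' j'] = ρ * D.η w w' + γ * lift (j' - j) := by
  simp [primitive, halfPrimitive, D.η_anti w w', lift_sub_comm j j']
  ring

theorem primitive_lv (σ : Bool) {k : ℕ} (hk : k < n) (i j i' j' : ZMod 3) :
    primitive D n μ ρ γ ![lv D n σ k i j, lv D n σ k i' j'] =
      μ σ * ((lam σ k).1 * lift (i' - i) + (lam σ k).2 * lift (j' - j)) := by
  simp [primitive, halfPrimitive, lv_of_lt hk, lift_sub_comm j j', lift_sub_comm i i']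
  ring

/-- In the coordinates of the layer above it, the vertex (i, j) of level k is (j - i, i). The
formula is thus the linear class `lam σ (k + 1)` on the layer, consistent with the recursion for
`lam`. -/
theorem primitive_lv_succ (σ : Bool) {k : ℕ} (hk : k < n) (i j i' j' : ZMod 3) :
    primitive D n μ ρ γ ![lv D n σ k i j, lv D n σ (k + 1) i' j'] =
      μ σ * ((lam σ (k + 1)).1 * lift (i' - (j - i)) + (lam σ (k + 1)).2 * lift (j' - i)) := by
  rcases Nat.lt_or_ge (k + 1) n with h | h
  · simp [primitive, halfPrimitive, lv_of_lt hk, lv_of_lt h]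
    omega
  · obtain rfl : k + 1 = n := by omega
    simp [primitive, halfPrimitive, lv_of_lt hk, lv_last, D.idx_c]

theorem primitive_cone (h : 0 < n) (σ : Bool) (x x' : Option (ZMod 3)) (j j' : ZMod 3)
    (hx : x.isSome → x'.isSome) :
    primitive D n μ ρ γ ![coneVert D n σ x j, coneVert D n σ x' j'] = μ σ * lift (j' - j) := by
  cases σ <;> rcases x with _ | x <;> rcases x' with _ | x' <;>
    simp [coneVert, lv_of_lt h, primitive, halfPrimitive, lam, lift_sub_comm j j'] at hx ⊢ <;> ring

/-- A cochain that depends only on the projection to the triangle, plus a constant γ per step around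
the circle, has coboundary pulled back from the triangle. This reduces all faces of all tetrahedra
of a prism to the single equation `hc`. -/
theorem closed_prism {V W' : Type} {a : (Fin 2 → V) → ℝ} {ω : (Fin 3 → W') → ℝ}
    (hω : IsAlternating ω) {φ : V → W'} {v : Fin 3 → ZMod 3 → V} {f : Fin 3 → W'}
    (hf : ∀ p j, φ (v p j) = f p) {ξ : Fin 3 → Fin 3 → ℝ} {γ : ℝ}
    (h0 : ∀ p q j, p ≤ q → a ![v p j, v q j] = ξ p q)
    (h1 : ∀ p q j, p ≤ q → a ![v p j, v q (j + 1)] = ξ p q + γ)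
    (hξ : ∀ p, ξ p p = 0) (hc : ξ 1 2 - ξ 0 2 + ξ 0 1 = ω f)
    (m : Fin 3) (j : ZMod 3) (k : Fin 4) :
    coboundary a ((fun p => v (stair m j p).1 (stair m j p).2) ∘ k.succAbove) =
      ω (φ ∘ (fun p => v (stair m j p).1 (stair m j p).2) ∘ k.succAbove) := by
  have e : ∀ g : Fin 3 → W', ω g = ω ![g 0, g 1, g 2] := fun g => by
    congr 1; ext i; fin_cases i <;> rfl
  have z1 : ∀ x y, ω ![x, x, y] = 0 := fun x y =>
    hω.eq_zero (i := 0) (j := 1) (by decide) rfl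
  have z2 : ∀ x y, ω ![x, y, y] = 0 := fun x y =>
    hω.eq_zero (i := 1) (j := 2) (by decide) rfl
  rw [coboundary_eq_two, e]
  rw [e f] at hc
  fin_cases m <;> fin_cases k <;>
    simp [stair_zero, stair_one, stair_two, Fin.succAbove, hf, h0, h1, hξ, z1, z2] <;> linarith

variable {W' : Type} (pole : Bool → W') (ψ : W → W')

/-- The map to a surface which collapses each layered solid torus, without its boundary, and the
circle factor. -/
def collapse : Vert W n → W'
  | .base w _ => ψ w
  | .inn σ _ _ _ => pole σ
  | .core σ _ => pole σ

/-- The two hypotheses are the matching conditions on the boundary tori: `hγ` equates the circle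
periods from both sides, and `hρ` lets the periods along the boundary of the band differ by exactly
the area of the cone triangle. -/
theorem closed_primitive (hn : 0 < n) {ω : (Fin 3 → W') → ℝ} (hω : IsAlternating ω)
    (hψ : ∀ T, ω (ψ ∘ D.tri T) = 0) (hγ : ∀ σ, γ = μ σ * (lam σ n).2)
    (hρ : ∀ σ i, ω ![pole σ, ψ (D.c σ i), ψ (D.c σ (i + 1))] = ρ - μ σ * (lam σ n).1)
    (x : TetIndex Tri n) (k : Fin 4) :
    coboundary (primitive D n μ ρ γ) (tet D n x ∘ k.succAbove) =
      ω (collapse n pole ψ ∘ tet D n x ∘ k.succAbove) := by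
  have l0 : lift 0 = 0 := rfl
  have l1 : lift 1 = 1 := rfl
  have lm : lift (-1) = -1 := rfl
  have zz : ∀ x, ω ![x, x, x] = 0 := fun x =>
    hω.eq_zero (i := 0) (j := 1) (by decide) rfl
  have z1 : ∀ x y, ω ![x, x, y] = 0 := fun x y =>
    hω.eq_zero (i := 0) (j := 1) (by decide) rfl
  have η0 : ∀ w, D.η w w = 0 := fun w => by have := D.η_anti w w; omega
  obtain ⟨T, j, m⟩ := x
  rcases T with T | ⟨σ, l, i, u⟩ | ⟨σ, i⟩
  · refine closed_prism hω (v := prism D n (.inl T)) (f := ψ ∘ D.tri T) (ξ := fun p q => ρ * D.η (D.tri T p) (D.tri T q))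
      (γ := γ) (fun p j => rfl) (fun p q j _ => ?_) (fun p q j _ => ?_) (fun p => ?_) ?_ m j k
    · exact (primitive_base ..).trans (by simp [l0])
    · exact (primitive_base ..).trans (by simp [l1])
    · simp [η0]
    · rw [hψ, ← mul_sub, ← mul_add]
      exact_mod_cast mul_eq_zero_of_right ρ (by exact_mod_cast D.η_closed T)
  · have hl := l.2
    rcases Nat.lt_or_ge ((l : ℕ) + 1) n with h | h
    · cases u
      · refine closed_prism hω (f := fun _ => pole σ) (γ := μ σ * (lam σ (l + 1)).2)
          (ξ := fun p q => μ σ * (lam σ (l + 1)).1 * lift ((slabTri i false q).2 -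
            (slabTri i false p).2)) (fun p j => ?_) (fun p q j hpq => ?_) (fun p q j hpq => ?_)
          (fun p => ?_) ?_ m j k
        · fin_cases p <;> simp [prism, lv_of_lt hl, lv_of_lt h, collapse]
        · fin_cases p <;> fin_cases q <;> simp at hpq <;>
            simp [prism, slabTri, primitive_lv, hl, h, primitive_lv_succ, l0, l1, lm, lam_succ]
        · fin_cases p <;> fin_cases q <;> simp at hpq <;>
            simp [prism, slabTri, primitive_lv, hl, h, primitive_lv_succ, l0, l1, lm, lam_succ] <;>
            ring_nf <;> simp [l0, l1, lm] <;> ring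
        · simp [l0]
        · rw [hω.eq_zero (i := 0) (j := 1) (by decide) rfl]
          simp [slabTri, l0, l1, lm]
      · refine closed_prism hω (f := fun _ => pole σ) (γ := μ σ * (lam σ (l + 1)).2)
          (ξ := fun p q => μ σ * (lam σ (l + 1)).1 * lift ((slabTri i true q).2 -
            (slabTri i true p).2)) (fun p j => ?_) (fun p q j hpq => ?_) (fun p q j hpq => ?_)
          (fun p => ?_) ?_ m j k
        · fin_cases p <;> simp [prism, lv_of_lt hl, lv_of_lt h, collapse]
        · fin_cases p <;> fin_cases q <;> simp at hpq <;>
            simp [prism, slabTri, primitive_lv, hl, h, primitive_lv_succ, l0, l1, lm, lam_succ]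
        · fin_cases p <;> fin_cases q <;> simp at hpq <;>
            simp [prism, slabTri, primitive_lv, hl, h, primitive_lv_succ, l0, l1, lm, lam_succ] <;>
            ring_nf <;> simp [l0, l1, lm] <;> ring
        · simp [l0]
        · rw [hω.eq_zero (i := 0) (j := 1) (by decide) rfl]
          simp [slabTri, l0, l1, lm]
    -- Only the outermost layer touches the band. It alone among the layers can map onto triangles
    -- of the cone instead of to the pole.
    · have hln : (l : ℕ) + 1 = n := by omega
      have hlv : ∀ i j, lv D n σ (l + 1) i j = .base (D.c σ i) j := fun i j => by
        rw [hln]; exact lv_last σ i j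
      have hs : ∀ i j i' j', primitive D n μ ρ γ ![lv D n σ l i j, .base (D.c σ i') j'] =
          μ σ * ((lam σ (l + 1)).1 * lift (i' - (j - i)) + (lam σ (l + 1)).2 * lift (j' - i)) :=
        fun i j i' j' => by rw [← hlv, primitive_lv_succ D n μ ρ γ σ hl]
      rw [← hln] at hγ hρ
      cases u
      · refine closed_prism hω (f := ![pole σ, pole σ, ψ (D.c σ (i + 1))])
          (γ := μ σ * (lam σ (l + 1)).2)
          (ξ := fun p q => μ σ * (lam σ (l + 1)).1 * lift ((slabTri i false q).2 -
            (slabTri i false p).2)) (fun p j => ?_) (fun p q j hpq => ?_) (fun p q j hpq => ?_)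
          (fun p => ?_) ?_ m j k
        · fin_cases p <;> simp [prism, lv_of_lt hl, hlv, collapse]
        · fin_cases p <;> fin_cases q <;> simp at hpq <;>
            simp [prism, slabTri, primitive_lv, hl, hlv, hs, primitive_base, η0, l0, l1, lm,
              lam_succ]
        · fin_cases p <;> fin_cases q <;> simp at hpq <;>
            simp [prism, slabTri, primitive_lv, hl, hlv, hs, primitive_base, η0, l0, l1, lm,
              lam_succ] <;>
            (try simp only [hγ σ, lam_succ]) <;> (try push_cast) <;> ring_nf <;> try simp [l0, lm] <;> ring
        · simp [l0]
        · rw [z1]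
          simp [slabTri, l0, l1, lm]
      · refine closed_prism hω (f := ![pole σ, ψ (D.c σ i), ψ (D.c σ (i + 1))])
          (γ := μ σ * (lam σ (l + 1)).2)
          -- The edge on the boundary torus carries ρ rather than μ times the generator; the
          -- discrepancy is the value of ω on the cone triangle.
          (ξ := ![![0, 0, μ σ * (lam σ (l + 1)).1], ![0, 0, ρ], ![0, 0, 0]])
          (fun p j => ?_) (fun p q j hpq => ?_) (fun p q j hpq => ?_)
          (fun p => ?_) ?_ m j k
        · fin_cases p <;> simp [prism, lv_of_lt hl, hlv, collapse]
        · fin_cases p <;> fin_cases q <;> simp at hpq <;>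
            simp [prism, primitive_lv, hl, hlv, hs, primitive_base, η0, l0, l1, D.η_c]
        · fin_cases p <;> fin_cases q <;> simp at hpq <;>
            simp [prism, primitive_lv, hl, hlv, hs, primitive_base, η0, l0, l1, D.η_c,
              lam_succ] <;>
            (try simp only [hγ σ, lam_succ]) <;> (try push_cast) <;> ring_nf <;> try simp [l0, l1, lm]
        · fin_cases p <;> rfl
        · rw [hρ]
          simp
  · have hp : ∀ p j, prism D n (.inr (.inr (σ, i))) p j = coneVert D n σ (coneTri i p) j :=
      fun p j => prism_cone D n σ i p j
    have hsome : ∀ (i : ZMod 3) (p q : Fin 3), p ≤ q →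
        (coneTri i p).isSome → (coneTri i q).isSome := by decide
    refine closed_prism hω (f := fun _ => pole σ) (γ := μ σ) (ξ := fun _ _ => 0)
      (fun p j => ?_) (fun p q j hpq => ?_) (fun p q j hpq => ?_) (fun p => rfl) ?_ m j k
    · cases σ <;> fin_cases p <;> simp [prism, lv_of_lt hn, collapse]
    · rw [hp, hp, primitive_cone D n μ ρ γ hn _ _ _ _ _ (hsome i p q hpq)]
      simp [l0]
    · rw [hp, hp, primitive_cone D n μ ρ γ hn _ _ _ _ _ (hsome i p q hpq)]
      simp [l1]
    · rw [hω.eq_zero (i := 0) (j := 1) (by decide) rfl]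
      simp

end FillingHopf
end HopfBound
end

noncomputable section
namespace HopfBound
open Finset

/-! ### Evaluation of the cup product and solution of the matching conditions -/

section HopfValue

/-- Up to sign this is the determinant of the two generators on the boundary tori. Because it is ±1,
solving the matching conditions does not divide the large periods back down. -/
theorem fib_cassini (k : ℕ) :
    (Nat.fib (k + 1) : ℤ) ^ 2 - Nat.fib k * Nat.fib (k + 2) = (-1) ^ k := by
  induction k with
  | zero => simp
  | succ k ih =>
    rw [pow_succ (-1 : ℤ), ← ih, Nat.fib_add_two (n := k + 1), Nat.fib_add_two (n := k)]
    push_cast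
    ring

variable {W Tri W' : Type} [Fintype Tri] [Fintype W] {D : Band W Tri}
  {n : ℕ} [LinearOrder (Vert W n)] [LinearOrder W'] {μ : Bool → ℝ} {ρ γ : ℝ}
  {pole : Bool → W'} {ψ : W → W'} {ω : (Fin 3 → W') → ℝ}

/-- A tetrahedron contributes only if exactly two vertices lie over the first pole, which confines
the sum to the outermost layer of the first solid torus. There one tetrahedron survives for each
pair (i, j), and all nine contribute the circle period times δ with sign -1. -/
theorem sum_altExt_cup (hn : 0 < n) (hφ : Monotone (collapse n pole ψ)) (hω : IsAlternating ω)
    (hpole : ∀ x, pole false ≤ x) (hne : pole true ≠ pole false) (hψ : ∀ w, ψ w ≠ pole false)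
    (hsupp : ∀ u, ω u ≠ 0 → ∃ q, u q = pole false) {δ : ℝ}
    (hδ : ∀ i, ω ![pole false, ψ (D.c false i), ψ (D.c false (i + 1))] = δ) :
    ∑ x, tetSign D n x * altExt (cup (primitive D n μ ρ γ)
      (pullback (collapse n pole ψ) ω)) (tet D n x) =
      -9 * (μ false * (lam false n).2) * δ := by
  have ha := isAlternating_primitive D n μ ρ γ
  have hzero := fun {t} => altExt_cup_eq_zero (a := primitive D n μ ρ γ) (t := t) hφ hω hpole hsupp
  have hval := fun {t} => altExt_cup_eq (t := t) hφ ha hω hpole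
  have hψ' : ∀ w, (ψ w = pole false) = False := fun w => eq_false (hψ w)
  rw [Fintype.sum_prod_type, Fintype.sum_sum_type, Fintype.sum_sum_type]
  have h1 : ∀ (T : Tri) (x : ZMod 3 × Fin 3), altExt (cup (primitive D n μ ρ γ)
      (pullback (collapse n pole ψ) ω)) (tet D n (.inl T, x)) = 0 := fun T x => by
    apply hzero
    simp [tet, prism, collapse, hψ']
  have h2 : ∀ (σ : Bool) (i : ZMod 3) (x : ZMod 3 × Fin 3), altExt (cup (primitive D n μ ρ γ)
      (pullback (collapse n pole ψ) ω)) (tet D n (.inr (.inr (σ, i)), x)) = 0 := fun σ i x => by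
    apply hzero
    have : ∀ p, collapse n pole ψ (tet D n (.inr (.inr (σ, i)), x) p) = pole σ := by
      intro p
      simp only [tet]
      rw [prism_cone]
      cases σ <;> rcases coneTri i _ with _ | _ <;> simp [coneVert, lv_of_lt hn, collapse]
    cases σ <;> simp [this, hne]
  have h3 : ∀ (k : Fin n) (i : ZMod 3) (u : Bool) (x : ZMod 3 × Fin 3),
      altExt (cup (primitive D n μ ρ γ) (pullback (collapse n pole ψ) ω))
        (tet D n (.inr (.inl (true, k, i, u)), x)) = 0 := fun k i u x => by
    apply hzero
    have : ∀ p, collapse n pole ψ (tet D n (.inr (.inl (true, k, i, u)), x) p) ≠ pole false := by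
      intro p
      simp only [tet]
      rw [prism_slab]
      rcases slabVert_eq (D := D) true k (slabTri i u _) _ with ⟨y, z, g⟩ | ⟨hk, y, z, g⟩ |
        ⟨y, z, g⟩ <;> rw [g] <;> simp [collapse, hne, hψ]
    simp [this]
  have h4 : ∀ (k : Fin n) (i : ZMod 3) (u : Bool) (x : ZMod 3 × Fin 3), (k : ℕ) + 1 < n →
      altExt (cup (primitive D n μ ρ γ) (pullback (collapse n pole ψ) ω))
        (tet D n (.inr (.inl (false, k, i, u)), x)) = 0 := fun k i u x hk => by
    apply hzero
    have : ∀ p, collapse n pole ψ (tet D n (.inr (.inl (false, k, i, u)), x) p) = pole false := by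
      intro p
      simp only [tet]
      rw [prism_slab]
      rcases slabTri i u _ with ⟨_ | _, y⟩ <;> simp [slabVert, lv_of_lt hk, lv_of_lt k.2, collapse]
    simp [this]
  obtain ⟨l, rfl⟩ : ∃ l, n = l + 1 := ⟨n - 1, by omega⟩
  have h5 : ∀ (i j : ZMod 3) (m : Fin 3),
      altExt (cup (primitive D (l + 1) μ ρ γ) (pullback (collapse (l + 1) pole ψ) ω))
        (tet D (l + 1) (.inr (.inl (false, Fin.last l, i, false)), j, m)) = 0 := by
    intro i j m
    -- This tetrahedron does have two vertices over the pole, but the other two have the same image,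
    -- so ω vanishes.
    by_cases hm : m = 2
    · subst hm
      rw [hval (tet_injective _)]
      · simp [tet, stair_two, prism, lv_last, collapse]
        right
        exact hω.eq_zero (i := 1) (j := 2) (by decide) rfl
      all_goals simp [tet, stair_two, prism, lv_last, lv_of_lt, collapse, hψ]
    · apply hzero
      fin_cases m
      · simp [tet, stair_zero, prism, lv_last, lv_of_lt, collapse, hψ', Finset.filter,
          Finset.card, Fin.univ_def, List.finRange_succ]
      · simp [tet, stair_one, prism, lv_last, lv_of_lt, collapse, hψ', Finset.filter,
          Finset.card, Fin.univ_def, List.finRange_succ]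
      · exact absurd rfl hm
  have h6 : ∀ (i j : ZMod 3) (m : Fin 3), m ≠ 0 →
      altExt (cup (primitive D (l + 1) μ ρ γ) (pullback (collapse (l + 1) pole ψ) ω))
        (tet D (l + 1) (.inr (.inl (false, Fin.last l, i, true)), j, m)) = 0 := by
    intro i j m hm
    apply hzero
    fin_cases m
    · exact absurd rfl hm
    · simp [tet, stair_one, prism, lv_last, lv_of_lt, collapse, hψ', Finset.filter,
          Finset.card, Fin.univ_def, List.finRange_succ]
    · simp [tet, stair_two, prism, lv_last, lv_of_lt, collapse, hψ', Finset.filter,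
          Finset.card, Fin.univ_def, List.finRange_succ]
  -- The first two vertices differ by (1, 1) in level l, so a takes the sum of both coordinates of
  -- `lam false l` there, which is the second coordinate at level l + 1.
  have h7 : ∀ (i j : ZMod 3),
      altExt (cup (primitive D (l + 1) μ ρ γ) (pullback (collapse (l + 1) pole ψ) ω))
        (tet D (l + 1) (.inr (.inl (false, Fin.last l, i, true)), j, 0)) =
      μ false * (lam false (l + 1)).2 * δ := by
    intro i j
    rw [hval (tet_injective _)]
    · rw [← hδ i]
      simp only [tet, stair_zero, prism, Fin.val_last, lv_last, collapse, Matrix.cons_val_zero,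
        Matrix.cons_val_one, Matrix.cons_val, primitive_lv D (l + 1) μ ρ γ false (Nat.lt_succ_self l)]
      congr 2
      have e : i + (j + 1) - (i + j) = 1 := by ring
      rw [add_sub_cancel_left, e, show lift 1 = 1 from rfl, lam_succ]
      push_cast
      ring
    all_goals simp [tet, stair_zero, prism, lv_last, lv_of_lt, collapse, hψ]
  have h8 : ∀ i j, tetSign D (l + 1) (.inr (.inl (false, Fin.last l, i, true)), j, 0) = -1 := by
    intro i j
    have : Odd (l + 1 + l) := ⟨l, by ring⟩
    simp [tetSign, prismSign, this.neg_one_pow]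
  simp only [Fintype.sum_prod_type, Fintype.sum_bool] at h1 h2 h3 ⊢
  simp only [h1, h2, h3, mul_zero, sum_const_zero, add_zero, zero_add]
  rw [Fin.sum_univ_castSucc, sum_eq_zero]
  · simp only [h5, mul_zero, Fin.sum_univ_three, h6 _ _ 1 (by decide), h6 _ _ 2 (by decide), h7, h8,
      add_zero, sum_const_zero, sum_const, card_univ, ZMod.card]
    simp
    ring
  · intro k _
    refine sum_eq_zero fun i _ => ?_
    simp [h4 k.castSucc i _ _ (by simp)]

theorem exists_hopfInvariant_filling [Fintype W'] {l : ℕ} [LinearOrder (Vert W (l + 1))]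
    (hφ : Monotone (collapse (l + 1) pole ψ)) (hω : IsAlternating ω)
    (hpole : ∀ x, pole false ≤ x) (hne : pole true ≠ pole false) (hψ : ∀ w, ψ w ≠ pole false)
    (hsupp : ∀ u, ω u ≠ 0 → ∃ q, u q = pole false)
    (hδ : ∀ i, ω ![pole false, ψ (D.c false i), ψ (D.c false (i + 1))] = 1 / 3)
    {L : AbstractSimplicialComplex W'} {oL : (Fin 3 → W') → ℝ} (hL : IsOrientation L 2 oL)
    (hpair : pairing L ω oL = 1) :
    ∃ h, IsSimplicialHopfInvariant (filling D (l + 1)) L (collapse (l + 1) pole ψ) h ∧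
      |h| = Nat.fib (l + 1) * Nat.fib (l + 2) := by
  obtain ⟨s, hs, hs2⟩ : ∃ s : ℝ, (s = 1 ∨ s = -1) ∧
      (Nat.fib (l + 1) : ℝ) ^ 2 - Nat.fib l * Nat.fib (l + 2) = s :=
    ⟨(-1) ^ l, neg_one_pow_eq_or ℝ l, by exact_mod_cast fib_cassini l⟩
  have hss : s * s = 1 := by rcases hs with rfl | rfl <;> norm_num
  set q : ℝ := ((Nat.fib (l + 1) : ℕ) : ℝ) with hq
  set r : ℝ := ((Nat.fib (l + 2) : ℕ) : ℝ) with hr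
  -- Equality of the circle periods makes the coefficients proportional to F_{l+2} and F_{l+1}, and
  -- the equation at the second pole then gives ρ. The remaining equation is Cassini's identity,
  -- which fixes the factor s / 3 with s = ±1.
  let μ : Bool → ℝ := fun σ => s / 3 * if σ then q else r
  have hz : ∀ u, (∀ p, u p ≠ pole false) → ω u = 0 := fun u hu => by
    by_contra h
    obtain ⟨p, hp⟩ := hsupp u h
    exact hu p hp
  have hl1 : lam false (l + 1) = ((Nat.fib l : ℤ), (Nat.fib (l + 1) : ℤ)) := lam_false_succ l
  have hl2 : lam true (l + 1) = ((Nat.fib (l + 1) : ℤ), (Nat.fib (l + 2) : ℤ)) := lam_true _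
  refine ⟨-9 * (μ false * (lam false (l + 1)).2) * (1 / 3), ?_, ?_⟩
  · refine ⟨signedChain (tet D (l + 1)) (tetSign D (l + 1)), oL, ω,
      primitive D (l + 1) μ (s / 3 * q ^ 2) (s / 3 * q * r), isOrientation_filling D (l + 1), hL,
      hpair, fun x hx => ?_, ?_⟩
    · refine coboundary_eq_pullback hφ (isAlternating_primitive _ _ _ _ _) hω (fun x k => ?_) hx
      refine closed_primitive D _ _ _ _ pole ψ (Nat.succ_pos l) hω (fun T => ?_) ?_ ?_ x k
      · exact hz _ fun p => hψ _
      · intro σ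
        cases σ
        · rw [hl1]; simp [μ, ← hq]; ring
        · rw [hl2]; simp [μ, ← hr]
      · intro σ i
        cases σ
        · rw [hδ, hl1]
          simp [μ]
          have : s / 3 * q ^ 2 - s / 3 * r * Nat.fib l = s / 3 * (q ^ 2 - Nat.fib l * r) := by ring
          rw [this, hs2, div_mul_eq_mul_div, hss]
          norm_num
        · rw [hz _ fun p => ?_, hl2]
          · simp [μ, ← hq]; ring
          · fin_cases p
            · exact hne
            · exact hψ _
            · exact hψ _
    · rw [filling, pairing_signedChain]
      exact (sum_altExt_cup (Nat.succ_pos l) hφ hω hpole hne hψ hsupp hδ).symm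
  · rw [hl1]
    have e : -9 * (μ false * ((Nat.fib (l + 1) : ℤ) : ℝ)) * (1 / 3) = -s * (q * r) := by
      simp [μ, ← hq]; ring
    rw [e, abs_mul]
    rcases hs with rfl | rfl <;> simp [abs_of_nonneg, hq, hr]

end HopfValue
end HopfBound
end

noncomputable section
namespace HopfBound
open Finset

/-! ### Push-forward of barycentric coordinates -/

section Pushf

variable {U V W : Type} [Fintype U] [Fintype V]

open Classical in
/-- The affine extension of a map of vertices. -/
def pushf (f : V → W) (x : V → ℝ) (w : W) : ℝ := ∑ v, if f v = w then x v else 0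

theorem continuous_pushf (f : V → W) : Continuous (pushf f) := by
  refine continuous_pi fun w => continuous_finsetSum _ fun v _ => ?_
  split_ifs <;> fun_prop

theorem pushf_comp (g : V → W) (f : U → V) (x : U → ℝ) :
    pushf g (pushf f x) = pushf (g ∘ f) x := by
  classical
  ext w
  have : ∀ v, (if g v = w then pushf f x v else 0) =
      ∑ u, if f u = v then (if g v = w then x u else 0) else 0 := fun v => by
    split_ifs with h
    · rfl
    · simp
  simp only [pushf] at this ⊢
  simp only [this]
  rw [sum_comm]
  refine sum_congr rfl fun u _ => ?_
  rw [sum_ite_eq]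
  simp

theorem pushf_nonneg {f : V → W} {x : V → ℝ} (hx : ∀ v, 0 ≤ x v) (w : W) : 0 ≤ pushf f x w :=
  sum_nonneg fun v _ => by split_ifs <;> simp [hx]

theorem sum_pushf [Fintype W] (f : V → W) (x : V → ℝ) : ∑ w, pushf f x w = ∑ v, x v := by
  classical
  simp only [pushf]
  rw [sum_comm]
  simp

theorem pushf_mem_stdSimplex [Fintype W] (f : V → W) {x : V → ℝ} (hx : x ∈ stdSimplex ℝ V) :
    pushf f x ∈ stdSimplex ℝ W :=
  ⟨pushf_nonneg hx.1, by rw [sum_pushf, hx.2]⟩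

theorem pushf_eq_zero {f : V → W} {x : V → ℝ} {w : W} (h : ∀ v, f v = w → x v = 0) :
    pushf f x w = 0 :=
  sum_eq_zero fun v _ => by split_ifs with hv <;> simp [*]

theorem pushf_apply_of_injective {f : V → W} (hf : Function.Injective f) (x : V → ℝ) (v : V) :
    pushf f x (f v) = x v := by
  classical
  simp [pushf, hf.eq_iff]

theorem eq_zero_of_pushf_eq_zero {f : V → W} {x : V → ℝ} (hx : ∀ v, 0 ≤ x v) {w : W}
    (h : pushf f x w = 0) {v : V} (hv : f v = w) : x v = 0 := by
  have := (sum_eq_zero_iff_of_nonneg fun v _ => by split_ifs <;> simp [hx]).1 h v (mem_univ v)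
  simpa [hv] using this

theorem pushf_id (x : V → ℝ) : pushf id x = x := by
  ext v
  exact pushf_apply_of_injective Function.injective_id x v

theorem pushf_eq_sum_filter [DecidableEq W] (f : V → W) (x : V → ℝ) (w : W) :
    pushf f x w = ∑ v with f v = w, x v := by
  rw [sum_filter, pushf]
  exact sum_congr rfl fun v _ => by congr

variable {d : ℕ}

theorem pushf_mem_cell [Fintype W] (f : V → W) {t : Fin (d + 1) → V} {x : V → ℝ}
    (hx : x ∈ cell t) : pushf f x ∈ cell (f ∘ t) := by
  refine ⟨pushf_mem_stdSimplex f hx.1, fun w hw => pushf_eq_zero fun v hv => hx.2 v fun p hp => ?_⟩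
  exact hw p (by rw [← hv, ← hp]; rfl)

theorem pushf_tuple_mem_cell (t : Fin (d + 1) → V) {c : Fin (d + 1) → ℝ}
    (hc : c ∈ stdSimplex ℝ (Fin (d + 1))) : pushf t c ∈ cell t :=
  ⟨pushf_mem_stdSimplex t hc, fun v hv => pushf_eq_zero fun p hp => absurd hp (hv p)⟩

theorem exists_of_mem_cell {t : Fin (d + 1) → V} (ht : Function.Injective t) {x : V → ℝ}
    (hx : x ∈ cell t) : ∃ c ∈ stdSimplex ℝ (Fin (d + 1)), pushf t c = x := by
  have key : pushf t (x ∘ t) = x := by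
    ext v
    by_cases hv : ∃ p, t p = v
    · obtain ⟨p, rfl⟩ := hv
      exact pushf_apply_of_injective ht _ p
    · push Not at hv
      rw [hx.2 v hv]
      exact pushf_eq_zero fun p hp => absurd hp (hv p)
  refine ⟨x ∘ t, ⟨fun p => hx.1.1 _, ?_⟩, key⟩
  rw [← sum_pushf t, key, hx.1.2]

theorem isCompact_cell (t : Fin (d + 1) → V) : IsCompact (cell t) := by
  have : cell t = stdSimplex ℝ V ∩ {x | ∀ v, (∀ p, t p ≠ v) → x v = 0} := rfl
  rw [this]
  refine (isCompact_stdSimplex ℝ V).inter_right ?_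
  simp only [Set.ofPred_forall]
  exact isClosed_iInter fun v => isClosed_iInter fun _ =>
    isClosed_eq (continuous_apply v) continuous_const

end Pushf

/-! ### The product of a triangulated surface and a circle -/

section Product

/-- The boundary of the triangle with vertices `ZMod 3`. -/
def circ : Set (ZMod 3 → ℝ) := {y | y ∈ stdSimplex ℝ (ZMod 3) ∧ ∃ i, y i = 0}

theorem isCompact_circ : IsCompact circ := by
  refine (isCompact_stdSimplex ℝ (ZMod 3)).inter_right (t := {y | ∃ i, y i = 0}) ?_
  simp only [Set.ofPred_exists]
  exact isClosed_iUnion_of_finite fun i => isClosed_eq (continuous_apply i) continuous_const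

theorem sum_zmod_three (f : ZMod 3 → ℝ) (j : ZMod 3) :
    ∑ i, f i = f j + f (j + 1) + f (j + 2) := by
  rw [← Equiv.sum_comp (Equiv.addLeft j)]
  refine (Fin.sum_univ_three _).trans ?_
  simp only [Equiv.coe_addLeft]
  congr 2
  exact congrArg f (add_zero j)

theorem zmod_three_cases (i j : ZMod 3) : i = j ∨ i = j + 1 ∨ i = j + 2 := by
  revert i j; decide

theorem zmod_three_ne (j : ZMod 3) : j ≠ j + 1 ∧ j ≠ j + 2 ∧ j + 1 ≠ j + 2 := by
  revert j; decide

theorem zmod_three_add (j : ZMod 3) : j + 1 + 2 = j := by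
  revert j; decide

theorem zmod_three_of_ne {j j' : ZMod 3} : j ≠ j' → j' = j + 1 ∨ j = j' + 1 := by
  revert j j'; decide

variable {B Tri : Type} [Fintype B] (tri : Tri → Fin 3 → B)

/-- The union of the triangles. -/
def triUnion : Set (B → ℝ) := ⋃ T, cell (tri T)

/-- The vertices of the tetrahedra of the staircase product with a circle. -/
def prodTet (x : Tri × ZMod 3 × Fin 3) (p : Fin 4) : B × ZMod 3 :=
  (tri x.1 (stair x.2.2 x.2.1 p).1, (stair x.2.2 x.2.1 p).2)

/-- The staircase product with a circle. -/
def prodUnion : Set (B × ZMod 3 → ℝ) := ⋃ x, cell (prodTet tri x)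

/-- The two projections of the product with a circle. -/
def marg (w : B × ZMod 3 → ℝ) : (B → ℝ) × (ZMod 3 → ℝ) := (pushf Prod.fst w, pushf Prod.snd w)

theorem isCompact_prodUnion [Finite Tri] : IsCompact (prodUnion tri) :=
  isCompact_iUnion fun _ => isCompact_cell _

theorem pushf_fst (w : B × ZMod 3 → ℝ) (b : B) : pushf Prod.fst w b = ∑ i, w (b, i) := by
  classical
  rw [pushf, Fintype.sum_prod_type, sum_eq_single b]
  · simp
  · intro b' _ hb
    simp [hb]
  · simp

theorem pushf_snd (w : B × ZMod 3 → ℝ) (i : ZMod 3) : pushf Prod.snd w i = ∑ b, w (b, i) := by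
  classical
  rw [pushf, Fintype.sum_prod_type_right, sum_eq_single i]
  · simp
  · intro b' _ hb
    simp [hb]
  · simp

/-- Think of w as a coupling of its two marginals. It is supported on two columns and monotone for
`lt`. If two such couplings differ, some b has more mass in column j + 1 for w' and some b' has more
for w; monotonicity of each then orders b and b' in opposite ways. -/
theorem coupling_unique {lt : B → B → Prop} (hlt : ∀ b b', lt b b' → ¬ lt b' b)
    {w w' : B × ZMod 3 → ℝ} (hw : ∀ x, 0 ≤ w x) (hw' : ∀ x, 0 ≤ w' x) {j j' : ZMod 3}
    (hj : ∀ b, w (b, j + 2) = 0) (hj' : ∀ b, w' (b, j' + 2) = 0)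
    (hs : ∀ b b', 0 < w (b, j) → 0 < w (b', j + 1) → b = b' ∨ lt b b')
    (hs' : ∀ b b', 0 < w' (b, j') → 0 < w' (b', j' + 1) → b = b' ∨ lt b b')
    (h1 : ∀ b, ∑ i, w (b, i) = ∑ i, w' (b, i)) (h2 : ∀ i, ∑ b, w (b, i) = ∑ b, w' (b, i)) :
    w = w' := by
  have hzero : ∀ i, (∑ b, w (b, i) = 0) → ∀ b, w (b, i) = 0 ∧ w' (b, i) = 0 := fun i hi b =>
    ⟨(sum_eq_zero_iff_of_nonneg fun b _ => hw (b, i)).1 hi b (mem_univ b),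
      (sum_eq_zero_iff_of_nonneg fun b _ => hw' (b, i)).1 ((h2 i).symm.trans hi) b (mem_univ b)⟩
  have fin : ∀ j, (∀ b, w (b, j + 2) = 0 ∧ w' (b, j + 2) = 0) →
      (∀ b, w (b, j + 1) = w' (b, j + 1)) → w = w' := by
    intro j h3 h4
    ext ⟨b, i⟩
    have h5 := h1 b
    rw [sum_zmod_three _ j, sum_zmod_three _ j, (h3 b).1, (h3 b).2, h4 b] at h5
    rcases zmod_three_cases i j with rfl | rfl | rfl
    · linarith
    · exact h4 b
    · rw [(h3 b).1, (h3 b).2]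
  have z1 : ∀ b, w (b, j + 2) = 0 ∧ w' (b, j + 2) = 0 := hzero _ (sum_eq_zero fun b _ => hj b)
  have z2 : ∀ b, w (b, j' + 2) = 0 ∧ w' (b, j' + 2) = 0 :=
    hzero _ ((h2 _).trans (sum_eq_zero fun b _ => hj' b))
  by_cases hjj : j = j'
  · subst hjj
    refine fin j z1 ?_
    by_contra! hne
    obtain ⟨b₀, hb₀⟩ := hne
    have key : ∀ b, w (b, j) + w (b, j + 1) = w' (b, j) + w' (b, j + 1) := fun b => by
      have h5 := h1 b
      rw [sum_zmod_three _ j, sum_zmod_three _ j, (z1 b).1, (z1 b).2] at h5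
      linarith
    obtain ⟨b, hb⟩ : ∃ b, w (b, j + 1) < w' (b, j + 1) := by
      by_contra! hge
      have := (sum_eq_sum_iff_of_le fun b _ => hge b).1 (h2 (j + 1)).symm
      exact hb₀ (this b₀ (mem_univ _)).symm
    obtain ⟨b', hb'⟩ : ∃ b, w' (b, j + 1) < w (b, j + 1) := by
      by_contra! hge
      have := (sum_eq_sum_iff_of_le fun b _ => hge b).1 (h2 (j + 1))
      exact hb₀ (this b₀ (mem_univ _))
    have hbb : b ≠ b' := by rintro rfl; linarith
    have k1 := key b
    have k2 := key b'
    have l1 := hs b b' (by linarith [hw' (b, j)]) (by linarith [hw' (b', j + 1)])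
    have l2 := hs' b' b (by linarith [hw (b', j)]) (by linarith [hw (b, j + 1)])
    exact hlt _ _ (l1.resolve_left hbb) (l2.resolve_left hbb.symm)
  -- If the empty columns differ, two of the three circle marginals vanish, so both couplings live
  -- on the same single column and are determined there.
  · have h3 : j' = j + 1 ∨ j = j' + 1 := zmod_three_of_ne hjj
    rcases h3 with rfl | rfl
    · have e : j + 1 + 2 = j := zmod_three_add j
      rw [e] at z2
      refine fin (j + 1) (by rw [e]; exact z2) fun b => ?_
      have e' : j + 1 + 1 = j + 2 := by ring
      rw [e', (z1 b).1, (z1 b).2]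
    · have e : j' + 1 + 2 = j' := zmod_three_add j'
      rw [e] at z1
      refine fin (j' + 1) (by rw [e]; exact z1) fun b => ?_
      have e' : j' + 1 + 1 = j' + 2 := by ring
      rw [e', (z2 b).1, (z2 b).2]

/-- This is the monotone coupling: the mass y (j + 1) of the upper column is taken from the last
vertices of the triangle first. The vertex that gets split determines which staircase tetrahedron
contains the point. -/
theorem exists_coupling {c : Fin 3 → ℝ} (hc : c ∈ stdSimplex ℝ (Fin 3)) {y : ZMod 3 → ℝ}
    (hy : y ∈ stdSimplex ℝ (ZMod 3)) {j : ZMod 3} (hj : y (j + 2) = 0) :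
    ∃ m, ∃ c' ∈ stdSimplex ℝ (Fin 4), pushf (fun p => (stair m j p).1) c' = c ∧
      pushf (fun p => (stair m j p).2) c' = y := by
  obtain ⟨hc0, hc1⟩ := hc
  obtain ⟨hy0, hy1⟩ := hy
  rw [Fin.sum_univ_three] at hc1
  rw [sum_zmod_three _ j, hj] at hy1
  have a0 := hc0 0
  have a1 := hc0 1
  have a2 := hc0 2
  have b0 := hy0 j
  have b1 := hy0 (j + 1)
  obtain ⟨n1, n2, n3⟩ := zmod_three_ne j
  have mk : ∀ (m : Fin 3) (c' : Fin 4 → ℝ), c' ∈ stdSimplex ℝ (Fin 4) →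
      (∀ i, pushf (fun p => (stair m j p).1) c' i = c i) →
      pushf (fun p => (stair m j p).2) c' j = y j →
      pushf (fun p => (stair m j p).2) c' (j + 1) = y (j + 1) →
      pushf (fun p => (stair m j p).2) c' (j + 2) = y (j + 2) → ∃ m, ∃ c' ∈ stdSimplex ℝ (Fin 4),
      pushf (fun p => (stair m j p).1) c' = c ∧ pushf (fun p => (stair m j p).2) c' = y := by
    intro m c' h0 h1 h2 h3 h4
    refine ⟨m, c', h0, funext h1, funext fun i => ?_⟩
    rcases zmod_three_cases i j with rfl | rfl | rfl
    exacts [h2, h3, h4]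
  have std : ∀ c' : Fin 4 → ℝ, 0 ≤ c' 0 → 0 ≤ c' 1 → 0 ≤ c' 2 → 0 ≤ c' 3 →
      c' 0 + c' 1 + c' 2 + c' 3 = 1 → c' ∈ stdSimplex ℝ (Fin 4) := by
    intro c' h0 h1 h2 h3 h4
    refine ⟨fun p => ?_, by rw [Fin.sum_univ_four, h4]⟩
    fin_cases p <;> assumption
  -- The thresholds c 2 and c 1 + c 2 separate the cases where vertex 2, 1 or 0 is split between the
  -- columns.
  rcases le_total (y (j + 1)) (c 2) with h | h
  · refine mk 2 ![c 0, c 1, c 2 - y (j + 1), y (j + 1)] (std _ ?_ ?_ ?_ ?_ ?_) ?_ ?_ ?_ ?_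
    · exact a0
    · exact a1
    · simpa using h
    · exact b1
    · simp; linarith
    · intro i
      fin_cases i <;> simp [pushf, stair_two, Fin.sum_univ_four]
    all_goals simp [pushf, stair_two, Fin.sum_univ_four, n1, n2, n3, n1.symm, n2.symm, n3.symm, hj]
    linarith
  rcases le_total (y (j + 1)) (c 1 + c 2) with h' | h'
  · refine mk 1 ![c 0, c 1 + c 2 - y (j + 1), y (j + 1) - c 2, c 2]
      (std _ ?_ ?_ ?_ ?_ ?_) ?_ ?_ ?_ ?_
    · exact a0
    · simpa using h'
    · simpa using h
    · exact a2
    · simp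
      linarith
    · intro i
      fin_cases i <;> simp [pushf, stair_one, Fin.sum_univ_four]
    all_goals simp [pushf, stair_one, Fin.sum_univ_four, n1, n2, n3, n1.symm, n2.symm, n3.symm, hj]
    linarith
  · refine mk 0 ![y j, c 0 - y j, c 1, c 2] (std _ ?_ ?_ ?_ ?_ ?_) ?_ ?_ ?_ ?_
    · exact b0
    · simp; linarith
    · exact a1
    · exact a2
    · simp; linarith
    · intro i
      fin_cases i <;> simp [pushf, stair_zero, Fin.sum_univ_four]
    all_goals simp [pushf, stair_zero, Fin.sum_univ_four, n1, n2, n3, n1.symm, n2.symm, n3.symm, hj]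
    linarith

variable {tri}

theorem staircase_of_mem {lt : B → B → Prop} (htri : ∀ T p q, p < q → lt (tri T p) (tri T q))
    {w : B × ZMod 3 → ℝ} (hw : w ∈ prodUnion tri) : ∃ j : ZMod 3, (∀ b, w (b, j + 2) = 0) ∧
      ∀ b b', 0 < w (b, j) → 0 < w (b', j + 1) → b = b' ∨ lt b b' := by
  obtain ⟨⟨T, j, m⟩, hw⟩ := Set.mem_iUnion.1 hw
  obtain ⟨n1, n2, n3⟩ := zmod_three_ne j
  refine ⟨j, fun b => hw.2 _ fun p hp => ?_, fun b b' hb hb' => ?_⟩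
  · have : (stair m j p).2 = j ∨ (stair m j p).2 = j + 1 := by
      simp only [stair]
      split_ifs <;> simp
    have e : (stair m j p).2 = j + 2 := congrArg Prod.snd hp
    rcases this with h | h <;> rw [h] at e
    · exact n2 e
    · exact n3 e
  · have h1 : ∃ p, prodTet tri (T, j, m) p = (b, j) := by
      by_contra! h
      exact hb.ne' (hw.2 _ h)
    have h2 : ∃ p, prodTet tri (T, j, m) p = (b', j + 1) := by
      by_contra! h
      exact hb'.ne' (hw.2 _ h)
    obtain ⟨p, hp⟩ := h1
    obtain ⟨q, hq⟩ := h2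
    have hpq : (stair m j p).1 ≤ (stair m j q).1 := by
      have e1 : (stair m j p).2 = j := congrArg Prod.snd hp
      have e2 : (stair m j q).2 = j + 1 := congrArg Prod.snd hq
      clear hp hq hb hb' hw n1 n2 n3
      revert m j p q
      decide
    have f1 : tri T (stair m j p).1 = b := congrArg Prod.fst hp
    have f2 : tri T (stair m j q).1 = b' := congrArg Prod.fst hq
    rcases hpq.lt_or_eq with h | h
    · right
      rw [← f1, ← f2]
      exact htri T _ _ h
    · left
      rw [← f1, ← f2, h]

/-- The staircase product is homeomorphic to the product. -/
theorem bijOn_marg {lt : B → B → Prop} (hlt : ∀ b b', lt b b' → ¬ lt b' b)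
    (htri : ∀ T p q, p < q → lt (tri T p) (tri T q)) (hinj : ∀ T, Function.Injective (tri T)) :
    Set.BijOn marg (prodUnion tri) (triUnion tri ×ˢ circ) := by
  refine ⟨?_, ?_, ?_⟩
  · intro w hw
    obtain ⟨j, hj, -⟩ := staircase_of_mem htri hw
    obtain ⟨x, hw⟩ := Set.mem_iUnion.1 hw
    refine ⟨Set.mem_iUnion.2 ⟨x.1, ?_⟩, pushf_mem_stdSimplex _ hw.1, j + 2, ?_⟩
    · refine ⟨pushf_mem_stdSimplex _ hw.1, fun b hb => pushf_eq_zero fun v hv => hw.2 v ?_⟩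
      intro p hp
      exact hb _ ((congrArg Prod.fst hp).trans hv)
    · change pushf Prod.snd w (j + 2) = 0
      rw [pushf_snd]
      exact sum_eq_zero fun b _ => hj b
  · intro w hw w' hw' h
    obtain ⟨j, hj, hs⟩ := staircase_of_mem htri hw
    obtain ⟨j', hj', hs'⟩ := staircase_of_mem htri hw'
    obtain ⟨x, hw⟩ := Set.mem_iUnion.1 hw
    obtain ⟨x', hw'⟩ := Set.mem_iUnion.1 hw'
    refine coupling_unique hlt hw.1.1 hw'.1.1 hj hj' hs hs' (fun b => ?_) fun i => ?_
    · rw [← pushf_fst, ← pushf_fst]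
      exact congrFun (congrArg Prod.fst h) b
    · rw [← pushf_snd, ← pushf_snd]
      exact congrFun (congrArg Prod.snd h) i
  · rintro ⟨β, y⟩ ⟨hβ, hy, i, hi⟩
    obtain ⟨T, hβ⟩ := Set.mem_iUnion.1 hβ
    obtain ⟨c, hc, hcβ⟩ := exists_of_mem_cell (hinj T) hβ
    obtain rfl : pushf (tri T) c = β := hcβ
    -- The vertex with zero coordinate must be written as j + 2 so that j and j + 1 are the two ends
    -- of the edge of the circle.
    have e : i = (i + 1) + 2 := (zmod_three_add i).symm
    rw [e] at hi
    obtain ⟨m, c', hc', h1, h2⟩ := exists_coupling hc hy hi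
    refine ⟨pushf (prodTet tri (T, i + 1, m)) c',
      Set.mem_iUnion.2 ⟨_, pushf_tuple_mem_cell _ hc'⟩, ?_⟩
    rw [marg, pushf_comp, pushf_comp, ← h1, pushf_comp]
    exact Prod.ext rfl h2

end Product
end HopfBound
end

noncomputable section
namespace HopfBound
open Finset

/-! ### Gluing homeomorphisms of compact sets -/

section Glue

/-- The condition `h'` says that the images meet only where the sets do; without it the glued map
could fail to be injective. -/
theorem bijOn_glue {X Y : Type*} {f g : X → Y} {A B : Set X} {A' B' : Set Y} [DecidablePred (· ∈ A)]
    (hf : Set.BijOn f A A') (hg : Set.BijOn g B B') (h : ∀ x ∈ A, x ∈ B → f x = g x)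
    (h' : ∀ x ∈ A, ∀ y ∈ B, f x = g y → x ∈ B) :
    Set.BijOn (fun x => if x ∈ A then f x else g x) (A ∪ B) (A' ∪ B') := by
  have eB : ∀ x ∈ B, (if x ∈ A then f x else g x) = g x := fun x hx => by
    split_ifs with hA
    · exact h x hA hx
    · rfl
  have eA : ∀ x ∈ A, (if x ∈ A then f x else g x) = f x := fun x hx => if_pos hx
  have key : ∀ x ∈ A, ∀ y ∈ B, f x = g y → x = y := fun x hx y hy e => by
    have := h' x hx y hy e
    exact hg.injOn this hy ((h x hx this).symm.trans e)
  refine ⟨?_, ?_, ?_⟩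
  · rintro x (hx | hx)
    · exact .inl (by simpa only [eA x hx] using hf.mapsTo hx)
    · exact .inr (by simpa only [eB x hx] using hg.mapsTo hx)
  · rintro x (hx | hx) y (hy | hy) e
    · simp only [eA x hx, eA y hy] at e
      exact hf.injOn hx hy e
    · simp only [eA x hx, eB y hy] at e
      exact key x hx y hy e
    · simp only [eB x hx, eA y hy] at e
      exact (key y hy x hx e.symm).symm
    · simp only [eB x hx, eB y hy] at e
      exact hg.injOn hx hy e
  · rintro y (hy | hy)
    · obtain ⟨x, hx, rfl⟩ := hf.surjOn hy
      exact ⟨x, .inl hx, eA x hx⟩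
    · obtain ⟨x, hx, rfl⟩ := hg.surjOn hy
      exact ⟨x, .inr hx, eB x hx⟩

variable {X Y : Type*} [TopologicalSpace X] [TopologicalSpace Y]

/-- A continuous map of a compact set to a Hausdorff space sends closed subsets to closed ones. -/
theorem continuousOn_invFunOn [Nonempty X] [T2Space Y] {f : X → Y} {K : Set X}
    (hK : IsCompact K) (hf : ContinuousOn f K) (hinj : Set.InjOn f K) :
    ContinuousOn (Function.invFunOn f K) (f '' K) := by
  rw [continuousOn_iff_isClosed]
  intro C hC
  refine ⟨f '' (K ∩ C), ((hK.inter_right hC).image_of_continuousOn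
    (hf.mono Set.inter_subset_left)).isClosed, ?_⟩
  ext y
  constructor
  · rintro ⟨h, x, hx, rfl⟩
    refine ⟨⟨x, ⟨hx, ?_⟩, rfl⟩, x, hx, rfl⟩
    rwa [Set.mem_preimage, hinj.leftInvOn_invFunOn hx] at h
  · rintro ⟨⟨x, ⟨hx, hC⟩, rfl⟩, -⟩
    refine ⟨?_, x, hx, rfl⟩
    rwa [Set.mem_preimage, hinj.leftInvOn_invFunOn hx]

theorem continuousOn_glue {f g : X → Y} {A B : Set X} [DecidablePred (· ∈ A)] (hA : IsClosed A)
    (hB : IsClosed B) (hf : ContinuousOn f A) (hg : ContinuousOn g B)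
    (h : ∀ x ∈ A, x ∈ B → f x = g x) :
    ContinuousOn (fun x => if x ∈ A then f x else g x) (A ∪ B) := by
  refine ContinuousOn.union_of_isClosed ?_ ?_ hA hB
  · exact hf.congr fun x hx => if_pos hx
  · refine hg.congr fun x hx => ?_
    split_ifs with hA
    · exact h x hA hx
    · rfl

theorem nonempty_homeomorph_of_bijOn [T2Space Y] {f : X → Y} {K : Set X} {K' : Set Y}
    (hK : IsCompact K) (hf : ContinuousOn f K) (hb : Set.BijOn f K K') : Nonempty (K ≃ₜ K') := by
  have := isCompact_iff_compactSpace.1 hK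
  have hc : Continuous (hb.equiv f) := by
    refine Continuous.subtype_mk ?_ _
    exact hf.domRestrict
  exact ⟨hc.homeoOfEquivCompactToT2⟩

/-- A compact set that meets every ray from the origin exactly once is a sphere. -/
theorem nonempty_homeomorph_sphere {n : ℕ} {G : X → EuclideanSpace ℝ (Fin (n + 1))} {K : Set X}
    (hK : IsCompact K) (hG : ContinuousOn G K) (h0 : ∀ x ∈ K, G x ≠ 0)
    (hinj : ∀ x ∈ K, ∀ y ∈ K, ∀ c : ℝ, 0 < c → G x = c • G y → x = y)
    (hsurj : ∀ v, v ≠ 0 → ∃ x ∈ K, ∃ c : ℝ, 0 < c ∧ G x = c • v) :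
    ∃ e : K ≃ₜ UnitSphere n, ∀ x, (e x).1 = ‖G x.1‖⁻¹ • G x.1 := by
  have := isCompact_iff_compactSpace.1 hK
  have hn : ∀ x ∈ K, 0 < ‖G x‖ := fun x hx => norm_pos_iff.2 (h0 x hx)
  let F : K → UnitSphere n := fun x => ⟨‖G x.1‖⁻¹ • G x.1, by
    rw [mem_sphere_zero_iff_norm, norm_smul, norm_inv, norm_norm,
      inv_mul_cancel₀ (hn x.1 x.2).ne']⟩
  have hF : Continuous F := by
    refine Continuous.subtype_mk ?_ _
    have : Continuous fun x : K => G x.1 := hG.domRestrict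
    exact (this.norm.inv₀ fun x => (hn x.1 x.2).ne').smul this
  have hbij : Function.Bijective F := by
    constructor
    · intro x y h
      have h1 : ‖G x.1‖⁻¹ • G x.1 = ‖G y.1‖⁻¹ • G y.1 := congrArg Subtype.val h
      refine Subtype.ext (hinj x.1 x.2 y.1 y.2 (‖G x.1‖ * ‖G y.1‖⁻¹) ?_ ?_)
      · exact mul_pos (hn _ x.2) (inv_pos.2 (hn _ y.2))
      · rw [mul_smul, ← h1, smul_smul, mul_inv_cancel₀ (hn _ x.2).ne', one_smul]
    · intro v
      have hv : ‖v.1‖ = 1 := mem_sphere_zero_iff_norm.1 v.2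
      obtain ⟨x, hx, c, hc, e⟩ := hsurj v.1 (by rw [← norm_pos_iff, hv]; exact one_pos)
      refine ⟨⟨x, hx⟩, Subtype.ext ?_⟩
      change ‖G x‖⁻¹ • G x = v.1
      rw [e, norm_smul, hv, Real.norm_of_nonneg hc.le, mul_one, smul_smul,
        inv_mul_cancel₀ hc.ne', one_smul]
  exact ⟨Continuous.homeoOfEquivCompactToT2 (f := Equiv.ofBijective F hbij) hF, fun x => rfl⟩

end Glue

/-! ### Solid tori -/

section Solid

/-- A model of the plane: the cone on the triangle. -/
def plane : Set (ZMod 3 → ℝ) := {p | (∀ i, 0 ≤ p i) ∧ ∃ i, p i = 0}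

theorem isClosed_plane : IsClosed plane := by
  have : plane = (⋂ i, {p | 0 ≤ p i}) ∩ ⋃ i, {p | p i = 0} := by
    ext p
    simp [plane]
  rw [this]
  refine (isClosed_iInter fun i => ?_).inter (isClosed_iUnion_of_finite fun i => ?_)
  · exact isClosed_le continuous_const (continuous_apply i)
  · exact isClosed_eq (continuous_apply i) continuous_const

theorem smul_mem_plane {p : ZMod 3 → ℝ} (hp : p ∈ plane) {c : ℝ} (hc : 0 ≤ c) : c • p ∈ plane := by
  obtain ⟨h, i, hi⟩ := hp
  exact ⟨fun j => mul_nonneg hc (h j), i, by simp [hi]⟩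

theorem mem_circ_iff {p : ZMod 3 → ℝ} : p ∈ circ ↔ p ∈ plane ∧ ∑ i, p i = 1 := by
  simp only [circ, plane, stdSimplex, Set.mem_ofPred_eq]
  tauto

theorem sum_smul' (c : ℝ) (p : ZMod 3 → ℝ) : ∑ i, (c • p) i = c * ∑ i, p i := by
  simp [mul_sum]

theorem smul_circ_injective {p q : ZMod 3 → ℝ} (hp : p ∈ circ) (hq : q ∈ circ) {c d : ℝ}
    (hc : 0 < c) (h : c • p = d • q) : c = d ∧ p = q := by
  have := congrArg (fun p => ∑ i, p i) h
  simp only [sum_smul', (mem_circ_iff.1 hp).2, (mem_circ_iff.1 hq).2, mul_one] at this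
  subst this
  exact ⟨rfl, smul_right_injective _ hc.ne' h⟩

theorem inv_smul_mem_circ {p : ZMod 3 → ℝ} (hp : p ∈ plane) (h : 0 < ∑ i, p i) :
    (∑ i, p i)⁻¹ • p ∈ circ :=
  mem_circ_iff.2 ⟨smul_mem_plane hp (inv_nonneg.2 h.le), by rw [sum_smul', inv_mul_cancel₀ h.ne']⟩

/-- A model of the solid torus. -/
def solid (r : ℝ) : Set ((ZMod 3 → ℝ) × (ZMod 3 → ℝ)) :=
  {p | p.1 ∈ plane ∧ ∑ i, p.1 i ≤ r ∧ p.2 ∈ circ}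

variable {E : Type*} [TopologicalSpace E]

/-- `f` identifies `X` with the solid torus of radius `r`, and the boundary torus `T`, with
coordinates `e`, with the standard torus by means of `χ`. -/
structure IsSolid (X T : Set E) (r : ℝ) (f e : E → (ZMod 3 → ℝ) × (ZMod 3 → ℝ))
    (χ : (ZMod 3 → ℝ) × (ZMod 3 → ℝ) → (ZMod 3 → ℝ) × (ZMod 3 → ℝ)) : Prop where
  isCompact : IsCompact X
  continuousOn : ContinuousOn f X
  bijOn : Set.BijOn f X (solid r)
  mem_iff : ∀ x ∈ X, ∑ i, (f x).1 i = r ↔ x ∈ T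
  eq : ∀ x ∈ T, f x = (r • (χ (e x)).1, (χ (e x)).2)
  subset : T ⊆ X

-- The new piece S is torus × [0, 1] and goes to the shell between the radii r and r + 1, its
-- angular part being constant along [0, 1] in its own coordinates. The gluing map need not extend
-- over the solid torus: it is only recorded in the boundary parametrization, which changes from χ
-- to χ ∘ ρ.
open Classical in
theorem IsSolid.glue [T2Space E] {X T S : Set E} {r : ℝ} {f e a : E → (ZMod 3 → ℝ) × (ZMod 3 → ℝ)} {t : E → ℝ}
    {χ ρ : (ZMod 3 → ℝ) × (ZMod 3 → ℝ) → (ZMod 3 → ℝ) × (ZMod 3 → ℝ)} (h : IsSolid X T r f e χ)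
    (hr : 0 < r) (hS : IsCompact S) (ha : ContinuousOn a S) (ht : ContinuousOn t S)
    (hb : Set.BijOn (fun x => (a x, t x)) S ((circ ×ˢ circ) ×ˢ Set.Icc 0 1))
    (htT : ∀ x ∈ S, t x = 0 ↔ x ∈ T) (hTS : T ⊆ S) (hXS : X ∩ S ⊆ T)
    (hχ : ContinuousOn χ (circ ×ˢ circ)) (hχb : Set.BijOn χ (circ ×ˢ circ) (circ ×ˢ circ))
    (hρ : ContinuousOn ρ (circ ×ˢ circ)) (hρb : Set.BijOn ρ (circ ×ˢ circ) (circ ×ˢ circ))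
    (hρe : ∀ x ∈ T, e x = ρ (a x)) :
    IsSolid (X ∪ S) {x | x ∈ S ∧ t x = 1} (r + 1) (fun x => if x ∈ X then f x else
      ((r + t x) • (χ (ρ (a x))).1, (χ (ρ (a x))).2)) a (χ ∘ ρ) := by
  have hc : ContinuousOn (χ ∘ ρ) (circ ×ˢ circ) := hχ.comp hρ hρb.mapsTo
  have hcb : Set.BijOn (χ ∘ ρ) (circ ×ˢ circ) (circ ×ˢ circ) := hχb.comp hρb
  have haS : Set.MapsTo a S (circ ×ˢ circ) := fun x hx => (hb.mapsTo hx).1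
  have htS : ∀ x ∈ S, t x ∈ Set.Icc (0 : ℝ) 1 := fun x hx => (hb.mapsTo hx).2
  have hang : ∀ x ∈ S, (χ (ρ (a x))).1 ∈ circ ∧ (χ (ρ (a x))).2 ∈ circ :=
    fun x hx => hcb.mapsTo (haS hx)
  have hsum : ∀ x ∈ S, ∑ i, ((r + t x) • (χ (ρ (a x))).1) i = r + t x := fun x hx => by
    rw [sum_smul', (mem_circ_iff.1 (hang x hx).1).2, mul_one]
  have hagree : ∀ x ∈ X, x ∈ S → f x = ((r + t x) • (χ (ρ (a x))).1, (χ (ρ (a x))).2) := by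
    intro x hx hxS
    have hT := hXS ⟨hx, hxS⟩
    rw [h.eq x hT, hρe x hT, (htT x hxS).2 hT, add_zero]
  have hgb : Set.BijOn (fun x => ((r + t x) • (χ (ρ (a x))).1, (χ (ρ (a x))).2)) S
      {p | p ∈ solid (r + 1) ∧ r ≤ ∑ i, p.1 i} := by
    refine ⟨fun x hx => ?_, fun x hx y hy e => ?_, ?_⟩
    · have h1 := hsum x hx
      have h2 := htS x hx
      refine ⟨⟨smul_mem_plane (mem_circ_iff.1 (hang x hx).1).1 (by linarith [h2.1]), ?_,
        (hang x hx).2⟩, ?_⟩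
      · rw [h1]; linarith [h2.2]
      · rw [h1]; linarith [h2.1]
    · simp only [Prod.mk.injEq] at e
      obtain ⟨e1, e2⟩ := smul_circ_injective (hang x hx).1 (hang y hy).1
        (by linarith [(htS x hx).1]) e.1
      have e3 : a x = a y := hcb.injOn (haS hx) (haS hy) (Prod.ext e2 e.2)
      exact hb.injOn hx hy (Prod.ext e3 (by simpa using e1))
    · rintro ⟨p, q⟩ ⟨⟨hp, hp1, hq⟩, hp2⟩
      simp only at hp hp1 hq hp2
      have hp0 : 0 < ∑ i, p i := by linarith
      obtain ⟨z, hz, hze⟩ := hcb.surjOn (⟨inv_smul_mem_circ hp hp0, hq⟩ :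
        ((∑ i, p i)⁻¹ • p, q) ∈ circ ×ˢ circ)
      obtain ⟨x, hx, hxe⟩ := hb.surjOn (⟨hz, by constructor <;> simp only <;> linarith⟩ :
        (z, ∑ i, p i - r) ∈ (circ ×ˢ circ) ×ˢ Set.Icc (0 : ℝ) 1)
      simp only [Prod.mk.injEq] at hxe
      obtain ⟨hxa, hxt⟩ := hxe
      refine ⟨x, hx, ?_⟩
      simp only [Function.comp_apply] at hze
      simp only [hxa, hxt, hze]
      rw [add_sub_cancel, smul_smul, mul_inv_cancel₀ hp0.ne', one_smul]
  refine ⟨h.isCompact.union hS, ?_, ?_, ?_, ?_, fun x hx => .inr hx.1⟩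
  · refine continuousOn_glue h.isCompact.isClosed hS.isClosed h.continuousOn ?_ hagree
    have hca : ContinuousOn (fun x => χ (ρ (a x))) S := hc.comp ha haS
    exact ((continuousOn_const.add ht).smul hca.fst).prodMk hca.snd
  · have hu : solid (r + 1) = solid r ∪ {p | p ∈ solid (r + 1) ∧ r ≤ ∑ i, p.1 i} := by
      ext p
      constructor
      · intro hp
        rcases le_total (∑ i, p.1 i) r with h | h
        · exact .inl ⟨hp.1, h, hp.2.2⟩
        · exact .inr ⟨hp, h⟩
      · rintro (hp | hp)
        · exact ⟨hp.1, by linarith [hp.2.1], hp.2.2⟩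
        · exact hp.1
    rw [hu]
    refine bijOn_glue h.bijOn hgb hagree fun x hx y hy e => ?_
    refine hTS ((h.mem_iff x hx).1 (le_antisymm (h.bijOn.mapsTo hx).2.1 ?_))
    rw [e, hsum y hy]
    linarith [(htS y hy).1]
  · rintro x hx
    by_cases hxX : x ∈ X
    · have h1 := (h.bijOn.mapsTo hxX).2.1
      simp only [if_pos hxX, Set.mem_ofPred_eq]
      constructor
      · intro h2
        linarith
      · rintro ⟨h2, h3⟩
        have := (htT x h2).2 (hXS ⟨hxX, h2⟩)
        linarith
    · have hxS := hx.resolve_left hxX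
      simp only [if_neg hxX, Set.mem_ofPred_eq, hsum x hxS]
      constructor
      · intro h2
        exact ⟨hxS, by linarith⟩
      · rintro ⟨-, h3⟩
        linarith
  · rintro x ⟨hx, hx1⟩
    have hxX : x ∉ X := fun hX => by
      have := (htT x hx).2 (hXS ⟨hX, hx⟩)
      linarith
    simp only [if_neg hxX, hx1, Function.comp_apply]

theorem IsSolid.congr {X X' T T' : Set E} {r r' : ℝ}
    {f e e' : E → (ZMod 3 → ℝ) × (ZMod 3 → ℝ)}
    {χ χ' : (ZMod 3 → ℝ) × (ZMod 3 → ℝ) → (ZMod 3 → ℝ) × (ZMod 3 → ℝ)} (h : IsSolid X T r f e χ)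
    (hX : X = X') (hT : T = T') (hr : r = r') (he : ∀ x ∈ T, χ (e x) = χ' (e' x)) :
    IsSolid X' T' r' f e' χ' := by
  subst hX hT hr
  exact ⟨h.isCompact, h.continuousOn, h.bijOn, h.mem_iff, fun x hx => by rw [← he x hx, h.eq x hx],
    h.subset⟩

end Solid
end HopfBound
end

noncomputable section
namespace HopfBound
open Finset

/-! ### Models of the layers -/

section Faces

variable {U V W : Type} [Fintype U] [Fintype V]

theorem pushf_comp_self {f : V → W} (hf : Function.Injective f) {x : W → ℝ}
    (hx : ∀ w, (∀ v, f v ≠ w) → x w = 0) : pushf f (x ∘ f) = x := by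
  ext w
  by_cases hw : ∃ v, f v = w
  · obtain ⟨v, rfl⟩ := hw
    exact pushf_apply_of_injective hf _ v
  · push Not at hw
    rw [hx w hw]
    exact pushf_eq_zero fun v hv => absurd hv (hw v)

theorem pushf_comp_eq {f : V → W} (hf : Function.Injective f) (x : V → ℝ) : pushf f x ∘ f = x :=
  funext fun v => pushf_apply_of_injective hf x v

theorem pushf_injective {f : V → W} (hf : Function.Injective f) : Function.Injective (pushf f) :=
  fun x y h => by rw [← pushf_comp_eq hf x, h, pushf_comp_eq hf]

theorem pushf_eq_zero_iff {f : V → W} {x : V → ℝ} (hx : ∀ v, 0 ≤ x v) (w : W) :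
    pushf f x w = 0 ↔ ∀ v, f v = w → x v = 0 :=
  ⟨fun h _ hv => eq_zero_of_pushf_eq_zero hx h hv, pushf_eq_zero⟩

variable {ι κ : Type} {d e : ℕ}

/-- Membership of points is reduced to inclusions between vertex sets, so that for concrete
triangulations the hypotheses are finite checks. -/
theorem pushf_mem_iUnion_cell_iff [Fintype W] {s : V → W} (hs : Function.Injective s)
    {τ : ι → Fin (d + 1) → W} {θ : κ → Fin (e + 1) → V}
    (h1 : ∀ k, ∃ i, ∀ p, ∃ q, τ i q = s (θ k p))
    (h2 : ∀ i, ∃ k, ∀ v, (∃ q, τ i q = s v) → ∃ p, θ k p = v) (u : V → ℝ) :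
    pushf s u ∈ ⋃ i, cell (τ i) ↔ u ∈ ⋃ k, cell (θ k) := by
  simp only [Set.mem_iUnion]
  constructor
  · rintro ⟨i, hi⟩
    obtain ⟨k, hk⟩ := h2 i
    refine ⟨k, ⟨fun v => ?_, ?_⟩, fun v hv => ?_⟩
    · rw [← pushf_apply_of_injective hs u v]
      exact hi.1.1 _
    · rw [← sum_pushf s, hi.1.2]
    · rw [← pushf_apply_of_injective hs u v]
      refine hi.2 _ fun q hq => ?_
      obtain ⟨p, hp⟩ := hk v ⟨q, hq⟩
      exact hv p hp
  · rintro ⟨k, hk⟩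
    obtain ⟨i, hi⟩ := h1 k
    refine ⟨i, pushf_mem_stdSimplex s hk.1, fun w hw => pushf_eq_zero fun v hv => hk.2 v ?_⟩
    rintro p rfl
    obtain ⟨q, hq⟩ := hi p
    exact hw q (hq.trans hv)

theorem mem_cell_of_forall {V : Type} [Fintype V] {t : Fin (d + 1) → V} {x : V → ℝ}
    (h0 : ∀ v, 0 ≤ x v) (h1 : ∑ v, x v = 1) (h : ∀ v, x v ≠ 0 → ∃ p, t p = v) : x ∈ cell t :=
  ⟨⟨h0, h1⟩, fun v hv => by_contra fun hx => by
    obtain ⟨p, hp⟩ := h v hx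
    exact hv p hp⟩

end Faces

section Models

/-- The triangles of the torus `C₃ × C₃`. -/
def torTri : (ZMod 3 × ZMod 3) × Bool → Fin 3 → ZMod 3 × ZMod 3
  | ((i, j), false) => ![(i, j), (i, j + 1), (i + 1, j + 1)]
  | ((i, j), true) => ![(i, j), (i + 1, j), (i + 1, j + 1)]

/-- The triangulated torus `C₃ × C₃`. -/
def tor : Set (ZMod 3 × ZMod 3 → ℝ) := ⋃ x, cell (torTri x)

theorem isCompact_tor : IsCompact tor := isCompact_iUnion fun _ => isCompact_cell _

/-- The triangles of the annulus `C₃ × [0, 1]`. -/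
def colTri : ZMod 3 × Bool → Fin 3 → Bool × ZMod 3
  | (i, false) => ![(false, i), (false, i + 1), (true, i + 1)]
  | (i, true) => ![(false, i), (true, i), (true, i + 1)]

/-- The coordinates on the annulus. -/
def annCoord (β : Bool × ZMod 3 → ℝ) : (ZMod 3 → ℝ) × ℝ :=
  (pushf Prod.snd β, pushf Prod.fst β true)

theorem sum_snd (β : Bool × ZMod 3 → ℝ) (i : ZMod 3) :
    pushf Prod.snd β i = β (true, i) + β (false, i) := by
  rw [pushf_snd, Fintype.sum_bool]

theorem staircase_of_mem_annulus {β : Bool × ZMod 3 → ℝ} (hβ : β ∈ triUnion colTri) :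
    ∃ j : ZMod 3, (∀ b, β (b, j + 2) = 0) ∧
      ∀ b b', 0 < β (b, j) → 0 < β (b', j + 1) → b = b' ∨ (b = false ∧ b' = true) := by
  obtain ⟨⟨i, u⟩, hβ⟩ := Set.mem_iUnion.1 hβ
  have h1 : ∀ i u b p, colTri (i, u) p ≠ (b, i + 2) := by decide
  have h2 : ∀ i u, ∃ p, ∀ q, colTri (i, u) q ≠ (p, bif p then i else i + 1) := by decide
  refine ⟨i, fun b => hβ.2 _ (h1 i u b), fun b b' hb hb' => ?_⟩
  cases b <;> cases b' <;> simp only [reduceCtorEq, or_self, and_self, and_false, or_false,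
    true_or, or_true, and_true, Bool.false_eq_true, false_and]
  obtain ⟨p, hp⟩ := h2 i u
  have := hβ.2 _ hp
  cases p
  · exact hb'.ne' this
  · exact hb.ne' this

/-- This is the staircase argument with an interval as base: a point of the annulus is a monotone
coupling of a point of the circle with a distribution on `false < true`, whence injectivity by
`coupling_unique`. -/
theorem bijOn_annCoord :
    Set.BijOn annCoord (triUnion colTri) (circ ×ˢ Set.Icc (0 : ℝ) 1) := by
  refine ⟨?_, ?_, ?_⟩
  · intro β hβ
    obtain ⟨j, hj, -⟩ := staircase_of_mem_annulus hβ
    obtain ⟨x, hβ⟩ := Set.mem_iUnion.1 hβ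
    have h1 := pushf_mem_stdSimplex (Prod.snd : Bool × ZMod 3 → ZMod 3) hβ.1
    have h2 := pushf_mem_stdSimplex (Prod.fst : Bool × ZMod 3 → Bool) hβ.1
    refine ⟨⟨h1, j + 2, ?_⟩, h2.1 true, ?_⟩
    · change pushf Prod.snd β (j + 2) = 0
      rw [sum_snd, hj, hj, add_zero]
    · have := h2.2
      rw [Fintype.sum_bool] at this
      change pushf Prod.fst β true ≤ 1
      linarith [h2.1 false]
  · intro β hβ β' hβ' h
    obtain ⟨j, hj, hs⟩ := staircase_of_mem_annulus hβ
    obtain ⟨j', hj', hs'⟩ := staircase_of_mem_annulus hβ'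
    obtain ⟨x, hβ⟩ := Set.mem_iUnion.1 hβ
    obtain ⟨x', hβ'⟩ := Set.mem_iUnion.1 hβ'
    simp only [annCoord, Prod.mk.injEq] at h
    have e1 := sum_pushf (Prod.fst : Bool × ZMod 3 → Bool) β
    have e2 := sum_pushf (Prod.fst : Bool × ZMod 3 → Bool) β'
    rw [Fintype.sum_bool, hβ.1.2] at e1
    rw [Fintype.sum_bool, hβ'.1.2] at e2
    refine coupling_unique (lt := fun b b' => b = false ∧ b' = true) (by decide)
      hβ.1.1 hβ'.1.1 hj hj' hs hs' (fun b => ?_) fun i => ?_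
    · rw [← pushf_fst, ← pushf_fst]
      cases b
      · linarith [h.2]
      · exact h.2
    · rw [← pushf_snd, ← pushf_snd, h.1]
  · rintro ⟨y, t⟩ ⟨⟨⟨hy, hy1⟩, i, hi⟩, ht0, ht1⟩
    simp only at hy hy1 hi ht0 ht1
    rw [← zmod_three_add i] at hi
    generalize i + 1 = j at hi
    rw [sum_zmod_three _ j, hi] at hy1
    obtain ⟨n1, n2, n3⟩ := zmod_three_ne j
    have y0 := hy j
    have y1 := hy (j + 1)
    have mk : ∀ (u : Bool) (c : Fin 3 → ℝ), c ∈ stdSimplex ℝ (Fin 3) →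
        pushf (Prod.snd ∘ colTri (j, u)) c j = y j →
        pushf (Prod.snd ∘ colTri (j, u)) c (j + 1) = y (j + 1) →
        pushf (Prod.snd ∘ colTri (j, u)) c (j + 2) = y (j + 2) →
        pushf (Prod.fst ∘ colTri (j, u)) c true = t →
        (y, t) ∈ annCoord '' triUnion colTri := by
      intro u c hc h1 h2 h3 h4
      refine ⟨pushf (colTri (j, u)) c, Set.mem_iUnion.2 ⟨(j, u), pushf_tuple_mem_cell _ hc⟩, ?_⟩
      rw [annCoord, pushf_comp, pushf_comp, h4]
      congr 1
      ext i
      rcases zmod_three_cases i j with rfl | rfl | rfl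
      exacts [h1, h2, h3]
    have std : ∀ c : Fin 3 → ℝ, 0 ≤ c 0 → 0 ≤ c 1 → 0 ≤ c 2 →
        c 0 + c 1 + c 2 = 1 → c ∈ stdSimplex ℝ (Fin 3) := by
      intro c h0 h1 h2 h4
      refine ⟨fun p => ?_, by rw [Fin.sum_univ_three, h4]⟩
      fin_cases p <;> assumption
    -- The mass t of the upper circle is taken from the vertex j + 1 first; the comparison decides
    -- which of the two triangles contains the point.
    rcases le_total t (y (j + 1)) with h | h
    · refine mk false ![y j, y (j + 1) - t, t] (std _ ?_ ?_ ?_ ?_) ?_ ?_ ?_ ?_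
      · exact y0
      · simpa using h
      · exact ht0
      · simp; linarith
      all_goals simp [pushf, colTri, Fin.sum_univ_three, n1, n2, n3, n1.symm, n2.symm, n3.symm, hi]
    · refine mk true ![1 - t, t - y (j + 1), y (j + 1)] (std _ ?_ ?_ ?_ ?_) ?_ ?_ ?_ ?_
      · simpa using ht1
      · simpa using h
      · exact y1
      · simp
      all_goals simp [pushf, colTri, Fin.sum_univ_three, n1, n2, n3, n1.symm, n2.symm, n3.symm, hi]
      linarith

/-- The layer triangles as a family. -/
def slabTri' (x : ZMod 3 × Bool) : Fin 3 → Bool × ZMod 3 := slabTri x.1 x.2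

theorem triUnion_congr {B ι : Type} [Fintype B] {tri tri' : ι → Fin 3 → B}
    (h : ∀ i b, (∃ p, tri i p = b) ↔ ∃ p, tri' i p = b) : triUnion tri = triUnion tri' := by
  refine Set.iUnion_congr fun i => ?_
  ext x
  refine and_congr_right fun _ => forall_congr' fun b => imp_congr_left ?_
  have := h i b
  rw [← not_exists, ← not_exists, this]

/-- The two families have the same triangles. Only the orders of their vertices differ, which
affects the staircase triangulation of the product but not the annulus. -/
theorem triUnion_slabTri' : triUnion slabTri' = triUnion colTri :=
  triUnion_congr (by decide)

/-- The vertices of a face of the layer. -/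
def topFace (x : ZMod 3 × ZMod 3) : (Bool × ZMod 3) × ZMod 3 := ((true, x.1), x.2)

/-- The coordinates on the layer. -/
def slabCoord (w : (Bool × ZMod 3) × ZMod 3 → ℝ) : (ZMod 3 → ℝ) × (ZMod 3 → ℝ) :=
  (pushf (fun v => v.1.2) w, pushf Prod.snd w)

/-- The height on the layer. -/
def height (w : (Bool × ZMod 3) × ZMod 3 → ℝ) : ℝ := pushf (fun v => v.1.1) w true

/-- The coordinates on the torus. -/
def torCoord (u : ZMod 3 × ZMod 3 → ℝ) : (ZMod 3 → ℝ) × (ZMod 3 → ℝ) :=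
  (pushf Prod.fst u, pushf Prod.snd u)

/-- A triangulation of `annulus × circle` whose boundary tori are standard. -/
structure IsSlab (tri : ZMod 3 × Bool → Fin 3 → Bool × ZMod 3)
    (bot : ZMod 3 × ZMod 3 → (Bool × ZMod 3) × ZMod 3) : Prop where
  bijOn : Set.BijOn (fun w => (slabCoord w, height w)) (prodUnion tri)
    ((circ ×ˢ circ) ×ˢ Set.Icc (0 : ℝ) 1)
  mem_top : ∀ u, pushf topFace u ∈ prodUnion tri ↔ u ∈ tor
  mem_bot : ∀ u, pushf bot u ∈ prodUnion tri ↔ u ∈ tor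
  bot_inj : Function.Injective bot
  bot_fst : ∀ x, (bot x).1.1 = false
  bot_surj : ∀ x j, ∃ y, bot y = ((false, x), j)

theorem isSlab_of {tri : ZMod 3 × Bool → Fin 3 → Bool × ZMod 3}
    {bot : ZMod 3 × ZMod 3 → (Bool × ZMod 3) × ZMod 3} {lt : Bool × ZMod 3 → Bool × ZMod 3 → Prop}
    (h : triUnion tri = triUnion colTri) (hlt : ∀ b b', lt b b' → ¬ lt b' b)
    (htri : ∀ T p q, p < q → lt (tri T p) (tri T q)) (hinj : ∀ T, Function.Injective (tri T))
    (h1 : ∀ k, ∃ i, ∀ p, ∃ q, prodTet tri i q = topFace (torTri k p))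
    (h2 : ∀ i, ∃ k, ∀ v, (∃ q, prodTet tri i q = topFace v) → ∃ p, torTri k p = v)
    (h3 : ∀ k, ∃ i, ∀ p, ∃ q, prodTet tri i q = bot (torTri k p))
    (h4 : ∀ i, ∃ k, ∀ v, (∃ q, prodTet tri i q = bot v) → ∃ p, torTri k p = v)
    (h5 : Function.Injective bot) (h6 : ∀ x, (bot x).1.1 = false)
    (h7 : ∀ x j, ∃ y, bot y = ((false, x), j)) : IsSlab tri bot := by
  refine ⟨?_, fun u => ?_, fun u => ?_, h5, h6, h7⟩
  · have b1 := bijOn_marg hlt htri hinj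
    rw [h] at b1
    have b2 : Set.BijOn (fun z : (Bool × ZMod 3 → ℝ) × (ZMod 3 → ℝ) =>
        (((annCoord z.1).1, z.2), (annCoord z.1).2)) (triUnion colTri ×ˢ circ)
        ((circ ×ˢ circ) ×ˢ Set.Icc (0 : ℝ) 1) := by
      refine ⟨fun z hz => ?_, fun z hz z' hz' e => ?_, ?_⟩
      · have := bijOn_annCoord.mapsTo hz.1
        exact ⟨⟨this.1, hz.2⟩, this.2⟩
      · simp only [Prod.mk.injEq] at e
        exact Prod.ext (bijOn_annCoord.injOn hz.1 hz'.1 (Prod.ext e.1.1 e.2)) e.1.2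
      · rintro ⟨⟨x, y⟩, t⟩ ⟨⟨hx, hy⟩, ht⟩
        obtain ⟨β, hβ, e⟩ := bijOn_annCoord.surjOn (⟨hx, ht⟩ : (x, t) ∈ circ ×ˢ Set.Icc (0 : ℝ) 1)
        exact ⟨(β, y), ⟨hβ, hy⟩, by simp only [e]⟩
    refine (b2.comp b1).congr fun w _ => ?_
    simp only [Function.comp_apply, marg, annCoord, pushf_comp]
    rfl
  · exact pushf_mem_iUnion_cell_iff (by decide) h1 h2 u
  · exact pushf_mem_iUnion_cell_iff h5 h3 h4 u

/-- The bottom face of a layer, in the coordinates of the previous level. -/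
def slabBot (x : ZMod 3 × ZMod 3) : (Bool × ZMod 3) × ZMod 3 := ((false, x.2 - x.1), x.1)

/-- The bottom face of a collar. -/
def colBot (x : ZMod 3 × ZMod 3) : (Bool × ZMod 3) × ZMod 3 := ((false, x.1), x.2)

/-- The finite checks include that the bottom torus, relabelled by the shear `slabBot`, is the
standard `tor` again. Here the reversed lower edges are needed. -/
theorem isSlab_slabTri : IsSlab slabTri' slabBot :=
  isSlab_of (lt := fun b b' => ∃ T p q, p < q ∧ slabTri' T p = b ∧ slabTri' T q = b')
    triUnion_slabTri' (by decide) (fun T p q h => ⟨T, p, q, h, rfl, rfl⟩)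
    (fun T => slabTri_injective T.1 T.2) (by decide +kernel) (by decide +kernel)
    (by decide +kernel) (by decide +kernel) (by decide) (by decide) (by decide)

theorem colTri_injective : ∀ T, Function.Injective (colTri T) := by decide

theorem isSlab_colTri : IsSlab colTri colBot :=
  isSlab_of (lt := fun b b' => ∃ T p q, p < q ∧ colTri T p = b ∧ colTri T q = b')
    rfl (by decide) (fun T p q h => ⟨T, p, q, h, rfl, rfl⟩)
    colTri_injective (by decide +kernel) (by decide +kernel)
    (by decide +kernel) (by decide +kernel) (by decide) (by decide) (by decide)

end Models
end HopfBound
end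

noncomputable section
namespace HopfBound
open Finset

/-! ### Boundary tori of a layer and the induced change of coordinates -/

section SlabFaces

variable {tri : ZMod 3 × Bool → Fin 3 → Bool × ZMod 3}
  {bot : ZMod 3 × ZMod 3 → (Bool × ZMod 3) × ZMod 3}

theorem topFace_injective : Function.Injective topFace := by decide

theorem slabCoord_topFace (u : ZMod 3 × ZMod 3 → ℝ) :
    slabCoord (pushf topFace u) = torCoord u := by
  simp only [slabCoord, torCoord, pushf_comp]
  rfl

theorem mem_stdSimplex_of_mem_prodUnion {B Tri : Type} [Fintype B] {tri : Tri → Fin 3 → B}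
    {w : B × ZMod 3 → ℝ} (hw : w ∈ prodUnion tri) : w ∈ stdSimplex ℝ (B × ZMod 3) := by
  obtain ⟨x, hx⟩ := Set.mem_iUnion.1 hw
  exact hx.1

theorem height_add {w : (Bool × ZMod 3) × ZMod 3 → ℝ} (hw : w ∈ stdSimplex ℝ _) :
    height w + pushf (fun v => v.1.1) w false = 1 := by
  rw [height, ← Fintype.sum_bool fun b => pushf (fun v : (Bool × ZMod 3) × ZMod 3 => v.1.1) w b,
    sum_pushf, hw.2]

theorem IsSlab.height_eq_one_iff (h : IsSlab tri bot) {w : (Bool × ZMod 3) × ZMod 3 → ℝ}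
    (hw : w ∈ prodUnion tri) : height w = 1 ↔ w ∈ pushf topFace '' tor := by
  have hs := mem_stdSimplex_of_mem_prodUnion hw
  constructor
  · intro h1
    have h2 := height_add hs
    rw [h1, add_eq_left, pushf_eq_zero_iff hs.1] at h2
    have h3 : pushf topFace (w ∘ topFace) = w := pushf_comp_self topFace_injective fun v hv => by
      refine h2 v ?_
      obtain ⟨⟨b, x⟩, j⟩ := v
      cases b
      · rfl
      · exact absurd rfl (hv (x, j))
    exact ⟨w ∘ topFace, (h.mem_top _).1 (by rwa [h3]), h3⟩
  · rintro ⟨u, hu, rfl⟩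
    have h2 := height_add hs
    rw [pushf_comp, pushf_eq_zero (by simp [topFace]), add_zero] at h2
    exact h2

theorem IsSlab.height_eq_zero_iff (h : IsSlab tri bot) {w : (Bool × ZMod 3) × ZMod 3 → ℝ}
    (hw : w ∈ prodUnion tri) : height w = 0 ↔ w ∈ pushf bot '' tor := by
  have hs := mem_stdSimplex_of_mem_prodUnion hw
  constructor
  · intro h2
    rw [height, pushf_eq_zero_iff hs.1] at h2
    have h3 : pushf bot (w ∘ bot) = w := pushf_comp_self h.bot_inj fun v hv => by
      refine h2 v ?_
      obtain ⟨⟨b, x⟩, j⟩ := v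
      cases b
      · obtain ⟨y, hy⟩ := h.bot_surj x j
        exact absurd hy (hv y)
      · rfl
    exact ⟨w ∘ bot, (h.mem_bot _).1 (by rwa [h3]), h3⟩
  · rintro ⟨u, hu, rfl⟩
    rw [height, pushf_comp, pushf_eq_zero]
    intro v hv
    simp [h.bot_fst] at hv

theorem continuous_slabCoord : Continuous slabCoord :=
  (continuous_pushf _).prodMk (continuous_pushf _)

theorem continuous_height : Continuous height := (continuous_apply true).comp (continuous_pushf _)

theorem continuous_torCoord : Continuous torCoord :=
  (continuous_pushf _).prodMk (continuous_pushf _)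

theorem IsSlab.bijOn_bot (h : IsSlab tri bot) :
    Set.BijOn (fun u => slabCoord (pushf bot u)) tor (circ ×ˢ circ) := by
  have h0 : ∀ u ∈ tor, height (pushf bot u) = 0 := fun u hu =>
    (h.height_eq_zero_iff ((h.mem_bot u).2 hu)).2 ⟨u, hu, rfl⟩
  refine ⟨fun u hu => (h.bijOn.mapsTo ((h.mem_bot u).2 hu)).1, fun u hu u' hu' e => ?_, ?_⟩
  · refine pushf_injective h.bot_inj (h.bijOn.injOn ((h.mem_bot u).2 hu) ((h.mem_bot u').2 hu') ?_)
    simp only [h0 u hu, h0 u' hu']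
    exact congrArg (·, (0 : ℝ)) e
  · intro z hz
    obtain ⟨w, hw, e⟩ := h.bijOn.surjOn (⟨hz, by simp⟩ :
      (z, (0 : ℝ)) ∈ (circ ×ˢ circ) ×ˢ Set.Icc (0 : ℝ) 1)
    simp only [Prod.mk.injEq] at e
    obtain ⟨u, hu, rfl⟩ := (h.height_eq_zero_iff hw).1 e.2
    exact ⟨u, hu, e.1⟩

theorem bijOn_torCoord : Set.BijOn torCoord tor (circ ×ˢ circ) := by
  refine isSlab_colTri.bijOn_bot.congr fun u _ => ?_
  simp only [slabCoord, torCoord, pushf_comp]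
  rfl

variable (bot) in
/-- The change of coordinates between the bottom of a layer and the top of the previous one. -/
def relabel (z : (ZMod 3 → ℝ) × (ZMod 3 → ℝ)) : (ZMod 3 → ℝ) × (ZMod 3 → ℝ) :=
  torCoord (Function.invFunOn (fun u => slabCoord (pushf bot u)) tor z)

theorem IsSlab.relabel_eq (h : IsSlab tri bot) {u : ZMod 3 × ZMod 3 → ℝ} (hu : u ∈ tor) :
    relabel bot (slabCoord (pushf bot u)) = torCoord u :=
  congrArg torCoord (h.bijOn_bot.injOn.leftInvOn_invFunOn hu)

theorem IsSlab.bijOn_relabel (h : IsSlab tri bot) :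
    Set.BijOn (relabel bot) (circ ×ˢ circ) (circ ×ˢ circ) :=
  bijOn_torCoord.comp (Set.BijOn.symm h.bijOn_bot.invOn_invFunOn.symm h.bijOn_bot)

theorem IsSlab.continuousOn_relabel (h : IsSlab tri bot) :
    ContinuousOn (relabel bot) (circ ×ˢ circ) := by
  refine continuous_torCoord.comp_continuousOn ?_
  have := continuousOn_invFunOn isCompact_tor
    (continuous_slabCoord.comp (continuous_pushf bot)).continuousOn h.bijOn_bot.injOn
  rwa [Function.comp_def, h.bijOn_bot.image_eq] at this

end SlabFaces

/-! ### Adding a layer to a solid torus -/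

section Layer

variable {V : Type} [Fintype V] {tri : ZMod 3 × Bool → Fin 3 → Bool × ZMod 3}
  {bot : ZMod 3 × ZMod 3 → (Bool × ZMod 3) × ZMod 3}

/-- The product coordinates and the height of the layer serve as the shell coordinates of
`IsSolid.glue`. The hypothesis `hX` forces height 0 on the overlap, so the layer meets X only in its
bottom torus. -/
theorem IsSlab.glue (h : IsSlab tri bot) {emb : (Bool × ZMod 3) × ZMod 3 → V}
    (hemb : Function.Injective emb) {lo hi : ZMod 3 × ZMod 3 → V} (hlo : emb ∘ bot = lo)
    (hhi : emb ∘ topFace = hi) {X : Set (V → ℝ)} {r : ℝ} (hr : 0 < r)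
    {f : (V → ℝ) → (ZMod 3 → ℝ) × (ZMod 3 → ℝ)}
    {χ : (ZMod 3 → ℝ) × (ZMod 3 → ℝ) → (ZMod 3 → ℝ) × (ZMod 3 → ℝ)}
    (hf : IsSolid X (pushf lo '' tor) r f (fun x => torCoord (x ∘ lo)) χ)
    (hX : ∀ x ∈ X, ∀ v, x (hi v) = 0)
    (hχ : ContinuousOn χ (circ ×ˢ circ)) (hχb : Set.BijOn χ (circ ×ˢ circ) (circ ×ˢ circ)) :
    ∃ f', IsSolid (X ∪ pushf emb '' prodUnion tri) (pushf hi '' tor) (r + 1) f'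
      (fun x => torCoord (x ∘ hi)) (χ ∘ relabel bot) := by
  classical
  subst hlo hhi
  have hS : IsCompact (pushf emb '' prodUnion tri) :=
    (isCompact_prodUnion tri).image (continuous_pushf emb)
  have hres : Continuous fun x : V → ℝ => x ∘ emb := by fun_prop
  have hlo' : Function.Injective (emb ∘ bot) := hemb.comp h.bot_inj
  have hb : Set.BijOn (fun x : V → ℝ => (slabCoord (x ∘ emb), height (x ∘ emb)))
      (pushf emb '' prodUnion tri) ((circ ×ˢ circ) ×ˢ Set.Icc 0 1) := by
    refine h.bijOn.comp (f := fun x : V → ℝ => x ∘ emb)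
      ⟨?_, ?_, fun w hw => ⟨_, ⟨w, hw, rfl⟩, pushf_comp_eq hemb w⟩⟩
    · rintro _ ⟨w, hw, rfl⟩
      simpa only [pushf_comp_eq hemb] using hw
    · rintro _ ⟨w, hw, rfl⟩ _ ⟨w', hw', rfl⟩ e
      simp only [pushf_comp_eq hemb] at e
      rw [e]
  have htT : ∀ x ∈ pushf emb '' prodUnion tri,
      height (x ∘ emb) = 0 ↔ x ∈ pushf (emb ∘ bot) '' tor := by
    rintro _ ⟨w, hw, rfl⟩
    rw [pushf_comp_eq hemb, h.height_eq_zero_iff hw]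
    constructor
    · rintro ⟨u, hu, rfl⟩
      exact ⟨u, hu, (pushf_comp _ _ _).symm⟩
    · rintro ⟨u, hu, e⟩
      exact ⟨u, hu, pushf_injective hemb (by rw [pushf_comp, e])⟩
  have hTS : pushf (emb ∘ bot) '' tor ⊆ pushf emb '' prodUnion tri := by
    rintro _ ⟨u, hu, rfl⟩
    exact ⟨pushf bot u, (h.mem_bot u).2 hu, pushf_comp _ _ _⟩
  have ha : Continuous fun x : V → ℝ => slabCoord (x ∘ emb) := continuous_slabCoord.comp hres
  have ht : Continuous fun x : V → ℝ => height (x ∘ emb) := continuous_height.comp hres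
  have key := hf.glue hr hS ha.continuousOn ht.continuousOn hb htT hTS ?_ hχ hχb h.continuousOn_relabel
    h.bijOn_relabel ?_
  · refine ⟨_, key.congr rfl ?_ rfl ?_⟩
    · ext x
      constructor
      · rintro ⟨⟨w, hw, rfl⟩, hx⟩
        rw [pushf_comp_eq hemb, h.height_eq_one_iff hw] at hx
        obtain ⟨u, hu, rfl⟩ := hx
        exact ⟨u, hu, (pushf_comp _ _ _).symm⟩
      · rintro ⟨u, hu, rfl⟩
        have hw := (h.mem_top u).2 hu
        rw [← pushf_comp]
        refine ⟨⟨_, hw, rfl⟩, ?_⟩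
        rw [pushf_comp_eq hemb]
        exact (h.height_eq_one_iff hw).2 ⟨u, hu, rfl⟩
    · rintro x ⟨⟨w, hw, rfl⟩, hx⟩
      rw [pushf_comp_eq hemb, h.height_eq_one_iff hw] at hx
      obtain ⟨u, hu, rfl⟩ := hx
      simp only [Function.comp_apply]
      rw [pushf_comp_eq hemb, slabCoord_topFace, pushf_comp,
        pushf_comp_eq (hemb.comp topFace_injective)]
  · rintro x ⟨hx, hxS⟩
    refine (htT x hxS).1 ?_
    rw [height, pushf_eq_zero]
    rintro ⟨⟨b, i⟩, j⟩ hv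
    obtain rfl : b = true := hv
    exact hX x hx (i, j)
  · rintro _ ⟨u, hu, rfl⟩
    rw [pushf_comp_eq hlo', ← pushf_comp, pushf_comp_eq hemb, h.relabel_eq hu]

end Layer

/-! ### The core of a solid torus -/

section Core

/-- The coordinates on the cone. -/
theorem bijOn_cone : Set.BijOn (fun (β : Option (ZMod 3) → ℝ) i => β (some i)) (triUnion coneTri)
    {p | p ∈ plane ∧ ∑ i, p i ≤ 1} := by
  have hsum : ∀ β ∈ triUnion coneTri, (∀ i, 0 ≤ β i) ∧ β none + ∑ i, β (some i) = 1 := by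
    intro β hβ
    obtain ⟨j, hβ⟩ := Set.mem_iUnion.1 hβ
    exact ⟨hβ.1.1, by rw [← Fintype.sum_option, hβ.1.2]⟩
  refine ⟨fun β hβ => ?_, fun β hβ β' hβ' e => ?_, ?_⟩
  · obtain ⟨h0, h1⟩ := hsum β hβ
    obtain ⟨j, hβ⟩ := Set.mem_iUnion.1 hβ
    have key : ∀ (j : ZMod 3) p, coneTri j p ≠ some (j + 2) := by decide
    exact ⟨⟨fun i => h0 _, j + 2, hβ.2 _ (key j)⟩, by linarith [h0 none]⟩
  · have h1 := (hsum β hβ).2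
    have h2 := (hsum β' hβ').2
    have e' : ∀ i, β (some i) = β' (some i) := congrFun e
    ext (_ | i)
    · simp only [e'] at h1
      linarith
    · exact e' i
  · rintro p ⟨⟨hp, i, hi⟩, hp1⟩
    refine ⟨fun o => o.elim (1 - ∑ i, p i) p, Set.mem_iUnion.2 ⟨i + 1, mem_cell_of_forall ?_ ?_ ?_⟩,
      rfl⟩
    · rintro (_ | j)
      · exact sub_nonneg.2 hp1
      · exact hp j
    · rw [Fintype.sum_option]
      simp
    · rintro (_ | j) hj
      · exact ⟨0, rfl⟩
      · have : j ≠ i := by rintro rfl; exact hj hi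
        have key : ∀ i j : ZMod 3, j ≠ i → ∃ p, coneTri (i + 1) p = some j := by decide
        exact key i j this

/-- The outer torus of the core. -/
def coneTop (x : ZMod 3 × ZMod 3) : Option (ZMod 3) × ZMod 3 := (some x.1, x.2)

/-- Cone × circle is disc × circle. The permutation s records which circle factor of the outer torus
bounds the disc. -/
theorem isSolid_core {V : Type} [Fintype V] {emb : Option (ZMod 3) × ZMod 3 → V}
    (hemb : Function.Injective emb) {hi : ZMod 3 × ZMod 3 → V} (s : Equiv.Perm (ZMod 3 × ZMod 3))
    (hhi : emb ∘ coneTop ∘ s = hi) (hs : ∀ u, pushf s u ∈ tor ↔ u ∈ tor)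
    {χ : (ZMod 3 → ℝ) × (ZMod 3 → ℝ) → (ZMod 3 → ℝ) × (ZMod 3 → ℝ)}
    (hχ : ∀ u, torCoord (pushf s u) = χ (torCoord u)) :
    ∃ f, IsSolid (pushf emb '' prodUnion coneTri) (pushf hi '' tor) 1 f
      (fun x => torCoord (x ∘ hi)) χ := by
  subst hhi
  have hctop : Function.Injective coneTop := by decide
  have hmem : ∀ u, pushf coneTop u ∈ prodUnion coneTri ↔ u ∈ tor := fun u =>
    pushf_mem_iUnion_cell_iff hctop (by decide +kernel) (by decide +kernel) u
  have hinj : Function.Injective (emb ∘ coneTop ∘ s) := hemb.comp (hctop.comp s.injective)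
  have hres : Continuous fun x : V → ℝ => x ∘ emb := by fun_prop
  let g : (Option (ZMod 3) × ZMod 3 → ℝ) → (ZMod 3 → ℝ) × (ZMod 3 → ℝ) :=
    fun w => (fun i => pushf Prod.fst w (some i), pushf Prod.snd w)
  have hg : Continuous g := by
    refine Continuous.prodMk ?_ (continuous_pushf _)
    exact continuous_pi fun i => (continuous_apply (some i)).comp (continuous_pushf _)
  have hgb : Set.BijOn g (prodUnion coneTri) (solid 1) := by
    have b1 := bijOn_marg (tri := coneTri)
      (lt := fun b b' => ∃ T p q, p < q ∧ coneTri T p = b ∧ coneTri T q = b') (by decide)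
      (fun T p q h => ⟨T, p, q, h, rfl, rfl⟩) coneTri_injective
    have b2 : Set.BijOn (fun z : (Option (ZMod 3) → ℝ) × (ZMod 3 → ℝ) =>
        ((fun i => z.1 (some i), z.2) : (ZMod 3 → ℝ) × (ZMod 3 → ℝ))) (triUnion coneTri ×ˢ circ)
        (solid 1) := by
      refine ⟨fun z hz => ?_, fun z hz z' hz' e => ?_, ?_⟩
      · have := bijOn_cone.mapsTo hz.1
        exact ⟨this.1, this.2, hz.2⟩
      · simp only [Prod.mk.injEq] at e
        exact Prod.ext (bijOn_cone.injOn hz.1 hz'.1 e.1) e.2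
      · rintro ⟨p, q⟩ ⟨hp, hp1, hq⟩
        obtain ⟨β, hβ, rfl⟩ := bijOn_cone.surjOn ⟨hp, hp1⟩
        exact ⟨(β, q), ⟨hβ, hq⟩, rfl⟩
    exact b2.comp b1
  have hgtop : ∀ u, g (pushf coneTop u) = torCoord u := fun u => by
    simp only [g, torCoord, pushf_comp]
    refine Prod.ext (funext fun i => ?_) rfl
    simp only [pushf, coneTop, Function.comp_apply, Option.some.injEq]
    exact sum_congr rfl fun _ _ => by congr
  refine ⟨fun x => g (x ∘ emb), (isCompact_prodUnion coneTri).image (continuous_pushf emb),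
    (hg.comp hres).continuousOn, ?_, ?_, ?_, ?_⟩
  · refine hgb.comp (f := fun x : V → ℝ => x ∘ emb)
      ⟨?_, ?_, fun w hw => ⟨_, ⟨w, hw, rfl⟩, pushf_comp_eq hemb w⟩⟩
    · rintro _ ⟨w, hw, rfl⟩
      simpa only [pushf_comp_eq hemb] using hw
    · rintro _ ⟨w, hw, rfl⟩ _ ⟨w', hw', rfl⟩ e
      simp only [pushf_comp_eq hemb] at e
      rw [e]
  · rintro _ ⟨w, hw, rfl⟩
    simp only [pushf_comp_eq hemb, g]
    have hst := mem_stdSimplex_of_mem_prodUnion hw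
    have h1 := sum_pushf (Prod.fst : Option (ZMod 3) × ZMod 3 → _) w
    rw [Fintype.sum_option, hst.2] at h1
    have h2 := pushf_eq_zero_iff (f := (Prod.fst : Option (ZMod 3) × ZMod 3 → _)) hst.1 none
    constructor
    · intro h3
      have h4 : pushf Prod.fst w none = 0 := by linarith
      have h5 : pushf coneTop (w ∘ coneTop) = w := pushf_comp_self hctop fun v hv => by
        refine h2.1 h4 v ?_
        obtain ⟨_ | i, j⟩ := v
        · rfl
        · exact absurd rfl (hv (i, j))
      refine ⟨pushf s.symm (w ∘ coneTop), (hs _).1 ?_, ?_⟩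
      · rw [pushf_comp, s.self_comp_symm, pushf_id]
        exact (hmem _).1 (by rwa [h5])
      · rw [pushf_comp, ← h5]
        simp only [Function.comp_assoc, s.self_comp_symm, Function.comp_id]
        rw [pushf_comp, h5]
    · rintro ⟨u, hu, e⟩
      rw [← pushf_comp, ← pushf_comp] at e
      obtain rfl := pushf_injective hemb e
      rw [pushf_comp, pushf_eq_zero (by simp [coneTop]), zero_add] at h1
      rw [pushf_comp]
      exact h1
  · rintro _ ⟨u, hu, rfl⟩
    rw [pushf_comp_eq hinj, ← pushf_comp, pushf_comp_eq hemb, ← pushf_comp, hgtop, hχ, one_smul]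
  · rintro _ ⟨u, hu, rfl⟩
    exact ⟨pushf coneTop (pushf s u), (hmem _).2 ((hs u).2 hu), by rw [pushf_comp, pushf_comp]; rfl⟩

end Core
end HopfBound
end

noncomputable section
namespace HopfBound
open Finset

/-! ### The layered solid tori -/

section LayeredSolidTorus

variable {W Tri : Type} [Fintype W] [Fintype Tri] (D : Band W Tri) (n : ℕ)

/-- The vertices of the `k`-th level torus. -/
def lvPair (σ : Bool) (k : ℕ) (x : ZMod 3 × ZMod 3) : Vert W n := lv D n σ k x.1 x.2

/-- The vertices of a layer, uncurried. -/
def slabEmb (σ : Bool) (k : ℕ) (x : (Bool × ZMod 3) × ZMod 3) : Vert W n :=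
  slabVert D n σ k x.1 x.2

/-- The vertices of a core, uncurried. -/
def coneEmb (σ : Bool) (x : Option (ZMod 3) × ZMod 3) : Vert W n := coneVert D n σ x.1 x.2

/-- The part of a layered solid torus inside the `m`-th level torus. -/
def layered (σ : Bool) : ℕ → Set (Vert W n → ℝ)
  | 0 => pushf (coneEmb D n σ) '' prodUnion coneTri
  | m + 1 => layered σ m ∪ pushf (slabEmb D n σ m) '' prodUnion slabTri'

/-- The exchange of the two circle factors for the first of the two solid tori. -/
def twist {α : Type*} (σ : Bool) : Equiv.Perm (α × α) := bif σ then Equiv.refl _ else Equiv.prodComm _ _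

variable {D n}

theorem slabEmb_injective {σ : Bool} {k : ℕ} (hk : k < n) :
    Function.Injective (slabEmb D n σ k) := fun _ _ h =>
  let ⟨h1, h2⟩ := slabVert_inj hk h
  Prod.ext h1 h2

theorem coneEmb_injective (σ : Bool) : Function.Injective (coneEmb D n σ) := fun _ _ h =>
  let ⟨h1, h2⟩ := coneVert_inj h
  Prod.ext h1 h2

theorem layered_apply_eq_zero {σ : Bool} {m : ℕ} (hm : m ≤ n) {x : Vert W n → ℝ}
    (hx : x ∈ layered D n σ m) {v : Vert W n} (h1 : ∀ j, v ≠ .core σ j)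
    (h2 : ∀ k ≤ m, ∀ i j, v ≠ lv D n σ k i j) : x v = 0 := by
  induction m with
  | zero =>
    obtain ⟨w, -, rfl⟩ := hx
    refine pushf_eq_zero ?_
    rintro ⟨_ | a, b⟩ rfl
    · exact absurd rfl (h1 b)
    · cases σ
      · exact absurd rfl (h2 0 le_rfl b a)
      · exact absurd rfl (h2 0 le_rfl a b)
  | succ m ih =>
    rcases hx with hx | ⟨w, -, rfl⟩
    · exact ih (by omega) hx fun k hk => h2 k (by omega)
    · refine pushf_eq_zero ?_
      rintro ⟨⟨_ | _, a⟩, b⟩ rfl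
      · exact absurd rfl (h2 m (by omega) b (a + b))
      · exact absurd rfl (h2 (m + 1) le_rfl a b)

theorem bijOn_twist (σ : Bool) {s : Set (ZMod 3 → ℝ)} :
    Set.BijOn (twist σ) (s ×ˢ s) (s ×ˢ s) := by
  cases σ
  · refine ⟨fun z hz => ⟨hz.2, hz.1⟩, (twist false).injective.injOn, fun z hz => ?_⟩
    exact ⟨(z.2, z.1), ⟨hz.2, hz.1⟩, rfl⟩
  · exact Set.bijOn_id _

theorem continuous_twist (σ : Bool) :
    Continuous (twist σ : (ZMod 3 → ℝ) × (ZMod 3 → ℝ) → _) := by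
  cases σ
  · exact continuous_swap
  · exact continuous_id

theorem pushf_twist_mem_tor (σ : Bool) (u : ZMod 3 × ZMod 3 → ℝ) :
    pushf (twist σ) u ∈ tor ↔ u ∈ tor := by
  refine pushf_mem_iUnion_cell_iff (twist σ).injective ?_ ?_ u <;> revert σ <;> decide +kernel

theorem torCoord_pushf_twist (σ : Bool) (u : ZMod 3 × ZMod 3 → ℝ) :
    torCoord (pushf (twist σ) u) = twist σ (torCoord u) := by
  simp only [torCoord, pushf_comp]
  cases σ <;> rfl

variable (D n)

/-- One χ serves both solid tori, because they have identical layers; only the factor filled by the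
core differs, by `twist`. This makes the filled annulus a sphere, however many layers there are. -/
theorem isSolid_layered {m : ℕ} (hm : m ≤ n) : ∃ χ, ContinuousOn χ (circ ×ˢ circ) ∧
    Set.BijOn χ (circ ×ˢ circ) (circ ×ˢ circ) ∧ ∀ σ, ∃ f, IsSolid (layered D n σ m)
      (pushf (lvPair D n σ m) '' tor) (m + 1) f (fun x => torCoord (x ∘ lvPair D n σ m))
      (twist σ ∘ χ) := by
  induction m with
  | zero =>
    refine ⟨id, continuousOn_id, Set.bijOn_id _, fun σ => ?_⟩
    obtain ⟨f, hf⟩ := isSolid_core (coneEmb_injective (D := D) (n := n) σ)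
      (hi := lvPair D n σ 0) (twist σ) (by funext ⟨i, j⟩; cases σ <;> rfl)
      (pushf_twist_mem_tor σ) (torCoord_pushf_twist σ)
    exact ⟨f, hf.congr rfl rfl (by simp) fun _ _ => rfl⟩
  | succ m ih =>
    obtain ⟨χ, hχ, hχb, h⟩ := ih (by omega)
    refine ⟨χ ∘ relabel slabBot, hχ.comp isSlab_slabTri.continuousOn_relabel
      isSlab_slabTri.bijOn_relabel.mapsTo, hχb.comp isSlab_slabTri.bijOn_relabel, fun σ => ?_⟩
    obtain ⟨f, hf⟩ := h σ
    have h0 : ∀ x ∈ layered D n σ m, ∀ v, x (lvPair D n σ (m + 1) v) = 0 := by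
      refine fun x hx v => layered_apply_eq_zero (by omega) hx (fun j => ?_) fun k hk i j h => ?_
      · simp only [lvPair, lv]
        split_ifs <;> simp
      · have := (lv_inj hm (by omega) h).2.1
        omega
    obtain ⟨f', hf'⟩ := isSlab_slabTri.glue (slabEmb_injective (D := D) (σ := σ) (show m < n by omega))
      (lo := lvPair D n σ m) (hi := lvPair D n σ (m + 1))
      (by funext ⟨a, b⟩; simp [slabEmb, slabBot, slabVert, lvPair]) (by funext ⟨a, b⟩; rfl)
      (by positivity) hf h0 ((continuous_twist σ).comp_continuousOn hχ) ((bijOn_twist σ).comp hχb)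
    exact ⟨f', hf'.congr rfl rfl (by push_cast; ring) fun _ _ => rfl⟩

/-- A collar of a boundary circle of a band. -/
structure Collar (σ : Bool) where
  col : Bool × ZMod 3 → W
  col_inj : Function.Injective col
  col_false : ∀ i, col (false, i) = D.c σ i
  col_true : ∀ i j, col (true, i) ≠ D.c σ j

variable {D}

/-- The vertices of a collar times a circle. -/
def Collar.emb {σ : Bool} (C : Collar D σ) (x : (Bool × ZMod 3) × ZMod 3) : Vert W n :=
  .base (C.col x.1) x.2

/-- A solid torus together with a collar. -/
def Collar.solid {σ : Bool} (C : Collar D σ) : Set (Vert W n → ℝ) :=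
  layered D n σ n ∪ pushf (C.emb n) '' prodUnion colTri

/-- The outer torus. -/
def Collar.outer {σ : Bool} (C : Collar D σ) (x : ZMod 3 × ZMod 3) : Vert W n :=
  .base (C.col (true, x.1)) x.2

theorem Collar.emb_injective {σ : Bool} (C : Collar D σ) : Function.Injective (C.emb n) := by
  rintro ⟨a, j⟩ ⟨a', j'⟩ h
  simp only [emb, Vert.base.injEq] at h
  exact Prod.ext (C.col_inj h.1) h.2

/-- A collar is glued without a shear, so attaching it leaves the boundary parametrization
unchanged. -/
theorem relabel_colBot {z : (ZMod 3 → ℝ) × (ZMod 3 → ℝ)} (hz : z ∈ circ ×ˢ circ) :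
    relabel colBot z = z := by
  obtain ⟨u, hu, rfl⟩ := isSlab_colTri.bijOn_bot.surjOn hz
  rw [isSlab_colTri.relabel_eq hu]
  simp only [slabCoord, torCoord, pushf_comp]
  rfl

theorem isSolid_collar : ∃ χ, ContinuousOn χ (circ ×ˢ circ) ∧
    Set.BijOn χ (circ ×ˢ circ) (circ ×ˢ circ) ∧
    (∀ σ, ∃ f, IsSolid (layered D n σ n) (pushf (lvPair D n σ n) '' tor) (n + 1) f
      (fun x => torCoord (x ∘ lvPair D n σ n)) (twist σ ∘ χ)) ∧
    ∀ (σ : Bool) (C : Collar D σ), ∃ f, IsSolid (C.solid n)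
      (pushf (C.outer n) '' tor) (n + 2) f (fun x => torCoord (x ∘ C.outer n))
      (twist σ ∘ χ) := by
  obtain ⟨χ, hχ, hχb, h⟩ := isSolid_layered D n le_rfl
  refine ⟨χ, hχ, hχb, h, fun σ C => ?_⟩
  obtain ⟨f, hf⟩ := h σ
  have h0 : ∀ x ∈ layered D n σ n, ∀ v, x (C.outer n v) = 0 := by
    refine fun x hx v => layered_apply_eq_zero le_rfl hx (fun j => ?_) fun k hk i j h => ?_
    · simp [Collar.outer]
    · simp only [Collar.outer, lv] at h
      split_ifs at h
      simp only [Vert.base.injEq] at h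
      exact C.col_true _ _ h.1
  obtain ⟨f', hf'⟩ := isSlab_colTri.glue (C.emb_injective n) (lo := lvPair D n σ n)
    (hi := C.outer n) (by funext ⟨a, b⟩; simp [Collar.emb, colBot, lvPair, lv_last, C.col_false])
    rfl (by positivity) hf h0 ((continuous_twist σ).comp_continuousOn hχ) ((bijOn_twist σ).comp hχb)
  refine ⟨f', hf'.congr rfl rfl (by ring) ?_⟩
  rintro _ ⟨u, hu, rfl⟩
  have hinj : Function.Injective (C.outer n) := (C.emb_injective n).comp topFace_injective
  rw [pushf_comp_eq hinj]
  simp only [Function.comp_apply]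
  rw [relabel_colBot (bijOn_torCoord.mapsTo hu)]

end LayeredSolidTorus
end HopfBound
end

noncomputable section
namespace HopfBound
open Finset

/-! ### Plane and sphere models -/

section PlaneModel

/-- A point of `plane` is the representative with minimum 0 of its class modulo constant vectors.
This identifies `plane` with the quotient, a linear plane. -/
theorem plane_eq_of_sub_eq {p q : ZMod 3 → ℝ} (hp : p ∈ plane) (hq : q ∈ plane) {k : ℝ}
    (h : ∀ i, p i - q i = k) : p = q := by
  obtain ⟨hp, i, hi⟩ := hp
  obtain ⟨hq, j, hj⟩ := hq
  have h1 := h i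
  have h2 := h j
  have h3 := hq i
  have h4 := hp j
  ext l
  have := h l
  linarith

/-- Linear coordinates on the model of the plane. -/
def planeCoord (p : ZMod 3 → ℝ) : ℝ × ℝ := (p 0 - p 2, p 1 - p 2)

theorem planeCoord_injOn : Set.InjOn planeCoord plane := by
  intro p hp q hq h
  simp only [planeCoord, Prod.mk.injEq] at h
  refine plane_eq_of_sub_eq hp hq (k := p 2 - q 2) fun i => ?_
  rcases zmod_three_cases i 0 with rfl | rfl | rfl
  · linarith [h.1]
  · have : (0 + 1 : ZMod 3) = 1 := rfl
    rw [this]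
    linarith [h.2]
  · rfl

theorem planeCoord_smul (c : ℝ) (p : ZMod 3 → ℝ) : planeCoord (c • p) = c • planeCoord p := by
  simp only [planeCoord, Pi.smul_apply, smul_eq_mul, Prod.smul_mk, mul_sub]

/-- The inverse of `planeCoord`. -/
def planeInv (z : ℝ × ℝ) (i : ZMod 3) : ℝ :=
  (if i = 0 then z.1 else if i = 1 then z.2 else 0) - min 0 (min z.1 z.2)

theorem planeInv_mem (z : ℝ × ℝ) : planeInv z ∈ plane := by
  have h1 := min_le_left 0 (min z.1 z.2)
  have h2 := (min_le_right 0 (min z.1 z.2)).trans (min_le_left _ _)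
  have h3 := (min_le_right 0 (min z.1 z.2)).trans (min_le_right _ _)
  refine ⟨fun i => ?_, ?_⟩
  · rw [planeInv, sub_nonneg]
    split_ifs <;> assumption
  · simp only [planeInv, sub_eq_zero]
    rcases min_choice 0 (min z.1 z.2) with h | h
    · exact ⟨2, by rw [h]; rfl⟩
    · rcases min_choice z.1 z.2 with h' | h'
      · exact ⟨0, by rw [h, h']; rfl⟩
      · exact ⟨1, by rw [h, h']; rfl⟩

theorem planeCoord_planeInv (z : ℝ × ℝ) : planeCoord (planeInv z) = z := by
  have e1 : (1 : ZMod 3) ≠ 0 := by decide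
  have e2 : (2 : ZMod 3) ≠ 0 := by decide
  have e3 : (2 : ZMod 3) ≠ 1 := by decide
  simp [planeCoord, planeInv, e1, e2, e3]

theorem continuous_planeCoord : Continuous planeCoord := by
  unfold planeCoord
  fun_prop

theorem continuous_planeInv : Continuous planeInv := by
  refine continuous_pi fun i => ?_
  unfold planeInv
  split_ifs <;> fun_prop

theorem sum_nonneg_of_mem_plane {p : ZMod 3 → ℝ} (hp : p ∈ plane) : 0 ≤ ∑ i, p i :=
  sum_nonneg fun i _ => hp.1 i

theorem eq_zero_of_mem_plane {p : ZMod 3 → ℝ} (hp : p ∈ plane) (h : ∑ i, p i = 0) : p = 0 :=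
  funext fun i => (sum_eq_zero_iff_of_nonneg fun i _ => hp.1 i).1 h i (mem_univ i)

/-- A model of the `3`-sphere as the union of two solid tori. -/
def sphereModel : Set ((ZMod 3 → ℝ) × (ZMod 3 → ℝ)) :=
  {z | z.1 ∈ plane ∧ z.2 ∈ plane ∧ max (∑ i, z.1 i) (∑ i, z.2 i) = 1}

theorem isCompact_sphereModel : IsCompact sphereModel := by
  have hb : sphereModel ⊆ Set.Icc 0 1 := by
    rintro ⟨p, q⟩ ⟨hp, hq, h⟩
    have h1 : ∑ i, p i ≤ 1 := h ▸ le_max_left _ _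
    have h2 : ∑ i, q i ≤ 1 := h ▸ le_max_right _ _
    refine ⟨⟨hp.1, hq.1⟩, fun i => ?_, fun i => ?_⟩
    · exact (single_le_sum (fun i _ => hp.1 i) (mem_univ i)).trans h1
    · exact (single_le_sum (fun i _ => hq.1 i) (mem_univ i)).trans h2
  refine isCompact_Icc.of_isClosed_subset ?_ hb
  refine (isClosed_plane.preimage continuous_fst).inter
    ((isClosed_plane.preimage continuous_snd).inter (isClosed_eq ?_ continuous_const))
  fun_prop

/-- The model is the unit sphere of a positively homogeneous gauge on a four-dimensional space, the
maximum of the gauges of two planes, so every ray from the origin meets it exactly once. -/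
theorem nonempty_sphereModel_homeomorph : Nonempty (sphereModel ≃ₜ UnitSphere 3) := by
  let G : (ZMod 3 → ℝ) × (ZMod 3 → ℝ) → EuclideanSpace ℝ (Fin 4) := fun z =>
    !₂[(planeCoord z.1).1, (planeCoord z.1).2, (planeCoord z.2).1, (planeCoord z.2).2]
  have hG : Continuous G := by
    have := continuous_planeCoord
    refine (PiLp.continuous_toLp 2 _).comp (continuous_pi fun i => ?_)
    fin_cases i <;> simp <;> fun_prop
  have hGeq : ∀ z z' : (ZMod 3 → ℝ) × (ZMod 3 → ℝ), ∀ c : ℝ, G z = c • G z' →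
      planeCoord z.1 = planeCoord (c • z'.1) ∧ planeCoord z.2 = planeCoord (c • z'.2) := by
    intro z z' c h
    have h' := fun i => congrFun (congrArg WithLp.ofLp h) i
    rw [planeCoord_smul, planeCoord_smul]
    refine ⟨Prod.ext (h' 0) (h' 1), Prod.ext (h' 2) (h' 3)⟩
  have key : ∀ z ∈ sphereModel, ∀ z' ∈ sphereModel, ∀ c : ℝ, 0 ≤ c → G z = c • G z' → c = 1 := by
    intro z hz z' hz' c hc h
    obtain ⟨h1, h2⟩ := hGeq _ _ _ h
    have e1 := planeCoord_injOn hz.1 (smul_mem_plane hz'.1 hc) h1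
    have e2 := planeCoord_injOn hz.2.1 (smul_mem_plane hz'.2.1 hc) h2
    have h3 := hz.2.2
    rw [e1, e2, sum_smul', sum_smul', ← mul_max_of_nonneg _ _ hc, hz'.2.2, mul_one] at h3
    exact h3
  refine (nonempty_homeomorph_sphere isCompact_sphereModel hG.continuousOn
    (fun z hz h => ?_) (fun z hz z' hz' c hc h => ?_) fun v hv => ?_).elim fun e _ => ⟨e⟩
  · exact one_ne_zero (key z hz z hz 0 le_rfl (by rw [h, smul_zero])).symm
  · obtain rfl := key z hz z' hz' c hc.le h
    obtain ⟨h1, h2⟩ := hGeq _ _ _ h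
    rw [one_smul] at h1 h2
    exact Prod.ext (planeCoord_injOn hz.1 hz'.1 h1) (planeCoord_injOn hz.2.1 hz'.2.1 h2)
  · set p := planeInv (v 0, v 1)
    set q := planeInv (v 2, v 3)
    have hp : p ∈ plane := planeInv_mem _
    have hq : q ∈ plane := planeInv_mem _
    have hpc : planeCoord p = (v 0, v 1) := planeCoord_planeInv _
    have hqc : planeCoord q = (v 2, v 3) := planeCoord_planeInv _
    set m := max (∑ i, p i) (∑ i, q i)
    have hm : 0 < m := by
      by_contra! hm
      have h1 := eq_zero_of_mem_plane hp
        (le_antisymm ((le_max_left _ _).trans hm) (sum_nonneg_of_mem_plane hp))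
      have h2 := eq_zero_of_mem_plane hq
        (le_antisymm ((le_max_right _ _).trans hm) (sum_nonneg_of_mem_plane hq))
      rw [h1] at hpc
      rw [h2] at hqc
      simp only [planeCoord, Pi.zero_apply, sub_zero, Prod.mk.injEq] at hpc hqc
      refine hv (PiLp.ext fun i => ?_)
      fin_cases i
      exacts [hpc.1.symm, hpc.2.symm, hqc.1.symm, hqc.2.symm]
    refine ⟨(m⁻¹ • p, m⁻¹ • q), ⟨smul_mem_plane hp (inv_nonneg.2 hm.le),
      smul_mem_plane hq (inv_nonneg.2 hm.le), ?_⟩, m⁻¹, inv_pos.2 hm, ?_⟩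
    · rw [sum_smul', sum_smul', ← mul_max_of_nonneg _ _ (inv_nonneg.2 hm.le)]
      exact inv_mul_cancel₀ hm.ne'
    · simp only [G, planeCoord_smul, hpc, hqc]
      ext i
      fin_cases i <;> rfl

end PlaneModel

/-! ### The filled annulus is a sphere -/

section Sphere

theorem pushf_image_iUnion_cell {V W ι : Type} [Fintype V] [Fintype W] {d : ℕ} {f : V → W}
    (hf : Function.Injective f) (t : ι → Fin (d + 1) → V) :
    pushf f '' ⋃ i, cell (t i) = ⋃ i, cell (f ∘ t i) := by
  rw [Set.image_iUnion]
  refine Set.iUnion_congr fun i => Set.Subset.antisymm ?_ fun x hx => ?_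
  · rintro _ ⟨x, hx, rfl⟩
    exact pushf_mem_cell f hx
  · have h1 : pushf f (x ∘ f) = x := pushf_comp_self hf fun w hw => hx.2 w fun p => hw _
    refine ⟨x ∘ f, ⟨⟨fun v => hx.1.1 _, by rw [← sum_pushf f, h1, hx.1.2]⟩, fun v hv => ?_⟩, h1⟩
    exact hx.2 _ fun p hp => hv p (hf hp)

variable {W Tri : Type} [Fintype W] [Fintype Tri] (D : Band W Tri) (n : ℕ)

/-- The vertices of the product part, uncurried. -/
def baseEmb (x : W × ZMod 3) : Vert W n := .base x.1 x.2

theorem baseEmb_injective : Function.Injective (baseEmb (W := W) n) := by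
  rintro ⟨a, b⟩ ⟨a', b'⟩ h
  simpa [baseEmb] using h

theorem layered_eq {σ : Bool} {m : ℕ} (hm : m ≤ n) : layered D n σ m =
    (⋃ x, cell (coneEmb D n σ ∘ prodTet coneTri x)) ∪
      ⋃ (k : Fin m), ⋃ x, cell (slabEmb D n σ k ∘ prodTet slabTri' x) := by
  induction m with
  | zero =>
    rw [layered, prodUnion, pushf_image_iUnion_cell (coneEmb_injective σ)]
    simp
  | succ m ih =>
    rw [layered, ih (by omega), prodUnion, pushf_image_iUnion_cell (slabEmb_injective (by omega)),
      Set.union_assoc]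
    congr 1
    ext x
    simp only [Set.mem_union, Set.mem_iUnion, Fin.exists_fin_succ']
    rfl

theorem realization_filling : realization (filling D n) =
    pushf (baseEmb n) '' prodUnion D.tri ∪ (layered D n false n ∪ layered D n true n) := by
  rw [filling, realization_facetComplex, layered_eq D n le_rfl, layered_eq D n le_rfl, prodUnion,
    pushf_image_iUnion_cell (baseEmb_injective n)]
  have hs : ∀ σ (k : Fin n) i u j m, tet D n (.inr (.inl (σ, k, i, u)), j, m) =
      slabEmb D n σ k ∘ prodTet slabTri' ((i, u), j, m) := fun σ k i u j m => by
    funext p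
    exact prism_slab D n σ k i u _ _
  have hc : ∀ σ i j m, tet D n (.inr (.inr (σ, i)), j, m) =
      coneEmb D n σ ∘ prodTet coneTri (i, j, m) := fun σ i j m => by
    funext p
    exact prism_cone D n σ i _ _
  have hb : ∀ T j m, tet D n (.inl T, j, m) = baseEmb n ∘ prodTet D.tri (T, j, m) :=
    fun _ _ _ => rfl
  refine Set.Subset.antisymm (Set.iUnion_subset ?_) (Set.union_subset ?_ (Set.union_subset ?_ ?_))
  · rintro ⟨T | ⟨σ, k, i, u⟩ | ⟨σ, i⟩, j, m⟩ x hx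
    · rw [hb] at hx
      exact .inl (Set.mem_iUnion.2 ⟨_, hx⟩)
    · rw [hs] at hx
      cases σ
      · exact .inr (.inl (.inr (Set.mem_iUnion.2 ⟨k, Set.mem_iUnion.2 ⟨_, hx⟩⟩)))
      · exact .inr (.inr (.inr (Set.mem_iUnion.2 ⟨k, Set.mem_iUnion.2 ⟨_, hx⟩⟩)))
    · rw [hc] at hx
      cases σ
      · exact .inr (.inl (.inl (Set.mem_iUnion.2 ⟨_, hx⟩)))
      · exact .inr (.inr (.inl (Set.mem_iUnion.2 ⟨_, hx⟩)))
  · refine Set.iUnion_subset fun ⟨T, j, m⟩ => ?_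
    rw [← hb]
    exact Set.subset_iUnion (fun x => cell (tet D n x)) _
  all_goals
    refine Set.union_subset (Set.iUnion_subset fun ⟨i, j, m⟩ => ?_)
      (Set.iUnion_subset fun k => Set.iUnion_subset fun ⟨⟨i, u⟩, j, m⟩ => ?_)
    · rw [← hc]
      exact Set.subset_iUnion (fun x => cell (tet D n x)) _
    · rw [← hs]
      exact Set.subset_iUnion (fun x => cell (tet D n x)) _

/-- The annulus as a band. -/
def annulus : Band (Bool × ZMod 3) (ZMod 3 × Bool) where
  tri := colTri
  sgn T := bif T.2 then -1 else 1
  c σ i := (σ, i)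
  idx x := x.2
  lt b b' := ∃ T p q, p < q ∧ colTri T p = b ∧ colTri T q = b'
  η x y := lift (y.2 - x.2)
  c_inj := by simp
  idx_c _ _ := rfl
  tri_inj := colTri_injective
  tri_dist T T' h := by
    have key : ∀ T T', (∀ p, ∃ q, colTri T' q = colTri T p) → T = T' := by decide
    exact key T T' fun p => (h ▸ Set.mem_range_self p : colTri T p ∈ Set.range (colTri T'))
  cover := by decide
  lt_asymm := by decide
  tri_lt T p q h := ⟨T, p, q, h, rfl, rfl⟩
  c_edge := by decide
  sgn_eq := by decide
  bdry q hq := by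
    have h := sum_zmod_three_add_one fun i => q (false, i) (true, i)
    rw [Fintype.sum_prod_type, ← sum_sub_distrib]
    simp only [Fintype.sum_bool, colTri, cond_true, cond_false]
    rw [← sub_eq_zero, ← sum_sub_distrib] at h ⊢
    rw [← h]
    refine sum_congr rfl fun i _ => ?_
    simp
    ring
  η_anti x y := lift_sub_comm _ _
  η_closed := by decide
  η_c := by decide

/-- The annulus is a collar. -/
def annulusCollar : Collar annulus false where
  col := id
  col_inj := Function.injective_id
  col_false _ := rfl
  col_true i j h := by simpa [annulus] using congrArg Prod.fst h

theorem layered_subset_stdSimplex (σ : Bool) : layered D n σ n ⊆ stdSimplex ℝ (Vert W n) := by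
  rw [layered_eq D n le_rfl]
  rintro x (hx | hx)
  · obtain ⟨_, hx⟩ := Set.mem_iUnion.1 hx
    exact hx.1
  · obtain ⟨_, hx⟩ := Set.mem_iUnion.1 hx
    obtain ⟨_, hx⟩ := Set.mem_iUnion.1 hx
    exact hx.1

theorem lv_eq_base {σ : Bool} {k : ℕ} {i j j' : ZMod 3} {w : W}
    (h : Vert.base w j' = lv D n σ k i j) : w = D.c σ i := by
  rw [lv] at h
  split_ifs at h
  simp only [Vert.base.injEq] at h
  exact h.1

/-- The filled annulus is a `3`-sphere. -/
theorem nonempty_realization_annulus_homeomorph (n : ℕ) :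
    Nonempty (realization (filling annulus n) ≃ₜ UnitSphere 3) := by
  classical
  obtain ⟨χ, hχ, hχb, h, h'⟩ := isSolid_collar (D := annulus) n
  obtain ⟨f₁, hf₁⟩ := h' false annulusCollar
  obtain ⟨f₂, hf₂⟩ := h true
  have hT : annulusCollar.outer n = lvPair annulus n true n := by
    funext x
    simp only [lvPair, lv_last]
    rfl
  have hemb : annulusCollar.emb n = baseEmb n := rfl
  rw [hT] at hf₁
  have hX : realization (filling annulus n) = annulusCollar.solid n ∪ layered annulus n true n := by
    rw [realization_filling, Collar.solid, hemb]
    change pushf (baseEmb n) '' prodUnion colTri ∪ _ = _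
    ac_rfl
  -- The swap of the factors undoes `twist false`. On the common torus both g₁ and g₂ then equal the
  -- parametrization χ, so they can be glued.
  let g₁ : (Vert (Bool × ZMod 3) n → ℝ) → (ZMod 3 → ℝ) × (ZMod 3 → ℝ) := fun x =>
    ((f₁ x).2, ((n : ℝ) + 2)⁻¹ • (f₁ x).1)
  let g₂ : (Vert (Bool × ZMod 3) n → ℝ) → (ZMod 3 → ℝ) × (ZMod 3 → ℝ) := fun x =>
    (((n : ℝ) + 1)⁻¹ • (f₂ x).1, (f₂ x).2)
  have hr₁ : (0 : ℝ) < n + 2 := by positivity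
  have hr₂ : (0 : ℝ) < n + 1 := by positivity
  have hg₁ : ContinuousOn g₁ (annulusCollar.solid n) :=
    hf₁.continuousOn.snd.prodMk ((continuous_const_smul _).comp_continuousOn hf₁.continuousOn.fst)
  have hg₂ : ContinuousOn g₂ (layered annulus n true n) :=
    ((continuous_const_smul _).comp_continuousOn hf₂.continuousOn.fst).prodMk hf₂.continuousOn.snd
  have hb₁ : Set.BijOn g₁ (annulusCollar.solid n)
      {z | z.1 ∈ circ ∧ z.2 ∈ plane ∧ ∑ i, z.2 i ≤ 1} := by
    refine Set.BijOn.comp (g := fun z : (ZMod 3 → ℝ) × (ZMod 3 → ℝ) =>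
      (z.2, ((n : ℝ) + 2)⁻¹ • z.1)) ⟨?_, ?_, ?_⟩ hf₁.bijOn
    · rintro ⟨p, q⟩ ⟨hp, hp1, hq⟩
      refine ⟨hq, smul_mem_plane hp (inv_nonneg.2 hr₁.le), ?_⟩
      simp only [sum_smul']
      rwa [inv_mul_le_iff₀ hr₁, mul_one]
    · intro z _ z' _ e
      simp only [Prod.mk.injEq] at e
      exact Prod.ext (smul_right_injective _ (inv_ne_zero hr₁.ne') e.2) e.1
    · rintro ⟨q, p⟩ ⟨hq, hp, hp1⟩
      refine ⟨(((n : ℝ) + 2) • p, q), ⟨smul_mem_plane hp hr₁.le, ?_, hq⟩, ?_⟩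
      · simp only [sum_smul']
        exact mul_le_of_le_one_right hr₁.le hp1
      · simp only [inv_smul_smul₀ hr₁.ne']
  have hb₂ : Set.BijOn g₂ (layered annulus n true n)
      {z | z.1 ∈ plane ∧ ∑ i, z.1 i ≤ 1 ∧ z.2 ∈ circ} := by
    refine Set.BijOn.comp (g := fun z : (ZMod 3 → ℝ) × (ZMod 3 → ℝ) =>
      (((n : ℝ) + 1)⁻¹ • z.1, z.2)) ⟨?_, ?_, ?_⟩ hf₂.bijOn
    · rintro ⟨p, q⟩ ⟨hp, hp1, hq⟩
      refine ⟨smul_mem_plane hp (inv_nonneg.2 hr₂.le), ?_, hq⟩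
      simp only [sum_smul']
      rwa [inv_mul_le_iff₀ hr₂, mul_one]
    · intro z _ z' _ e
      simp only [Prod.mk.injEq] at e
      exact Prod.ext (smul_right_injective _ (inv_ne_zero hr₂.ne') e.1) e.2
    · rintro ⟨p, q⟩ ⟨hp, hp1, hq⟩
      refine ⟨(((n : ℝ) + 1) • p, q), ⟨smul_mem_plane hp hr₂.le, ?_, hq⟩, ?_⟩
      · simp only [sum_smul']
        exact mul_le_of_le_one_right hr₂.le hp1
      · simp only [inv_smul_smul₀ hr₂.ne']
  -- The two layered tori have no vertex in common, so a common point must lie in the collar, with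
  -- no mass on its inner circle, that is, at height 1.
  have hinter : ∀ x ∈ annulusCollar.solid n, x ∈ layered annulus n true n →
      x ∈ pushf (lvPair annulus n true n) '' tor := by
    intro x hx hx2
    have h0 : ∀ v, (∀ j, v ≠ .core true j) → (∀ k ≤ n, ∀ i j, v ≠ lv annulus n true k i j) →
        x v = 0 := fun v => layered_apply_eq_zero le_rfl hx2
    rcases hx with hx | ⟨w, hw, rfl⟩
    · exfalso
      have hz : ∀ v, x v = 0 := by
        intro v
        by_contra hv
        have a1 : ∃ j, v = .core true j ∨ ∃ k ≤ n, ∃ i, v = lv annulus n true k i j := by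
          by_contra! hcon
          exact hv (h0 v (fun j => (hcon j).1) fun k hk i j => (hcon j).2 k hk i)
        obtain ⟨j, a1⟩ := a1
        refine hv (layered_apply_eq_zero le_rfl hx (fun j' e => ?_) fun k' hk' i' j' e => ?_)
        · rcases a1 with rfl | ⟨k, hk, i, rfl⟩
          · simp at e
          · rw [lv] at e
            split_ifs at e
        · rcases a1 with rfl | ⟨k, hk, i, rfl⟩
          · rw [lv] at e
            split_ifs at e
          · exact absurd (lv_inj hk hk' e).1 (by simp)
      have := (layered_subset_stdSimplex annulus n _ hx2).2
      simp [hz] at this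
    · have hs := mem_stdSimplex_of_mem_prodUnion hw
      have h1 := height_add hs
      rw [pushf_eq_zero, add_zero] at h1
      · obtain ⟨u, hu, rfl⟩ := (isSlab_colTri.height_eq_one_iff hw).1 h1
        refine ⟨u, hu, ?_⟩
        rw [pushf_comp, ← hT]
        rfl
      · rintro ⟨⟨b, i⟩, j⟩ hb
        obtain rfl : b = false := hb
        rw [← pushf_apply_of_injective (annulusCollar.emb_injective n) w]
        refine h0 _ (fun j' => by simp [Collar.emb]) fun k hk i' j' e => ?_
        have := lv_eq_base _ _ e
        simp [annulus, annulusCollar] at this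
  have hagree : ∀ x ∈ annulusCollar.solid n, x ∈ layered annulus n true n → g₁ x = g₂ x := by
    intro x hx hx2
    have hT := hinter x hx hx2
    simp only [g₁, g₂, hf₁.eq x hT, hf₂.eq x hT]
    rw [inv_smul_smul₀ hr₁.ne', inv_smul_smul₀ hr₂.ne']
    rfl
  have hcl₁ := hf₁.isCompact
  have hcl₂ := hf₂.isCompact
  have hbij := bijOn_glue hb₁ hb₂ hagree fun x hx y hy e => by
    refine hf₂.subset ((hf₁.mem_iff x hx).1 ?_)
    have h1 := (mem_circ_iff.1 (hb₂.mapsTo hy).2.2).2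
    rw [← e] at h1
    simp only [g₁, sum_smul'] at h1
    rwa [inv_mul_eq_one₀ hr₁.ne', eq_comm] at h1
  have hcont := continuousOn_glue hcl₁.isClosed hcl₂.isClosed hg₁ hg₂ hagree
  have hU : {z : (ZMod 3 → ℝ) × (ZMod 3 → ℝ) | z.1 ∈ circ ∧ z.2 ∈ plane ∧ ∑ i, z.2 i ≤ 1} ∪
      {z | z.1 ∈ plane ∧ ∑ i, z.1 i ≤ 1 ∧ z.2 ∈ circ} = sphereModel := by
    ext z
    simp only [sphereModel, mem_circ_iff, Set.mem_union, Set.mem_ofPred_eq]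
    constructor
    · rintro (⟨⟨h1, h2⟩, h3, h4⟩ | ⟨h1, h2, h3, h4⟩)
      · exact ⟨h1, h3, by rw [h2, max_eq_left h4]⟩
      · exact ⟨h1, h3, by rw [h4, max_eq_right h2]⟩
    · rintro ⟨h1, h2, h3⟩
      have h4 := le_max_left (∑ i, z.1 i) (∑ i, z.2 i)
      have h5 := le_max_right (∑ i, z.1 i) (∑ i, z.2 i)
      rcases max_choice (∑ i, z.1 i) (∑ i, z.2 i) with h | h
      · exact .inl ⟨⟨h1, by rw [← h, h3]⟩, h2, by rwa [h3] at h5⟩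
      · exact .inr ⟨h1, by rwa [h3] at h4, h2, by rw [← h, h3]⟩
  rw [hU, ← hX] at hbij
  rw [← hX] at hcont
  obtain ⟨e₁⟩ := nonempty_homeomorph_of_bijOn (hX ▸ hcl₁.union hcl₂) hcont hbij
  obtain ⟨e₂⟩ := nonempty_sphereModel_homeomorph
  exact ⟨e₁.trans e₂⟩

end Sphere
end HopfBound
end

noncomputable section
namespace HopfBound
open Finset

/-! ### The Hopf invariant of the collapse map -/

section ConeForm

variable {W : Type}

open Classical in
/-- The alternating cochain that distributes the fundamental class over three triangles around
the vertex `s`. -/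
def coneForm (s : W) (c : ZMod 3 → W) (u : Fin 3 → W) : ℝ :=
  ∑ i, 1 / 3 * (Matrix.of fun p q => if u p = ![s, c i, c (i + 1)] q then (1 : ℝ) else 0).det

theorem isAlternating_coneForm (s : W) (c : ZMod 3 → W) : IsAlternating (coneForm s c) := by
  classical
  intro t π
  rw [coneForm, coneForm, mul_sum]
  refine sum_congr rfl fun i _ => ?_
  have := Matrix.det_permute π
    (Matrix.of fun p q => if t p = ![s, c i, c (i + 1)] q then (1 : ℝ) else 0)
  simp only [Function.comp_apply]
  rw [mul_left_comm, ← this]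
  rfl

theorem exists_eq_of_coneForm_ne_zero {s : W} {c : ZMod 3 → W} {u : Fin 3 → W}
    (h : coneForm s c u ≠ 0) : ∃ q, u q = s := by
  classical
  by_contra! hu
  refine h (sum_eq_zero fun i _ => ?_)
  rw [Matrix.det_eq_zero_of_column_eq_zero 0 fun p => ?_, mul_zero]
  simp [hu p]

/-- For the triangle with index i the incidence matrix is the identity. Another cone triangle shares
only part of its vertices, which makes its determinant vanish. -/
theorem coneForm_cone {s : W} {c : ZMod 3 → W} (hc : Function.Injective c) (hs : ∀ i, c i ≠ s)
    (i : ZMod 3) : coneForm s c ![s, c i, c (i + 1)] = 1 / 3 := by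
  classical
  rw [coneForm, sum_eq_single i]
  · obtain ⟨h, -, -⟩ := zmod_three_ne i
    simp [Matrix.det_fin_three, hs, (hs _).symm, hc.eq_iff]
  · intro j _ hj
    have key : ∀ i j : ZMod 3, j ≠ i → (i = j + 1 → ¬ (i + 1 = j)) ∧ ¬ i = j ∧ ¬ i + 1 = j + 1 := by
      decide
    obtain ⟨k1, k2, k3⟩ := key i j hj
    simp only [Matrix.det_fin_three, Matrix.of_apply, Matrix.cons_val_zero, Matrix.cons_val_one,
      Matrix.cons_val, hs, (hs _).symm, hc.eq_iff, if_false, if_true, k2, k3]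
    split_ifs with h1 h2
    · exact absurd h2 (k1 h1)
    all_goals simp
  · simp

theorem IsAlternating.altExt_eq [LinearOrder W] {n : ℕ} {f : (Fin n → W) → ℝ}
    (hf : IsAlternating f) {t : Fin n → W} (ht : Function.Injective t) : altExt f t = f t := by
  have h1 : StrictMono (t ∘ Tuple.sort t) :=
    (Tuple.monotone_sort t).strictMono_of_injective (ht.comp (Tuple.sort t).injective)
  have h2 := isAlternating_altExt f t (Tuple.sort t)
  rw [altExt_of_strictMono f h1, hf] at h2
  refine (mul_left_cancel₀ ?_ h2).symm
  rcases Int.units_eq_one_or (Equiv.Perm.sign (Tuple.sort t)) with h | h <;> rw [h] <;> simp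

end ConeForm

/-! ### The collapse map as a continuous map with known Hopf invariant -/

section HopfMap

/-- A linear order for which a given map is monotone. -/
abbrev inducedLinearOrder {V W : Type} [Fintype V] [LinearOrder W] (φ : V → W) : LinearOrder V :=
  LinearOrder.lift' (fun v => toLex (φ v, Fintype.equivFin V v)) fun v w h => by
    simpa using congrArg (fun x => (ofLex x).2) h

theorem monotone_inducedLinearOrder {V W : Type} [Fintype V] [LinearOrder W] (φ : V → W) :
    letI := inducedLinearOrder φ
    Monotone φ := by
  intro v w h
  have h' : toLex (φ v, Fintype.equivFin V v) ≤ toLex (φ w, Fintype.equivFin V w) := h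
  rw [Prod.Lex.toLex_le_toLex] at h'
  rcases h' with h' | h'
  · exact h'.le
  · exact h'.1.le

/-- The map forgets the circle direction, so a whole prism goes into one triangle: a band triangle,
a cone triangle, or just a pole. -/
theorem image_collapse_mem {W Tri W' ι : Type} [Fintype Tri] [DecidableEq W'] {D : Band W Tri}
    {n : ℕ} {pole : Bool → W'} {ψ : W → W'} {τ : ι → Fin 3 → W'} {hτ : ∀ v, ∃ i p, τ i p = v}
    (hn : 0 < n) (hb : ∀ T, ∃ i, ∀ p, ∃ q, τ i q = ψ (D.tri T p))
    (hc : ∀ σ i, ∃ t, (∃ q, τ t q = pole σ) ∧ (∃ q, τ t q = ψ (D.c σ i)) ∧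
      ∃ q, τ t q = ψ (D.c σ (i + 1)))
    (s : Finset (Vert W n)) (hs : s ∈ (filling D n).faces) :
    s.image (collapse n pole ψ) ∈ (facetComplex τ hτ).faces := by
  obtain ⟨hs0, ⟨T, j, m⟩, hs⟩ := hs
  have hlv : ∀ σ k i j, collapse n pole ψ (lv D n σ k i j) = pole σ ∨
      collapse n pole ψ (lv D n σ k i j) = ψ (D.c σ i) := by
    intro σ k i j
    rw [lv]
    split_ifs
    · exact .inl rfl
    · exact .inr rfl
  have hlv' : ∀ σ (k : ℕ) i j, k < n → collapse n pole ψ (lv D n σ k i j) = pole σ := by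
    intro σ k i j h
    rw [lv_of_lt h]
    rfl
  suffices h : ∃ t, ∀ p j, ∃ q, τ t q = collapse n pole ψ (prism D n T p j) by
    obtain ⟨t, ht⟩ := h
    refine ⟨hs0.image _, t, fun w hw => ?_⟩
    obtain ⟨v, hv, rfl⟩ := mem_image.1 hw
    obtain ⟨p, rfl⟩ := hs v hv
    exact ht _ _
  rcases T with T | ⟨σ, k, i, u⟩ | ⟨σ, i⟩
  · obtain ⟨t, ht⟩ := hb T
    exact ⟨t, fun p _ => ht p⟩
  · obtain ⟨t, h1, h2, h3⟩ := hc σ i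
    refine ⟨t, fun p j => ?_⟩
    rw [prism_slab]
    have key : ∀ i u p, (slabTri i u p).1 = true → (slabTri i u p).2 = i ∨
        (slabTri i u p).2 = i + 1 := by decide
    have key := key i u p
    generalize slabTri i u p = x at key
    obtain ⟨_ | _, x⟩ := x
    · rw [slabVert, hlv' _ _ _ _ k.2]
      exact h1
    · rw [slabVert]
      rcases hlv σ (k + 1) x j with h | h <;> rw [h]
      · exact h1
      · rcases key rfl with rfl | rfl
        exacts [h2, h3]
  · obtain ⟨t, h1, -, -⟩ := hc σ i
    refine ⟨t, fun p j => ?_⟩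
    rw [prism_cone]
    generalize coneTri i p = x
    have : collapse n pole ψ (coneVert D n σ x j) = pole σ := by
      cases σ <;> rcases x with _ | x
      exacts [rfl, hlv' _ _ _ _ hn, rfl, hlv' _ _ _ _ hn]
    rwa [this]

/-- The affine extension of a simplicial map. -/
def realMap {V W : Type} [Fintype V] [Fintype W] [DecidableEq W] {K : AbstractSimplicialComplex V}
    {L : AbstractSimplicialComplex W} (φ : V → W) (h : ∀ s ∈ K.faces, s.image φ ∈ L.faces) :
    C(realization K, realization L) where
  toFun x := ⟨pushf φ x.1, by
    obtain ⟨s, hs, hx⟩ := x.2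
    refine ⟨s.image φ, h s hs, pushf_mem_stdSimplex φ hx.1, fun w hw => pushf_eq_zero ?_⟩
    rintro v rfl
    exact hx.2 v fun hv => hw (mem_image_of_mem φ hv)⟩
  continuous_toFun := by
    refine Continuous.subtype_mk ?_ _
    exact (continuous_pushf φ).comp continuous_subtype_val

variable {W Tri W' ι S : Type} [Fintype W] [Fintype Tri] [Fintype W'] [LinearOrder W'] [Fintype ι]
  [TopologicalSpace S]

/-- The vertex order of the manifold may be chosen freely, so it is induced lexicographically from
the target and the collapse map becomes monotone. Its affine extension is the map itself, so no
simplicial approximation is needed. -/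
theorem exists_isHopfInvariant (D : Band W Tri) {pole : Bool → W'} {ψ : W → W'}
    {τ : ι → Fin 3 → W'} {hτ : ∀ v, ∃ i p, τ i p = v}
    (hb : ∀ T, ∃ i, ∀ p, ∃ q, τ i q = ψ (D.tri T p))
    (hc : ∀ σ i, ∃ t, (∃ q, τ t q = pole σ) ∧ (∃ q, τ t q = ψ (D.c σ i)) ∧
      ∃ q, τ t q = ψ (D.c σ (i + 1)))
    (hpole : ∀ x, pole false ≤ x) (hne : pole true ≠ pole false) (hψ : ∀ w, ψ w ≠ pole false)
    (hinj : Function.Injective fun i => ψ (D.c false i)) {ε : ι → ℝ}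
    (hε : IsOrientation (facetComplex τ hτ) 2 (signedChain τ ε)) (hτi : ∀ i, Function.Injective (τ i))
    (hsum : ∑ i, ε i * coneForm (pole false) (fun i => ψ (D.c false i)) (τ i) = 1)
    (eL : realization (facetComplex τ hτ) ≃ₜ S) (l : ℕ) :
    ∃ (hφ : ∀ s ∈ (filling D (l + 1)).faces,
      s.image (collapse (l + 1) pole ψ) ∈ (facetComplex τ hτ).faces) (h : ℝ),
      IsHopfInvariant ((eL : C(_, S)).comp (realMap _ hφ)) h ∧
        |h| = Nat.fib (l + 1) * Nat.fib (l + 2) := by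
  let := inducedLinearOrder (collapse (l + 1) pole ψ)
  have hmono := monotone_inducedLinearOrder (collapse (l + 1) pole ψ)
  have halt := isAlternating_coneForm (pole false) fun i => ψ (D.c false i)
  have hφ := image_collapse_mem (D := D) (hτ := hτ) (Nat.succ_pos l) hb hc
  obtain ⟨h, hh, hfib⟩ := exists_hopfInvariant_filling hmono halt hpole hne hψ
    (fun u => exists_eq_of_coneForm_ne_zero)
    (coneForm_cone hinj fun i => hψ _) hε (by
      rw [pairing_signedChain, ← hsum]
      exact sum_congr rfl fun i _ => by rw [halt.altExt_eq (hτi i)])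
  refine ⟨hφ, h, ⟨_, _, _, _, _, _, filling D (l + 1), facetComplex τ hτ, Homeomorph.refl _, eL,
    collapse (l + 1) pole ψ, _, ⟨hmono, hφ⟩, fun x w => ?_, .refl _, hh⟩, hfib⟩
  rw [← pushf_eq_sum_filter]
  change (eL.symm (eL (realMap _ hφ x))).1 w = _
  rw [eL.symm_apply_apply]
  rfl

end HopfMap
end HopfBound
end

noncomputable section
namespace HopfBound
open Finset

/-! ### The Hopf size of layered spheres -/

section Growth

/-- The product at least doubles at each step, since F_{l+3} = F_{l+1} + F_{l+2} ≥ 2 F_{l+1}. -/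
theorem two_pow_le_fib_mul_fib (l : ℕ) : 2 ^ l ≤ Nat.fib (l + 1) * Nat.fib (l + 2) := by
  induction l with
  | zero => decide
  | succ l ih =>
    have h1 : Nat.fib (l + 3) = Nat.fib (l + 1) + Nat.fib (l + 2) := Nat.fib_add_two
    have h2 : Nat.fib (l + 1) ≤ Nat.fib (l + 2) := Nat.fib_mono (by omega)
    change 2 ^ (l + 1) ≤ Nat.fib (l + 2) * Nat.fib (l + 3)
    rw [h1, pow_succ]
    nlinarith

theorem exists_exp_lt (A : ℝ) (hA : 0 < A) (B : ℕ) : ∃ c : ℝ, 0 < c ∧ ∃ N₀ : ℕ, ∀ N : ℕ, N₀ ≤ N →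
    ∃ l : ℕ, (B + 12 * (l + 1) + 6) * 144 ≤ N ∧
      Real.exp (c * N) < A * (Nat.fib (l + 1) * Nat.fib (l + 2)) := by
  -- A layer count costs 12 · 144 = 1728 simplices, so l = N / 3456 uses at most half of N and the
  -- constant terms fit in the other half. As log 2 > 1/2, 2^l is about exp(N / 6912) or more; the
  -- rate 1 / 13824 is half of that, leaving room for A and for rounding.
  refine ⟨1 / 13824, by norm_num, 288 * (18 + B) + (⌈13824 * (1 - Real.log A)⌉₊ + 1), fun N hN =>
    ⟨N / 3456, by omega, ?_⟩⟩
  set l := N / 3456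
  have h1 : (N : ℝ) < 3456 * (l + 1) := by
    have : N < 3456 * (l + 1) := by omega
    exact_mod_cast this
  have h2 : 13824 * (1 - Real.log A) < N := by
    refine (Nat.le_ceil _).trans_lt ?_
    have : ⌈13824 * (1 - Real.log A)⌉₊ < N := by omega
    exact_mod_cast this
  have h3 : ((2 : ℝ) ^ l) ≤ Nat.fib (l + 1) * Nat.fib (l + 2) := by
    exact_mod_cast two_pow_le_fib_mul_fib l
  have h4 : Real.exp (l * (1 / 2)) ≤ 2 ^ l := by
    rw [Real.exp_nat_mul]
    gcongr
    rw [← Real.le_log_iff_exp_le two_pos]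
    linarith [Real.log_two_gt_d9]
  calc Real.exp (1 / 13824 * N) < Real.exp (Real.log A + l * (1 / 2)) := by
        rw [Real.exp_lt_exp]
        linarith
    _ = A * Real.exp (l * (1 / 2)) := by rw [Real.exp_add, Real.exp_log hA]
    _ ≤ _ := by gcongr; exact h4.trans h3

end Growth

/-! ### Lipschitz estimates for simplicial maps -/

section Lipschitz

/-- The chord is 2 sin(θ/2), and Jordan's inequality bounds the sine from below by its secant. -/
theorem angle_le_pi_div_two_mul_norm_sub {E : Type*} [NormedAddCommGroup E] [InnerProductSpace ℝ E]
    {x y : E} (hx : ‖x‖ = 1) (hy : ‖y‖ = 1) :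
    InnerProductGeometry.angle x y ≤ Real.pi / 2 * ‖x - y‖ := by
  set θ := InnerProductGeometry.angle x y with hθ
  have h0 : 0 ≤ θ := InnerProductGeometry.angle_nonneg x y
  have h1 : θ ≤ Real.pi := InnerProductGeometry.angle_le_pi x y
  have h2 : ‖x - y‖ ^ 2 = 4 * Real.sin (θ / 2) ^ 2 := by
    have h3 := InnerProductGeometry.cos_angle x y
    rw [hx, hy, mul_one, div_one] at h3
    rw [norm_sub_sq_real, hx, hy, ← h3, ← hθ, Real.sin_sq, Real.cos_sq, mul_div_cancel₀ _ two_ne_zero]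
    ring
  have h3 : 2 / Real.pi * (θ / 2) ≤ Real.sin (θ / 2) :=
    Real.mul_le_sin (by linarith) (by linarith)
  have h4 : ‖x - y‖ = 2 * Real.sin (θ / 2) := by
    have h5 : 0 ≤ 2 * Real.sin (θ / 2) :=
      mul_nonneg two_pos.le (Real.sin_nonneg_of_nonneg_of_le_pi (by linarith) (by linarith))
    rw [← sq_eq_sq₀ (norm_nonneg _) h5, h2]
    ring
  rw [h4]
  have hpi := Real.pi_pos
  calc θ = Real.pi / 2 * (2 * (2 / Real.pi * (θ / 2))) := by field_simp
    _ ≤ _ := by gcongr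

theorem norm_normalize_sub_le {E : Type*} [NormedAddCommGroup E] [NormedSpace ℝ E] {u v : E}
    (hu : u ≠ 0) (hv : v ≠ 0) : ‖‖u‖⁻¹ • u - ‖v‖⁻¹ • v‖ ≤ 2 * ‖u‖⁻¹ * ‖u - v‖ := by
  have hu' : 0 < ‖u‖ := norm_pos_iff.2 hu
  have hv' : 0 < ‖v‖ := norm_pos_iff.2 hv
  have e : ‖u‖⁻¹ • u - ‖v‖⁻¹ • v = ‖u‖⁻¹ • ((u - v) + (‖v‖ - ‖u‖) • ‖v‖⁻¹ • v) := by
    rw [smul_add, smul_sub, smul_smul _ _ (‖v‖⁻¹ • v), mul_sub, inv_mul_cancel₀ hu'.ne', sub_smul,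
      one_smul, smul_smul, mul_assoc, mul_inv_cancel₀ hv'.ne', mul_one]
    abel
  rw [e, norm_smul, norm_inv, norm_norm]
  have h1 : ‖(‖v‖ - ‖u‖) • ‖v‖⁻¹ • v‖ ≤ ‖u - v‖ := by
    rw [norm_smul, norm_smul, norm_inv, norm_norm, inv_mul_cancel₀ hv'.ne', mul_one,
      Real.norm_eq_abs, abs_sub_comm]
    exact abs_norm_sub_norm_le u v
  calc ‖u‖⁻¹ * ‖(u - v) + (‖v‖ - ‖u‖) • ‖v‖⁻¹ • v‖
      ≤ ‖u‖⁻¹ * (‖u - v‖ + ‖u - v‖) := by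
        gcongr
        exact (norm_add_le _ _).trans (by gcongr)
    _ = _ := by ring

variable {V W : Type} [Fintype V] [Fintype W]

theorem sum_abs_pushf_sub_le (f : V → W) (x y : V → ℝ) :
    ∑ w, |pushf f x w - pushf f y w| ≤ ∑ v, |x v - y v| := by
  classical
  calc ∑ w, |pushf f x w - pushf f y w| ≤ ∑ w, ∑ v, (if f v = w then |x v - y v| else 0) := by
        refine sum_le_sum fun w _ => ?_
        rw [pushf, pushf, ← sum_sub_distrib]
        refine (abs_sum_le_sum_abs _ _).trans (sum_le_sum fun v _ => ?_)
        by_cases h : f v = w <;> simp [h]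
    _ = _ := by
        rw [sum_comm]
        simp

theorem unitDist_nonneg (x y : V → ℝ) : 0 ≤ unitDist x y := Real.sqrt_nonneg _

/-- Cauchy–Schwarz on at most four coordinates gives the factor √8, as `unitDist` contains a
division by 2; 3 is a convenient upper bound. -/
theorem sum_abs_sub_le {s : Finset V} (hs : s.card ≤ 4) {x y : V → ℝ} (hx : InSimplex s x)
    (hy : InSimplex s y) : ∑ v, |x v - y v| ≤ 3 * unitDist x y := by
  have h1 : ∑ v, |x v - y v| = ∑ v ∈ s, |x v - y v| :=
    (sum_subset (subset_univ s) fun v _ hv => by rw [hx.2 v hv, hy.2 v hv]; simp).symm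
  have h2 : ∑ v ∈ s, |x v - y v| ^ 2 ≤ ∑ v, (x v - y v) ^ 2 := by
    simp only [sq_abs]
    exact sum_le_sum_of_subset_of_nonneg (subset_univ s) fun _ _ _ => sq_nonneg _
  have h3 := sq_sum_le_card_mul_sum_sq (s := s) (f := fun v => |x v - y v|)
  have h4 : (s.card : ℝ) ≤ 4 := by exact_mod_cast hs
  have h5 : 0 ≤ ∑ v ∈ s, |x v - y v| ^ 2 := sum_nonneg fun _ _ => by positivity
  have h6 : 0 ≤ ∑ v, (x v - y v) ^ 2 := sum_nonneg fun _ _ => by positivity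
  rw [h1, unitDist]
  refine abs_le_of_sq_le_sq' ?_ (by positivity) |>.2
  rw [mul_pow, Real.sq_sqrt (by positivity)]
  nlinarith

/-- A map that is Lipschitz on simplices is Lipschitz for the length metric. -/
theorem isLipschitzToSphere_of_forall {K : AbstractSimplicialComplex V} {C : ℝ} (hC : 0 < C)
    {F : C(realization K, UnitSphere 2)}
    (h : ∀ s ∈ K.faces, ∀ x y : realization K, InSimplex s x.1 → InSimplex s y.1 →
      ‖(F x).1 - (F y).1‖ ≤ C * unitDist x.1 y.1) :
    IsLipschitzToSphere K (Real.pi / 2 * C) F := by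
  intro x y
  have hn : ∀ x, ‖(F x).1‖ = 1 := fun x => mem_sphere_zero_iff_norm.1 (F x).2
  have hpos : 0 < Real.pi / 2 * C := mul_pos (by positivity) hC
  have hp0 : ENNReal.ofReal (Real.pi / 2 * C) ≠ 0 := (ENNReal.ofReal_pos.2 hpos).ne'
  rw [← ENNReal.div_le_iff' hp0 ENNReal.ofReal_ne_top]
  refine le_iInf fun n => le_iInf fun p => le_iInf fun h0 => le_iInf fun h1 => le_iInf fun hp => ?_
  rw [ENNReal.div_le_iff' hp0 ENNReal.ofReal_ne_top, ← ENNReal.ofReal_sum_of_nonneg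
    (fun i _ => unitDist_nonneg _ _), ← ENNReal.ofReal_mul hpos.le]
  refine ENNReal.ofReal_le_ofReal ((angle_le_pi_div_two_mul_norm_sub (hn x) (hn y)).trans ?_)
  rw [mul_assoc]
  refine mul_le_mul_of_nonneg_left ?_ (by positivity)
  rw [← h0, ← h1, mul_sum, ← dist_eq_norm]
  refine (dist_le_range_sum_dist (fun i => (F (p i)).1) n).trans (sum_le_sum fun i hi => ?_)
  obtain ⟨s, hs, hx, hy⟩ := hp i (mem_range.1 hi)
  rw [dist_eq_norm]
  exact h s hs _ _ hx hy

end Lipschitz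
end HopfBound
end

noncomputable section
namespace HopfBound
open Finset

/-! ### The bipyramid as a target sphere -/

section Bipyramid

/-- The vertices of the triangle in the bipyramid. -/
def bipyrMid : ZMod 3 → Fin 5 := fun i => (show Fin 3 from i).succ.castSucc

/-- The triangles of the bipyramid. -/
def bipyrTri : Bool × ZMod 3 → Fin 3 → Fin 5
  | (σ, i) => ![bif σ then 4 else 0, bipyrMid i, bipyrMid (i + 1)]

theorem bipyrTri_cover : ∀ v, ∃ i p, bipyrTri i p = v := by decide

theorem bipyrTri_injective : ∀ i, Function.Injective (bipyrTri i) := by decide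

/-- The bipyramid over a triangle. -/
abbrev bipyramid : AbstractSimplicialComplex (Fin 5) := facetComplex bipyrTri bipyrTri_cover

/-- The signs of the triangles of the bipyramid. -/
def bipyrSign (x : Bool × ZMod 3) : ℝ := if x.1 then -1 else 1

theorem isOrientation_bipyramid : IsOrientation bipyramid 2 (signedChain bipyrTri bipyrSign) := by
  refine isOrientation_signedChain bipyrTri_injective (fun x y h => ?_)
    (fun x => ?_) (fun _ => IsAlternating.coboundary_two) fun c hc => ?_
  · have key : ∀ x y, (∀ p, ∃ q, bipyrTri y q = bipyrTri x p) → x = y := by decide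
    exact key x y fun p => (h ▸ Set.mem_range_self p : bipyrTri x p ∈ Set.range (bipyrTri y))
  · unfold bipyrSign
    split_ifs <;> simp
  · have h : ∀ s : Fin 5, ∑ i, c ![s, bipyrMid (i + 1)] = ∑ i, c ![s, bipyrMid i] := fun s =>
      sum_zmod_three_add_one fun i => c ![s, bipyrMid i]
    simp only [Fintype.sum_prod_type, Fintype.sum_bool, bipyrSign, coboundary_eq_two, bipyrTri,
      Matrix.cons_val_zero, Matrix.cons_val_one, Matrix.cons_val, ← mul_sum, sum_add_distrib,
      sum_sub_distrib, h]
    simp [sum_add_distrib, h]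

/-- The bipyramid is the join of the boundary of a triangle with two points: some middle vertex is
unused, and so is some apex. -/
theorem mem_realization_bipyramid {x : Fin 5 → ℝ} : x ∈ realization bipyramid ↔
    x ∈ stdSimplex ℝ (Fin 5) ∧ x ∘ bipyrMid ∈ plane ∧ (x 0 = 0 ∨ x 4 = 0) := by
  rw [realization_facetComplex, Set.mem_iUnion]
  constructor
  · rintro ⟨⟨σ, i⟩, hx⟩
    refine ⟨hx.1, ⟨fun i => hx.1.1 _, i + 2, hx.2 _ ?_⟩, ?_⟩
    · have key : ∀ σ i p, bipyrTri (σ, i) p ≠ bipyrMid (i + 2) := by decide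
      exact key σ i
    · have key : ∀ σ i p, bipyrTri (σ, i) p ≠ bif σ then 0 else 4 := by decide
      have := hx.2 _ (key σ i)
      cases σ
      · exact .inr this
      · exact .inl this
  · rintro ⟨hx, ⟨-, i, hi⟩, h⟩
    obtain ⟨σ, hσ⟩ : ∃ σ, x (bif σ then 0 else 4) = 0 := by
      rcases h with h | h
      exacts [⟨true, h⟩, ⟨false, h⟩]
    refine ⟨(σ, i + 1), mem_cell_of_forall hx.1 hx.2 fun v hv => ?_⟩
    have key : ∀ σ i v, v ≠ bipyrMid i → (v ≠ bif σ then 0 else 4) →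
        ∃ p, bipyrTri (σ, i + 1) p = v := by decide
    refine key σ i v ?_ ?_
    · rintro rfl
      exact hv hi
    · rintro rfl
      exact hv hσ

/-- The linear map from the bipyramid to space. -/
def bipyrMap : (Fin 5 → ℝ) →L[ℝ] EuclideanSpace ℝ (Fin 3) :=
  LinearMap.toContinuousLinearMap
    { toFun := fun x => !₂[x 1 - x 3, x 2 - x 3, x 4 - x 0]
      map_add' := fun x y => by ext i; fin_cases i <;> simp <;> ring
      map_smul' := fun c x => by ext i; fin_cases i <;> simp <;> ring }

theorem bipyrMap_apply (x : Fin 5 → ℝ) : bipyrMap x = !₂[x 1 - x 3, x 2 - x 3, x 4 - x 0] := rfl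

theorem isCompact_realization_bipyramid : IsCompact (realization bipyramid) := by
  rw [realization_facetComplex]
  exact isCompact_iUnion fun _ => isCompact_cell _

/-- A linear map places the bipyramid around the origin of space. Points on a common ray have
proportional barycentric coordinates, and these sum to 1, so each ray is met once and radial
projection is a homeomorphism. -/
theorem bipyramid_homeomorph : ∃ e : realization bipyramid ≃ₜ UnitSphere 2,
    ∀ x, (e x).1 = ‖bipyrMap x.1‖⁻¹ • bipyrMap x.1 ∧ bipyrMap x.1 ≠ 0 := by
  have hpc : ∀ x : Fin 5 → ℝ, planeCoord (x ∘ bipyrMid) = (x 1 - x 3, x 2 - x 3) := fun _ => rfl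
  have hGeq : ∀ x ∈ realization bipyramid, ∀ y ∈ realization bipyramid, ∀ c : ℝ, 0 ≤ c →
      bipyrMap x = c • bipyrMap y → x = c • y := by
    intro x hx y hy c hc h
    rw [mem_realization_bipyramid] at hx hy
    have h' := fun i => congrFun (congrArg WithLp.ofLp h) i
    have h0 : x 1 - x 3 = c * (y 1 - y 3) := h' 0
    have h1 : x 2 - x 3 = c * (y 2 - y 3) := h' 1
    have h2 : x 4 - x 0 = c * (y 4 - y 0) := h' 2
    have e := planeCoord_injOn hx.2.1 (smul_mem_plane hy.2.1 hc) (by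
      rw [planeCoord_smul, hpc, hpc, h0, h1]; rfl)
    have n0 := hx.1.1 0
    have n4 := hx.1.1 4
    have m0 := mul_nonneg hc (hy.1.1 0)
    have m4 := mul_nonneg hc (hy.1.1 4)
    have e4 : x 4 = c * y 4 ∧ x 0 = c * y 0 := by
      rcases hx.2.2 with a | a <;> rcases hy.2.2 with b | b <;> rw [a, b] at h2 <;>
        rw [b] <;> rw [a] <;> constructor <;> nlinarith
    ext v
    have key : ∀ v : Fin 5, v = 0 ∨ v = 4 ∨ ∃ i, v = bipyrMid i := by decide
    rcases key v with rfl | rfl | ⟨i, rfl⟩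
    · exact e4.2
    · exact e4.1
    · exact congrFun e i
  have key : ∀ x ∈ realization bipyramid, ∀ y ∈ realization bipyramid, ∀ c : ℝ, 0 ≤ c →
      bipyrMap x = c • bipyrMap y → c = 1 := by
    intro x hx y hy c hc h
    have h1 := (mem_realization_bipyramid.1 hx).1.2
    rw [hGeq x hx y hy c hc h] at h1
    simp only [Pi.smul_apply, smul_eq_mul, ← mul_sum, (mem_realization_bipyramid.1 hy).1.2,
      mul_one] at h1
    exact h1
  have hne : ∀ x ∈ realization bipyramid, bipyrMap x ≠ 0 := fun x hx h =>
    one_ne_zero (key x hx x hx 0 le_rfl (by rw [h, smul_zero])).symm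
  refine (nonempty_homeomorph_sphere isCompact_realization_bipyramid bipyrMap.continuous.continuousOn
    hne (fun x hx y hy c hc h => ?_) fun v hv => ?_).imp fun e he x => ⟨he x, hne x.1 x.2⟩
  · obtain rfl := key x hx y hy c hc.le h
    rw [hGeq x hx y hy 1 zero_le_one h, one_smul]
  · set p := planeInv (v 0, v 1)
    have hp : p ∈ plane := planeInv_mem _
    have hpv : planeCoord p = (v 0, v 1) := planeCoord_planeInv _
    -- The positive and negative parts of the height go to the two apices, so one of these
    -- coordinates is zero.
    let z : Fin 5 → ℝ := ![max (-v 2) 0, p 0, p 1, p 2, max (v 2) 0]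
    have hzp : z ∘ bipyrMid = p := funext fun i => by fin_cases i <;> rfl
    have hz0 : ∀ i, 0 ≤ z i := by
      intro i
      fin_cases i
      exacts [le_max_right _ _, hp.1 0, hp.1 1, hp.1 2, le_max_right _ _]
    have hz4 : z 4 - z 0 = v 2 := by
      change max (v 2) 0 - max (-v 2) 0 = v 2
      rcases le_total (v 2) 0 with h | h
      · rw [max_eq_right h, max_eq_left (by linarith)]; ring
      · rw [max_eq_left h, max_eq_right (by linarith)]; ring
    have hzv : bipyrMap z = v := by
      rw [bipyrMap_apply, hz4]
      have e1 := congrArg Prod.fst hpv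
      have e2 := congrArg Prod.snd hpv
      ext i
      fin_cases i
      exacts [e1, e2, rfl]
    have hm : 0 < ∑ i, z i := by
      refine (sum_nonneg fun i _ => hz0 i).lt_of_ne' fun h => hv ?_
      rw [← hzv, show z = 0 from funext fun i =>
        (sum_eq_zero_iff_of_nonneg fun i _ => hz0 i).1 h i (mem_univ i), map_zero]
    refine ⟨(∑ i, z i)⁻¹ • z, mem_realization_bipyramid.2 ⟨⟨fun i => ?_, ?_⟩, ?_, ?_⟩,
      (∑ i, z i)⁻¹, inv_pos.2 hm, by rw [map_smul, hzv]⟩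
    · exact mul_nonneg (inv_nonneg.2 hm.le) (hz0 i)
    · simp only [Pi.smul_apply, smul_eq_mul, ← mul_sum]
      exact inv_mul_cancel₀ hm.ne'
    · change (∑ i, z i)⁻¹ • (z ∘ bipyrMid) ∈ plane
      rw [hzp]
      exact smul_mem_plane hp (inv_nonneg.2 hm.le)
    · have : z 0 = 0 ∨ z 4 = 0 := by
        rcases le_total (v 2) 0 with h | h
        · exact .inr (max_eq_right h)
        · exact .inl (max_eq_right (by linarith))
      simpa [hm.ne'] using this

/-- Radial projection is Lipschitz away from the origin, and by compactness the image of the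
bipyramid stays away from it. -/
theorem exists_lipschitz_bipyramid : ∃ C : ℝ, 0 < C ∧ ∃ e : realization bipyramid ≃ₜ UnitSphere 2,
    ∀ x y, ‖(e x).1 - (e y).1‖ ≤ C * ∑ w, |x.1 w - y.1 w| := by
  obtain ⟨e, he⟩ := bipyramid_homeomorph
  have hne : (realization bipyramid).Nonempty := by
    obtain ⟨v, hv⟩ : (Metric.sphere (0 : EuclideanSpace ℝ (Fin 3)) 1).Nonempty :=
      (NormedSpace.sphere_nonempty).2 zero_le_one
    exact ⟨_, (e.symm ⟨v, hv⟩).2⟩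
  obtain ⟨x₀, hx₀, hmin⟩ := isCompact_realization_bipyramid.exists_isMinOn hne
    bipyrMap.continuous.norm.continuousOn
  have hm : 0 < ‖bipyrMap x₀‖ := norm_pos_iff.2 (he ⟨x₀, hx₀⟩).2
  refine ⟨2 * ‖bipyrMap x₀‖⁻¹ * (‖bipyrMap‖ + 1), by positivity, e, fun x y => ?_⟩
  rw [(he x).1, (he y).1]
  refine (norm_normalize_sub_le (he x).2 (he y).2).trans ?_
  have h1 : ‖bipyrMap x₀‖ ≤ ‖bipyrMap x.1‖ := hmin x.2
  rw [← map_sub, mul_assoc _ (‖bipyrMap‖ + 1)]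
  have h2 : ‖x.1 - y.1‖ ≤ ∑ w, |x.1 w - y.1 w| := by
    refine (pi_norm_le_iff_of_nonneg (sum_nonneg fun _ _ => abs_nonneg _)).2 fun w => ?_
    exact single_le_sum (f := fun w => |x.1 w - y.1 w|) (fun _ _ => abs_nonneg _) (mem_univ w)
  gcongr
  calc ‖bipyrMap (x.1 - y.1)‖ ≤ ‖bipyrMap‖ * ‖x.1 - y.1‖ := bipyrMap.le_opNorm _
    _ ≤ (‖bipyrMap‖ + 1) * ∑ w, |x.1 w - y.1 w| := by
      gcongr
      linarith

/-- Layered triangulations of the `3`-sphere have exponentially large Hopf size. -/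
theorem exists_exp_lt_hopfSize : ∃ c : ℝ, 0 < c ∧ ∃ N₀ : ℕ, ∀ N : ℕ, N₀ ≤ N →
    ∃ (V : Type) (_ : Fintype V) (K : AbstractSimplicialComplex V),
      Nonempty (realization K ≃ₜ UnitSphere 3) ∧ numSimplices K ≤ N ∧
      ENNReal.ofReal (Real.exp (c * N)) < hopfSize K := by
  obtain ⟨C, hC, e, he⟩ := exists_lipschitz_bipyramid
  -- The factors pass from chord to angle, from the bipyramid to the sphere, and from barycentric to
  -- unit Euclidean distance. None depends on the number of layers.
  set L := Real.pi / 2 * (C * 3)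
  have hL : 0 < L := mul_pos (by positivity) (by positivity)
  obtain ⟨c, hc, N₀, h⟩ := exists_exp_lt ((L ^ 4)⁻¹) (by positivity)
    (Fintype.card (ZMod 3 × Bool))
  refine ⟨c, hc, N₀, fun N hN => ?_⟩
  obtain ⟨l, hl, hexp⟩ := h N hN
  refine ⟨_, _, filling annulus (l + 1), nonempty_realization_annulus_homeomorph _,
    (numSimplices_filling_le _ _).trans hl, ?_⟩
  -- The second boundary circle already goes to the apex 4, so the annulus covers the second cone
  -- and the second solid torus is sent to a point.
  let ψ : Bool × ZMod 3 → Fin 5 := fun x => bif x.1 then 4 else bipyrMid x.2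
  let pole : Bool → Fin 5 := fun σ => bif σ then 4 else 0
  obtain ⟨hφ, h, hh, hfib⟩ := exists_isHopfInvariant annulus (pole := pole) (ψ := ψ)
    (hτ := bipyrTri_cover) (by decide) (by decide) (by decide) (by decide) (by decide) (by decide)
    isOrientation_bipyramid bipyrTri_injective (by
      rw [Fintype.sum_prod_type, Fintype.sum_bool]
      have h1 : ∀ i, coneForm (pole false) (fun i => ψ (annulus.c false i))
          (bipyrTri (true, i)) = 0 := fun i => by
        by_contra h
        obtain ⟨q, hq⟩ := exists_eq_of_coneForm_ne_zero h
        have key : ∀ i q, bipyrTri (true, i) q ≠ 0 := by decide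
        exact key i q hq
      have h2 : ∀ i, coneForm (pole false) (fun i => ψ (annulus.c false i))
          (bipyrTri (false, i)) = 1 / 3 := fun i =>
        coneForm_cone (s := pole false) (c := fun i => ψ (annulus.c false i))
          (by decide) (by decide) i
      simp only [h1, h2, bipyrSign]
      simp) e l
  have hlip : IsLipschitzToSphere (filling annulus (l + 1)) L
      ((e : C(_, UnitSphere 2)).comp (realMap _ hφ)) := by
    refine isLipschitzToSphere_of_forall (by positivity) fun s hs x y hx hy => ?_
    have hcard : s.card ≤ 4 := by
      obtain ⟨-, T, hT⟩ := hs
      classical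
      calc s.card ≤ (univ.image (tet annulus (l + 1) T)).card := card_le_card fun v hv => by
            obtain ⟨p, hp⟩ := hT v hv
            exact mem_image.2 ⟨p, mem_univ _, hp⟩
        _ ≤ 4 := card_image_le.trans (by simp)
    refine (he (realMap _ hφ x) (realMap _ hφ y)).trans ?_
    rw [mul_assoc]
    refine mul_le_mul_of_nonneg_left ?_ hC.le
    exact (sum_abs_pushf_sub_le _ _ _).trans (sum_abs_sub_le hcard hx hy)
  refine lt_of_lt_of_le ?_ (le_iSup₂_of_le L hL (le_iSup₂_of_le _ hlip (le_iSup₂_of_le h hh le_rfl)))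
  rw [ENNReal.ofReal_lt_ofReal_iff_of_nonneg (Real.exp_pos _).le, hfib, mul_comm _ (L ^ 4)⁻¹]
  exact hexp

end Bipyramid
end HopfBound
end

noncomputable section
namespace HopfBound
open Finset

/-! ### Locally Euclidean spaces -/

section LocEuc

variable {H H' X Y E F : Type*} [TopologicalSpace H] [TopologicalSpace H'] [TopologicalSpace X]
  [TopologicalSpace Y] [TopologicalSpace E] [TopologicalSpace F]

/-- Every point has a neighbourhood that is homeomorphic to an open subset of `H`. -/
def LocEuc (H X : Type*) [TopologicalSpace H] [TopologicalSpace X] : Prop :=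
  ∀ x : X, ∃ e : OpenPartialHomeomorph X H, x ∈ e.source

theorem LocEuc.nonempty_chartedSpace (h : LocEuc H X) : Nonempty (ChartedSpace H X) := by
  choose e he using h
  exact ⟨{ atlas := Set.range e
           chartAt := e
           mem_chart_source := he
           chart_mem_atlas := Set.mem_range_self }⟩

theorem LocEuc.of_homeomorph (e : X ≃ₜ H) : LocEuc H X := fun _ =>
  ⟨e.toOpenPartialHomeomorph, trivial⟩

theorem LocEuc.transHomeomorph (h : LocEuc H X) (g : H ≃ₜ H') : LocEuc H' X := fun x => by
  obtain ⟨e, he⟩ := h x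
  exact ⟨e.trans g.toOpenPartialHomeomorph, by simpa using he⟩

theorem LocEuc.congr (h : LocEuc H X) (g : Y ≃ₜ X) : LocEuc H Y := fun y => by
  obtain ⟨e, he⟩ := h (g y)
  exact ⟨g.toOpenPartialHomeomorph.trans e, by simpa using he⟩

theorem LocEuc.prod (h : LocEuc H X) (h' : LocEuc H' Y) : LocEuc (H × H') (X × Y) := fun x => by
  obtain ⟨e, he⟩ := h x.1
  obtain ⟨e', he'⟩ := h' x.2
  exact ⟨e.prod e', ⟨he, he'⟩⟩

/-- A continuous injection of a compact set is a local homeomorphism between open subsets. -/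
theorem LocEuc.exists_chart [T2Space E] [T2Space F] {A : Set E} {B : Set F} (hB : LocEuc H B)
    {f : E → F} {K U O : Set E} {P : Set F} (hKA : K ⊆ A) (hK : IsCompact K)
    (hf : ContinuousOn f K) (hinj : Set.InjOn f K) (hfB : Set.MapsTo f K B) (hO : IsOpen O)
    (hUO : U = A ∩ O) (hUK : U ⊆ K) (hP : IsOpen P) (hUP : f '' U = B ∩ P) (x : A) (hx : x.1 ∈ U) :
    ∃ e : OpenPartialHomeomorph A H, x ∈ e.source := by
  classical
  let b₀ : B := ⟨f x, hfB (hUK hx)⟩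
  -- Off K the map f may leave B, so g takes a default value there; only its values on K are used.
  let g : A → B := fun a => if h : f a ∈ B then ⟨f a, h⟩ else b₀
  let K' : Set A := Subtype.val ⁻¹' K
  let U' : Set A := Subtype.val ⁻¹' U
  have hg : ∀ a ∈ K', (g a).1 = f a := fun a ha => by
    simp only [g]
    rw [dif_pos (hfB ha)]
  have hK' : IsCompact K' := by
    rw [Subtype.isCompact_iff, Subtype.image_preimage_coe, Set.inter_eq_right.2 hKA]
    exact hK
  have hgc : ContinuousOn g K' := by
    rw [Topology.IsInducing.subtypeVal.continuousOn_iff]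
    exact (hf.comp continuous_subtype_val.continuousOn fun a ha => ha).congr hg
  have hgi : Set.InjOn g K' := fun a ha b hb h => by
    have := congrArg Subtype.val h
    rw [hg a ha, hg b hb] at this
    exact Subtype.ext (hinj ha hb this)
  have hU' : IsOpen U' := by
    have : U' = Subtype.val ⁻¹' O := by
      ext a
      simp [U', hUO, a.2]
    rw [this]
    exact hO.preimage continuous_subtype_val
  have hUK' : U' ⊆ K' := fun a ha => hUK ha
  have hgU : IsOpen (g '' U') := by
    have : g '' U' = Subtype.val ⁻¹' P := by
      ext b
      constructor
      · rintro ⟨a, ha, rfl⟩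
        have h1 : f a ∈ B ∩ P := hUP ▸ Set.mem_image_of_mem f ha
        rw [Set.mem_preimage, hg a (hUK' ha)]
        exact h1.2
      · intro hb
        have h1 : b.1 ∈ f '' U := hUP ▸ ⟨b.2, hb⟩
        obtain ⟨a, ha, hab⟩ := h1
        refine ⟨⟨a, hKA (hUK ha)⟩, ha, Subtype.ext ?_⟩
        rw [hg _ (hUK ha), hab]
    rw [this]
    exact hP.preimage continuous_subtype_val
  have : Nonempty A := ⟨x⟩
  let e : OpenPartialHomeomorph A B :=
    { toFun := g
      invFun := Function.invFunOn g K'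
      source := U'
      target := g '' U'
      map_source' := fun a ha => Set.mem_image_of_mem g ha
      map_target' := by
        rintro _ ⟨a, ha, rfl⟩
        rwa [hgi.leftInvOn_invFunOn (hUK' ha)]
      left_inv' := fun a ha => hgi.leftInvOn_invFunOn (hUK' ha)
      right_inv' := by
        rintro _ ⟨a, ha, rfl⟩
        rw [hgi.leftInvOn_invFunOn (hUK' ha)]
      open_source := hU'
      open_target := hgU
      continuousOn_toFun := hgc.mono hUK'
      continuousOn_invFun := (continuousOn_invFunOn hK' hgc hgi).mono (Set.image_mono hUK') }
  obtain ⟨e', he'⟩ := hB (g x)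
  refine ⟨e.trans e', ?_⟩
  rw [OpenPartialHomeomorph.trans_source]
  exact ⟨hx, he'⟩

end LocEuc

/-! ### Local models: the circle, and cones over cycles -/

section Models

/-- The plane model is homeomorphic to the plane. -/
def planeHomeomorph : plane ≃ₜ ℝ × ℝ where
  toFun p := planeCoord p.1
  invFun z := ⟨planeInv z, planeInv_mem z⟩
  left_inv p := Subtype.ext
    (planeCoord_injOn (planeInv_mem _) p.2 (planeCoord_planeInv _))
  right_inv z := planeCoord_planeInv z
  continuous_toFun := continuous_planeCoord.comp continuous_subtype_val
  continuous_invFun := continuous_planeInv.subtype_mk _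

/-- On the open star of the vertex i at most one other coordinate is nonzero, so the difference of
the other two is a chart onto (-1, 1), inverted by positive and negative parts. -/
theorem locEuc_circ : LocEuc ℝ circ := by
  intro x
  have hR : LocEuc ℝ (Set.univ : Set ℝ) := .of_homeomorph (Homeomorph.Set.univ ℝ)
  obtain ⟨i, hi⟩ : ∃ i, 0 < x.1 i := by
    by_contra! h
    have h1 := x.2.1.2
    have h2 := sum_nonpos fun i (_ : i ∈ univ) => h i
    linarith
  have hsum : ∀ y ∈ circ, y i + y (i + 1) + y (i + 2) = 1 := fun y hy => by
    rw [← sum_zmod_three, hy.1.2]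
  refine hR.exists_chart (f := fun y => y (i + 1) - y (i + 2))
    (K := circ ∩ {y | y (i + 1) = 0 ∨ y (i + 2) = 0}) (U := circ ∩ {y | 0 < y i})
    (O := {y | 0 < y i}) (P := Set.Ioo (-1) 1) Set.inter_subset_left ?_ ?_ ?_ ?_ ?_ rfl ?_ isOpen_Ioo
    ?_ x ⟨x.2, hi⟩
  · refine isCompact_circ.inter_right ?_
    exact (isClosed_eq (continuous_apply _) continuous_const).union
      (isClosed_eq (continuous_apply _) continuous_const)
  · exact Continuous.continuousOn (by fun_prop)
  · rintro y ⟨hy, hy0⟩ z ⟨hz, hz0⟩ h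
    have h1 := hsum y hy
    have h2 := hsum z hz
    have a1 := hy.1.1 (i + 1)
    have a2 := hy.1.1 (i + 2)
    have b1 := hz.1.1 (i + 1)
    have b2 := hz.1.1 (i + 2)
    simp only at h
    have e : y (i + 1) = z (i + 1) ∧ y (i + 2) = z (i + 2) := by
      rcases hy0 with e1 | e1 <;> rcases hz0 with e2 | e2 <;> rw [e1, e2] at h <;>
        constructor <;> linarith
    ext j
    rcases zmod_three_cases j i with rfl | rfl | rfl
    · linarith
    · exact e.1
    · exact e.2
  · exact fun _ _ => trivial
  · exact isOpen_lt continuous_const (continuous_apply i)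
  · rintro y ⟨hy, hyi⟩
    refine ⟨hy, ?_⟩
    obtain ⟨j, hj⟩ := hy.2
    rcases zmod_three_cases j i with rfl | rfl | rfl
    · exact absurd hj hyi.ne'
    · exact .inl hj
    · exact .inr hj
  · rw [Set.univ_inter]
    ext t
    constructor
    · rintro ⟨y, ⟨hy, hyi⟩, rfl⟩
      have h1 := hsum y hy
      have a1 := hy.1.1 (i + 1)
      have a2 := hy.1.1 (i + 2)
      simp only [Set.mem_ofPred_eq] at hyi
      constructor <;> simp only <;> linarith
    · rintro ⟨ht0, ht1⟩
      obtain ⟨n1, n2, n3⟩ := zmod_three_ne i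
      have hs : ∀ f : ZMod 3 → ℝ, ∑ j, f j = f i + f (i + 1) + f (i + 2) := fun f =>
        sum_zmod_three f i
      have a0 : 0 < 1 - max t 0 - max (-t) 0 := by
        rcases le_total t 0 with h | h
        · rw [max_eq_right h, max_eq_left (by linarith)]; linarith
        · rw [max_eq_left h, max_eq_right (by linarith)]; linarith
      refine ⟨fun j => if j = i then 1 - max t 0 - max (-t) 0 else if j = i + 1 then max t 0
        else max (-t) 0, ⟨⟨⟨fun j => ?_, ?_⟩, ?_⟩, ?_⟩, ?_⟩
      · dsimp only
        split_ifs
        exacts [a0.le, le_max_right _ _, le_max_right _ _]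
      · rw [hs]
        simp only [n1.symm, n2.symm, n3.symm, if_false, if_true]
        ring
      · rcases le_total t 0 with h | h
        · exact ⟨i + 1, by simp [n1.symm, h]⟩
        · exact ⟨i + 2, by simp [n2.symm, n3.symm, h]⟩
      · simpa using a0
      · simp only [n1.symm, n2.symm, n3.symm, if_false, if_true]
        rcases le_total t 0 with h | h
        · rw [max_eq_right h, max_eq_left (by linarith)]; ring
        · rw [max_eq_left h, max_eq_right (by linarith)]; ring

/-- The next vertex of the cycle with `d` vertices. -/
def nxt (d k : ℕ) : ℕ := if k + 1 = d then 0 else k + 1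

/-- The cone over the cycle with `d` vertices. -/
def cycCone (d : ℕ) : Set (ℕ → ℝ) :=
  {p | (∀ k, 0 ≤ p k) ∧ ∃ k < d, ∀ j, j ≠ k → j ≠ nxt d k → p j = 0}

theorem cycCone_apply_eq_zero {d : ℕ} {p : ℕ → ℝ} (hp : p ∈ cycCone d) {j : ℕ} (hj : d ≤ j) :
    p j = 0 := by
  obtain ⟨k, hk, h⟩ := hp.2
  refine h j (by omega) ?_
  simp only [nxt]
  split_ifs <;> omega

/-- Removing a vertex of the cycle. -/
def dropVertex (d : ℕ) (p : ℕ → ℝ) (j : ℕ) : ℝ :=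
  if j = d then 0 else p j + if j = 0 ∨ j + 1 = d then p d else 0

/-- Adding a vertex to the cycle. -/
def addVertex (d : ℕ) (p : ℕ → ℝ) (j : ℕ) : ℝ :=
  if j = d then min (p 0) (p (d - 1))
  else p j - if j = 0 ∨ j + 1 = d then min (p 0) (p (d - 1)) else 0

theorem dropVertex_mem {d : ℕ} (hd : 3 ≤ d) {p : ℕ → ℝ} (hp : p ∈ cycCone (d + 1)) :
    dropVertex d p ∈ cycCone d := by
  obtain ⟨h0, k, hk, h⟩ := hp
  refine ⟨fun j => ?_, ?_⟩
  · have := h0 j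
    have := h0 d
    unfold dropVertex
    split_ifs <;> linarith
  · by_cases hkd : k + 1 < d
    · have e : p d = 0 := h d (by omega) (by simp only [nxt]; split_ifs <;> omega)
      refine ⟨k, by omega, fun j h1 h2 => ?_⟩
      have : p j = 0 := h j h1 (by simp only [nxt] at h2 ⊢; split_ifs at h2 ⊢ <;> omega)
      simp [dropVertex, e, this]
    · refine ⟨d - 1, by omega, fun j h1 h2 => ?_⟩
      simp only [nxt, show d - 1 + 1 = d by omega, if_true] at h2
      have : j ≠ d → p j = 0 := fun h3 =>
        h j (by omega) (by simp only [nxt]; split_ifs <;> omega)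
      by_cases h3 : j = d
      · simp [dropVertex, h3]
      · simp [dropVertex, h3, this h3, h2, show j + 1 ≠ d by omega]

theorem addVertex_mem {d : ℕ} (hd : 3 ≤ d) {p : ℕ → ℝ} (hp : p ∈ cycCone d) :
    addVertex d p ∈ cycCone (d + 1) := by
  have hz := fun j hj => cycCone_apply_eq_zero hp (j := j) hj
  obtain ⟨h0, k, hk, h⟩ := hp
  have m0 : 0 ≤ min (p 0) (p (d - 1)) := le_min (h0 _) (h0 _)
  refine ⟨fun j => ?_, ?_⟩
  · unfold addVertex
    split_ifs with h1 h2
    · exact m0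
    · rw [sub_nonneg]
      rcases h2 with rfl | h2
      · exact min_le_left _ _
      · rw [show j = d - 1 by omega]
        exact min_le_right _ _
    · simpa using h0 j
  · by_cases hkd : k + 1 < d
    · have e : min (p 0) (p (d - 1)) = 0 := by
        refine le_antisymm ?_ m0
        by_cases hk0 : k = 0
        · rw [h (d - 1) (by omega) (by simp only [nxt]; split_ifs <;> omega)]
          exact min_le_right _ _
        · rw [h 0 (by omega) (by simp only [nxt]; split_ifs <;> omega)]
          exact min_le_left _ _
      refine ⟨k, by omega, fun j h1 h2 => ?_⟩
      by_cases h3 : j = d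
      · simp [addVertex, h3, e]
      · have : p j = 0 := h j h1 (by simp only [nxt] at h2 ⊢; split_ifs at h2 ⊢ <;> omega)
        simp [addVertex, e, this]
    · obtain rfl : k = d - 1 := by omega
      have hj : ∀ j, j ≠ 0 → j + 1 ≠ d → p j = 0 := fun j h1 h2 =>
        h j (by omega) (by simp only [nxt]; split_ifs <;> omega)
      rcases le_total (p 0) (p (d - 1)) with hle | hle
      · refine ⟨d - 1, by omega, fun j h1 h2 => ?_⟩
        simp only [nxt] at h2
        have h3 : j ≠ d := by split_ifs at h2 <;> omega
        by_cases h4 : j = 0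
        · simp [addVertex, h4, min_eq_left hle, show ¬ 0 = d by omega]
        · simp [addVertex, h3, h4, show j + 1 ≠ d by omega, hj]
      · refine ⟨d, by omega, fun j h1 h2 => ?_⟩
        simp only [nxt, if_true] at h2
        by_cases h4 : j + 1 = d
        · obtain rfl : j = d - 1 := by omega
          simp [addVertex, h1, h4, min_eq_right hle]
        · simp [addVertex, h1, h2, h4, hj]

theorem addVertex_dropVertex {d : ℕ} (hd : 3 ≤ d) {p : ℕ → ℝ} (hp : p ∈ cycCone (d + 1)) :
    addVertex d (dropVertex d p) = p := by
  obtain ⟨h0, k, hk, h⟩ := hp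
  have e1 : dropVertex d p 0 = p 0 + p d := by simp [dropVertex, show ¬ 0 = d by omega]
  have e2 : dropVertex d p (d - 1) = p (d - 1) + p d := by
    simp [dropVertex, show d - 1 ≠ d by omega, show d - 1 + 1 = d by omega]
  have hm : min (p 0 + p d) (p (d - 1) + p d) = p d := by
    rw [min_add_add_right]
    have : min (p 0) (p (d - 1)) = 0 := by
      refine le_antisymm ?_ (le_min (h0 _) (h0 _))
      by_cases hk0 : k = 0 ∨ k = d
      · rw [h (d - 1) (by omega) (by simp only [nxt]; split_ifs <;> omega)]
        exact min_le_right _ _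
      · rw [h 0 (by omega) (by simp only [nxt]; split_ifs <;> omega)]
        exact min_le_left _ _
    rw [this, zero_add]
  ext j
  rw [addVertex, e1, e2, hm]
  by_cases h1 : j = d
  · simp [h1]
  · by_cases h2 : j = 0 ∨ j + 1 = d <;> simp [dropVertex, h1, h2]

theorem dropVertex_addVertex {d : ℕ} {p : ℕ → ℝ} (hp : p ∈ cycCone d) :
    dropVertex d (addVertex d p) = p := by
  have hz := cycCone_apply_eq_zero hp (le_refl d)
  ext j
  by_cases h1 : j = d
  · simp [h1, dropVertex, hz]
  · by_cases h2 : j = 0 ∨ j + 1 = d <;> simp [dropVertex, addVertex, h1, h2]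

theorem continuous_dropVertex (d : ℕ) : Continuous (dropVertex d) := by
  refine continuous_pi fun j => ?_
  unfold dropVertex
  split_ifs <;> fun_prop

theorem continuous_addVertex (d : ℕ) : Continuous (addVertex d) := by
  refine continuous_pi fun j => ?_
  unfold addVertex
  split_ifs <;> fun_prop

/-- Removing a vertex of a cycle does not change the cone. -/
def cycConeHomeomorph {d : ℕ} (hd : 3 ≤ d) : cycCone (d + 1) ≃ₜ cycCone d where
  toFun p := ⟨dropVertex d p.1, dropVertex_mem hd p.2⟩
  invFun p := ⟨addVertex d p.1, addVertex_mem hd p.2⟩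
  left_inv p := Subtype.ext (addVertex_dropVertex hd p.2)
  right_inv p := Subtype.ext (dropVertex_addVertex p.2)
  continuous_toFun := ((continuous_dropVertex d).comp continuous_subtype_val).subtype_mk _
  continuous_invFun := ((continuous_addVertex d).comp continuous_subtype_val).subtype_mk _

/-- The cone over the triangle is the plane model. -/
def cycConeThree : cycCone 3 ≃ₜ plane where
  toFun p := ⟨fun i => p.1 i.val, fun i => p.2.1 _, by
    obtain ⟨-, k, hk, h⟩ := p.2
    interval_cases k
    · exact ⟨2, h 2 (by decide) (by decide)⟩
    · exact ⟨0, h 0 (by decide) (by decide)⟩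
    · exact ⟨1, h 1 (by decide) (by decide)⟩⟩
  invFun p := ⟨fun k => if k < 3 then p.1 k else 0, by
    obtain ⟨h0, i, hi⟩ := p.2
    refine ⟨fun k => ?_, ?_⟩
    · dsimp only
      split_ifs
      exacts [h0 _, le_rfl]
    · have key : ∀ i : ZMod 3, ∃ k < 3, ∀ j < 3, j ≠ k → j ≠ nxt 3 k → (j : ZMod 3) = i := by
        decide
      obtain ⟨k, hk, h⟩ := key i
      refine ⟨k, hk, fun j h1 h2 => ?_⟩
      dsimp only
      split_ifs with hj
      · rw [h j hj h1 h2, hi]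
      · rfl⟩
  left_inv p := Subtype.ext (funext fun k => by
    dsimp only
    split_ifs with h
    · rw [ZMod.val_cast_of_lt h]
    · exact (cycCone_apply_eq_zero p.2 (by omega)).symm)
  right_inv p := Subtype.ext (funext fun i => by
    dsimp only
    rw [if_pos (ZMod.val_lt i), ZMod.natCast_zmod_val])
  continuous_toFun := by
    refine Continuous.subtype_mk (continuous_pi fun i => ?_) _
    exact (continuous_apply (ZMod.val i)).comp continuous_subtype_val
  continuous_invFun := by
    refine Continuous.subtype_mk (continuous_pi fun k => ?_) _
    split_ifs
    · exact (continuous_apply _).comp continuous_subtype_val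
    · exact continuous_const

theorem locEuc_cycCone {d : ℕ} (hd : 3 ≤ d) : LocEuc (ℝ × ℝ) (cycCone d) := by
  induction d, hd using Nat.le_induction with
  | base => exact .of_homeomorph (cycConeThree.trans planeHomeomorph)
  | succ d hd ih => exact ih.congr (cycConeHomeomorph hd)

end Models
end HopfBound
end

noncomputable section
namespace HopfBound
open Finset

/-! ### Triangulated surfaces -/

section Surfaces

variable {V ι : Type} [Fintype V] {τ : ι → Fin 3 → V}

theorem nxt_lt {d k : ℕ} (hk : k < d) : nxt d k < d := by
  simp only [nxt]
  split_ifs <;> omega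

/-- A complex of triangles in which the link of every vertex is a cycle is locally a plane. -/
theorem locEuc_of_links [Finite ι] {hτ : ∀ v, ∃ i p, τ i p = v} {d : V → ℕ} {ℓ : V → ℕ → V}
    (hd : ∀ v, 3 ≤ d v) (hne : ∀ v, ∀ k < d v, ℓ v k ≠ v)
    (hinj : ∀ v, ∀ k < d v, ∀ k' < d v, ℓ v k = ℓ v k' → k = k')
    (h1 : ∀ i p, ∃ k < d (τ i p), ∀ q, τ i q = τ i p ∨ τ i q = ℓ (τ i p) k ∨
      τ i q = ℓ (τ i p) (nxt (d (τ i p)) k))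
    (h2 : ∀ v, ∀ k < d v, ∃ i, (∃ p, τ i p = v) ∧ (∃ p, τ i p = ℓ v k) ∧
      ∃ p, τ i p = ℓ v (nxt (d v) k)) :
    LocEuc (ℝ × ℝ) (realization (facetComplex τ hτ)) := by
  classical
  intro x
  have hA : realization (facetComplex τ hτ) = ⋃ i, cell (τ i) := realization_facetComplex
  have hstd : ∀ y ∈ realization (facetComplex τ hτ), y ∈ stdSimplex ℝ V := fun y hy => by
    rw [hA] at hy
    obtain ⟨i, hi⟩ := Set.mem_iUnion.1 hy
    exact hi.1
  obtain ⟨v, hv⟩ : ∃ v, 0 < x.1 v := by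
    by_contra! h
    have h1 := (hstd x.1 x.2).2
    have h2 := sum_nonpos fun i (_ : i ∈ univ) => h i
    linarith
  -- K is the closed star of v.
  let K : Set (V → ℝ) := ⋃ i, ⋃ (_ : ∃ p, τ i p = v), cell (τ i)
  have hKm : ∀ y, y ∈ K ↔ ∃ i, (∃ p, τ i p = v) ∧ y ∈ cell (τ i) := fun y => by
    simp only [K, Set.mem_iUnion, exists_prop]
  have hKs : ∀ y ∈ K, ∃ k < d v, ∀ w, w ≠ v → w ≠ ℓ v k → w ≠ ℓ v (nxt (d v) k) → y w = 0 := by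
    intro y hy
    obtain ⟨i, ⟨p, hp⟩, hy'⟩ := (hKm y).1 hy
    obtain ⟨k, hk, h⟩ := h1 i p
    rw [hp] at hk h
    refine ⟨k, hk, fun w e1 e2 e3 => hy'.2 w ?_⟩
    rintro q rfl
    rcases h q with h | h | h
    exacts [e1 h, e2 h, e3 h]
  have hKA : K ⊆ realization (facetComplex τ hτ) := fun y hy => by
    obtain ⟨i, -, hi⟩ := (hKm y).1 hy
    rw [hA]
    exact Set.mem_iUnion.2 ⟨i, hi⟩
  have hsum : ∀ y : V → ℝ, (∀ w, w ≠ v → (∀ k < d v, w ≠ ℓ v k) → y w = 0) →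
      ∑ w, y w = y v + ∑ k ∈ range (d v), y (ℓ v k) := by
    intro y hy
    have e : ∑ k ∈ range (d v), y (ℓ v k) = ∑ w ∈ (range (d v)).image (ℓ v), y w :=
      (sum_image fun a ha b hb => hinj v a (mem_range.1 ha) b (mem_range.1 hb)).symm
    have hv' : v ∉ (range (d v)).image (ℓ v) := fun h => by
      obtain ⟨k, hk, e⟩ := mem_image.1 h
      exact hne v k (mem_range.1 hk) e
    rw [e, ← sum_insert hv']
    refine (sum_subset (subset_univ _) fun w _ hw => hy w ?_ fun k hk e => ?_).symm
    · rintro rfl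
      exact hw (mem_insert_self _ _)
    · exact hw (mem_insert_of_mem (mem_image.2 ⟨k, mem_range.2 hk, e.symm⟩))
  have hKs' : ∀ y ∈ K, ∀ w, w ≠ v → (∀ k < d v, w ≠ ℓ v k) → y w = 0 := fun y hy w e1 e2 => by
    obtain ⟨k, hk, h⟩ := hKs y hy
    exact h w e1 (e2 k hk) (e2 _ (nxt_lt hk))
  -- The chart forgets the coordinate at v, which the others determine. The open star, where that
  -- coordinate is positive, becomes the part of the cone over the link with coordinate sum below 1.
  refine (locEuc_cycCone (hd v)).exists_chart (f := fun y k => if k < d v then y (ℓ v k) else 0)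
    (K := K) (O := {y | 0 < y v}) (P := {p | ∑ k ∈ range (d v), p k < 1}) hKA ?_ ?_ ?_ ?_ ?_ rfl
    ?_ ?_ ?_ x ⟨x.2, hv⟩
  · exact isCompact_iUnion fun i => isCompact_iUnion fun _ => isCompact_cell _
  · refine Continuous.continuousOn (continuous_pi fun k => ?_)
    split_ifs
    · exact continuous_apply _
    · exact continuous_const
  · intro y hy z hz h
    have e1 : ∀ k < d v, y (ℓ v k) = z (ℓ v k) := fun k hk => by
      have := congrFun h k
      simpa [hk] using this
    have e2 := hsum y (hKs' y hy)
    have e3 := hsum z (hKs' z hz)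
    rw [(hstd y (hKA hy)).2] at e2
    rw [(hstd z (hKA hz)).2, ← sum_congr rfl fun k hk => e1 k (mem_range.1 hk)] at e3
    ext w
    by_cases hw : w = v
    · rw [hw]; linarith
    · by_cases hw' : ∃ k < d v, w = ℓ v k
      · obtain ⟨k, hk, rfl⟩ := hw'
        exact e1 k hk
      · push Not at hw'
        rw [hKs' y hy w hw hw', hKs' z hz w hw hw']
  · intro y hy
    obtain ⟨k, hk, h⟩ := hKs y hy
    refine ⟨fun j => ?_, k, hk, fun j e1 e2 => ?_⟩
    · dsimp only
      split_ifs
      exacts [(hstd y (hKA hy)).1 _, le_rfl]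
    · dsimp only
      split_ifs with hj
      · exact h _ (hne v j hj) (fun e => e1 (hinj v j hj k hk e))
          fun e => e2 (hinj v j hj _ (nxt_lt hk) e)
      · rfl
  · exact isOpen_lt continuous_const (continuous_apply v)
  · rintro y ⟨hy, hyv⟩
    rw [hA] at hy
    obtain ⟨i, hi⟩ := Set.mem_iUnion.1 hy
    refine (hKm y).2 ⟨i, ?_, hi⟩
    by_contra! h
    exact (ne_of_gt hyv) (hi.2 v h)
  · exact isOpen_lt (by fun_prop) continuous_const
  · ext p
    constructor
    · rintro ⟨y, ⟨hy, hyv⟩, rfl⟩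
      have hyK : y ∈ K := by
        rw [hA] at hy
        obtain ⟨i, hi⟩ := Set.mem_iUnion.1 hy
        refine (hKm y).2 ⟨i, ?_, hi⟩
        by_contra! h
        exact (ne_of_gt hyv) (hi.2 v h)
      obtain ⟨k, hk, h⟩ := hKs y hyK
      refine ⟨⟨fun j => ?_, k, hk, fun j e1 e2 => ?_⟩, ?_⟩
      · dsimp only
        split_ifs
        exacts [(hstd y hy).1 _, le_rfl]
      · dsimp only
        split_ifs with hj
        · exact h _ (hne v j hj) (fun e => e1 (hinj v j hj k hk e))
            fun e => e2 (hinj v j hj _ (nxt_lt hk) e)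
        · rfl
      · have e2 := hsum y (hKs' y hyK)
        rw [(hstd y hy).2] at e2
        have e3 : ∑ k ∈ range (d v), (if k < d v then y (ℓ v k) else 0) =
            ∑ k ∈ range (d v), y (ℓ v k) :=
          sum_congr rfl fun k hk => if_pos (mem_range.1 hk)
        have hyv : 0 < y v := hyv
        simp only [Set.mem_ofPred_eq, e3]
        linarith
    · rintro ⟨⟨hp0, k, hk, hp⟩, hp1⟩
      have hp1 : ∑ k ∈ range (d v), p k < 1 := hp1
      let y : V → ℝ := fun w => (if w = v then 1 - ∑ k ∈ range (d v), p k else 0) +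
        ∑ k ∈ range (d v), if ℓ v k = w then p k else 0
      have hyv : y v = 1 - ∑ k ∈ range (d v), p k := by
        simp only [y, if_true]
        rw [sum_eq_zero fun k hk => if_neg (hne v k (mem_range.1 hk)), add_zero]
      have hyl : ∀ j < d v, y (ℓ v j) = p j := by
        intro j hj
        simp only [y, if_neg (hne v j hj), zero_add]
        rw [sum_eq_single j]
        · simp
        · intro b hb hbj
          exact if_neg fun e => hbj (hinj v b (mem_range.1 hb) j hj e)
        · intro h
          exact absurd (mem_range.2 hj) h
      have hys : ∀ w, w ≠ v → (∀ k < d v, w ≠ ℓ v k) → y w = 0 := by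
        intro w hw hw'
        simp only [y, if_neg hw, zero_add]
        exact sum_eq_zero fun k hk => if_neg fun e => hw' k (mem_range.1 hk) e.symm
      have hy0 : ∀ w, 0 ≤ y w := by
        intro w
        refine add_nonneg ?_ (sum_nonneg fun k _ => ?_)
        · split_ifs <;> linarith
        · split_ifs
          exacts [hp0 k, le_rfl]
      have hy1 : ∑ w, y w = 1 := by
        rw [hsum y hys, hyv, sum_congr rfl fun k hk => hyl k (mem_range.1 hk)]
        ring
      have hyA : y ∈ realization (facetComplex τ hτ) := by
        obtain ⟨i, a1, a2, a3⟩ := h2 v k hk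
        rw [hA]
        refine Set.mem_iUnion.2 ⟨i, mem_cell_of_forall hy0 hy1 fun w hw => ?_⟩
        by_cases e : w = v
        · rwa [e]
        · by_cases e' : ∃ j < d v, w = ℓ v j
          · obtain ⟨j, hj, rfl⟩ := e'
            by_cases j1 : j = k
            · rwa [j1]
            · by_cases j2 : j = nxt (d v) k
              · rwa [j2]
              · exact absurd ((hyl j hj).trans (hp j j1 j2)) hw
          · push Not at e'
            exact absurd (hys w e e') hw
      refine ⟨y, ⟨hyA, ?_⟩, funext fun j => ?_⟩
      · change 0 < y v
        rw [hyv]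
        linarith
      · dsimp only
        split_ifs with hj
        · exact hyl j hj
        · exact (cycCone_apply_eq_zero ⟨hp0, k, hk, hp⟩ (by omega)).symm

open Classical in
/-- A complex is connected if its vertices are connected by edges. -/
theorem isConnected_realization {ι V : Type} [Fintype V] {n : ℕ} {τ : ι → Fin (n + 1) → V}
    {hτ : ∀ v, ∃ i p, τ i p = v} (v₀ : V)
    (h : ∀ P : V → Prop, P v₀ → (∀ i p q, P (τ i p) → P (τ i q)) → ∀ v, P v) :
    IsConnected (realization (facetComplex τ hτ)) := by
  rw [realization_facetComplex]
  set A : Set (V → ℝ) := ⋃ i, cell (τ i) with hA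
  have hs : ∀ i p, Pi.single (τ i p) (1 : ℝ) ∈ cell (τ i) := fun i p =>
    ⟨single_mem_stdSimplex ℝ _, fun w hw => Pi.single_eq_of_ne (hw p).symm _⟩
  have hconv : ∀ i, IsPreconnected (cell (τ i)) := fun i => by
    refine (Convex.inter (convex_stdSimplex ℝ V) (t := {x | ∀ v, (∀ p, τ i p ≠ v) → x v = 0})
      ?_).isPreconnected
    intro x hx y hy a b _ _ _ v hv
    simp [hx v hv, hy v hv]
  have hsA : ∀ i p, Pi.single (τ i p) (1 : ℝ) ∈ A := fun i p => Set.mem_iUnion.2 ⟨i, hs i p⟩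
  have hcell : ∀ i p, Pi.single (τ i p) (1 : ℝ) ∈ connectedComponentIn A (Pi.single v₀ 1) →
      cell (τ i) ⊆ connectedComponentIn A (Pi.single v₀ 1) := fun i p hp => by
    rw [connectedComponentIn_eq hp]
    exact (hconv i).subset_connectedComponentIn (hs i p) (Set.subset_iUnion (fun i => cell (τ i)) i)
  have hv₀ : Pi.single v₀ (1 : ℝ) ∈ A := by
    obtain ⟨i, p, rfl⟩ := hτ v₀
    exact hsA i p
  have key := h (fun v => Pi.single v (1 : ℝ) ∈ connectedComponentIn A (Pi.single v₀ 1))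
    (mem_connectedComponentIn hv₀) fun i p q hp => hcell i p hp (hs i q)
  have hAC : A = connectedComponentIn A (Pi.single v₀ 1) := by
    refine Set.Subset.antisymm (Set.iUnion_subset fun i => hcell i 0 (key _))
      (connectedComponentIn_subset _ _)
  refine ⟨⟨_, hv₀⟩, ?_⟩
  rw [hAC]
  exact isPreconnected_connectedComponentIn

/-- Enumerating the subsets of the facets rather than all sets of vertices makes the Euler
characteristic accessible to evaluation. -/
theorem eulerChar_facetComplex [DecidableEq V] [Fintype ι] {hτ : ∀ v, ∃ i p, τ i p = v} :
    eulerChar (facetComplex τ hτ) =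
      ∑ s ∈ univ.biUnion fun i => (univ.image (τ i)).powerset.erase ∅, (-1) ^ (s.card + 1) := by
  classical
  rw [eulerChar]
  refine sum_congr ?_ fun _ _ => rfl
  ext s
  simp only [mem_filter, mem_univ, true_and, mem_biUnion, mem_erase, mem_powerset]
  constructor
  · rintro ⟨h0, i, hi⟩
    refine ⟨i, h0.ne_empty, fun v hv => ?_⟩
    obtain ⟨p, hp⟩ := hi v hv
    exact mem_image.2 ⟨p, mem_univ _, hp⟩
  · rintro ⟨i, h0, hi⟩
    refine ⟨nonempty_iff_ne_empty.2 h0, i, fun v hv => ?_⟩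
    obtain ⟨p, -, hp⟩ := mem_image.1 (hi hv)
    exact ⟨p, hp⟩

end Surfaces
end HopfBound
end

noncomputable section
namespace HopfBound
open Finset

/-! ### A surface of genus two -/

section Cap

/-- An identity for all antisymmetric edge functions amounts to an identity between integer
coefficients, which can be checked for a concrete triangulation. -/
theorem sum_eq_zero_of_antisymm {W ι : Type} [Fintype W] [DecidableEq W] [Fintype ι] {a b : ι → W}
    {s : ι → ℤ} (h : ∀ x y, ∑ i, s i * ((if a i = x ∧ b i = y then 1 else 0) -
      if a i = y ∧ b i = x then 1 else 0) = 0) {q : W → W → ℝ} (hq : ∀ x y, q y x = -q x y) :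
    ∑ i, (s i : ℝ) * q (a i) (b i) = 0 := by
  have h1 : ∀ a b : W, q a b = ∑ x, ∑ y, (if a = x ∧ b = y then (1 : ℝ) else 0) * q x y := by
    intro a b
    rw [sum_eq_single a, sum_eq_single b] <;> simp +contextual [eq_comm]
  have h2 : ∀ a b : W, q b a = ∑ x, ∑ y, (if a = y ∧ b = x then (1 : ℝ) else 0) * q x y := by
    intro a b
    rw [h1 b a]
    simp only [and_comm]
  have h3 : ∑ i, (s i : ℝ) * (q (a i) (b i) - q (b i) (a i)) = 0 := by
    have e : ∀ i, (s i : ℝ) * (q (a i) (b i) - q (b i) (a i)) = ∑ x, ∑ y,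
        ((s i * ((if a i = x ∧ b i = y then 1 else 0) -
          if a i = y ∧ b i = x then 1 else 0) : ℤ) : ℝ) * q x y := by
      intro i
      rw [h1 (a i) (b i), h2 (a i) (b i), ← sum_sub_distrib, mul_sum]
      refine sum_congr rfl fun x _ => ?_
      rw [← sum_sub_distrib, mul_sum]
      refine sum_congr rfl fun y _ => ?_
      push_cast
      ring
    simp only [e]
    rw [sum_comm]
    refine sum_eq_zero fun x _ => ?_
    rw [sum_comm]
    refine sum_eq_zero fun y _ => ?_
    rw [← sum_mul, ← Int.cast_sum, h]
    simp
  have h4 : ∀ i, (s i : ℝ) * (q (a i) (b i) - q (b i) (a i)) = 2 * (s i * q (a i) (b i)) :=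
    fun i => by rw [hq (a i) (b i)]; ring
  simp only [h4, ← mul_sum] at h3
  linarith

variable {W Tri W' : Type} [Fintype Tri] (D : Band W Tri) (pole : Bool → W') (ψ : W → W')

/-- The triangles of the surface obtained from a band by adding two cones. -/
def capTri : Tri ⊕ Bool × ZMod 3 → Fin 3 → W'
  | .inl T => ψ ∘ D.tri T
  | .inr (σ, i) => ![pole σ, ψ (D.c σ i), ψ (D.c σ (i + 1))]

/-- The signs of the triangles of the closed surface. -/
def capSign : Tri ⊕ Bool × ZMod 3 → ℝ
  | .inl T => -D.sgn T
  | .inr (σ, _) => if σ then -1 else 1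

/-- Radial edges of each cone cancel around its circle, leaving the boundary circle. The signs are
opposite to those of the band, whose boundary is therefore closed off. -/
theorem sum_capSign {c : (Fin 2 → W') → ℝ} (hc : IsAlternating c) :
    ∑ x, capSign D x * coboundary c (capTri D pole ψ x) = 0 := by
  have h := D.bdry (fun x y => c ![ψ x, ψ y]) fun x y => hc.swap_two _ _
  have h' : ∀ σ, ∑ i, c ![pole σ, ψ (D.c σ (i + 1))] = ∑ i, c ![pole σ, ψ (D.c σ i)] := fun σ =>
    sum_zmod_three_add_one fun i => c ![pole σ, ψ (D.c σ i)]
  have e : ∀ σ, ∑ i, coboundary c ![pole σ, ψ (D.c σ i), ψ (D.c σ (i + 1))] =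
      ∑ i, c ![ψ (D.c σ i), ψ (D.c σ (i + 1))] := fun σ => by
    simp only [coboundary_eq_two, Matrix.cons_val_zero, Matrix.cons_val_one, Matrix.cons_val,
      sum_add_distrib, sum_sub_distrib, h']
    ring
  rw [Fintype.sum_sum_type, Fintype.sum_prod_type, Fintype.sum_bool]
  simp only [capSign, capTri, ← mul_sum, e, neg_mul, sum_neg_distrib]
  simp only [coboundary_eq_two, Function.comp_apply]
  rw [h]
  simp

theorem isOrientation_cap [Fintype W'] [LinearOrder W']
    {hτ : ∀ v, ∃ i p, capTri D pole ψ i p = v} (hinj : ∀ x, Function.Injective (capTri D pole ψ x))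
    (hdist : ∀ x y, (∀ p, ∃ q, capTri D pole ψ y q = capTri D pole ψ x p) → x = y) :
    IsOrientation (facetComplex (capTri D pole ψ) hτ) 2
      (signedChain (capTri D pole ψ) (capSign D)) := by
  refine isOrientation_signedChain hinj (fun x y h => hdist x y fun p =>
    (h ▸ Set.mem_range_self p : capTri D pole ψ x p ∈ Set.range (capTri D pole ψ y)))
    (fun x => ?_) (fun _ => IsAlternating.coboundary_two) fun c hc => sum_capSign D pole ψ hc
  rcases x with T | ⟨_ | _, i⟩
  · rcases D.sgn_eq T with h | h <;> simp [capSign, h]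
  · simp [capSign]
  · simp [capSign]

end Cap

/-! ### The concrete triangulation of genus two -/

section GenusTwo

/-- The triangles of a surface of genus two with two triangles removed. -/
def genusTri : Fin 36 → Fin 3 → Fin 17 :=
  ![![3, 6, 8], ![5, 3, 7], ![5, 7, 8], ![3, 4, 8], ![5, 8, 9], ![4, 8, 9],
    ![4, 5, 6], ![5, 6, 9], ![4, 7, 9], ![4, 6, 7], ![3, 6, 9], ![3, 7, 9],
    ![0, 3, 4], ![0, 1, 4], ![1, 4, 5], ![1, 2, 5], ![2, 5, 3], ![2, 0, 3],
    ![6, 8, 14], ![7, 16, 14], ![7, 8, 16], ![8, 14, 15], ![8, 10, 16], ![8, 10, 15],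
    ![6, 15, 16], ![6, 10, 16], ![7, 10, 15], ![6, 7, 15], ![6, 10, 14], ![7, 10, 14],
    ![11, 14, 15], ![11, 12, 15], ![12, 15, 16], ![12, 13, 16], ![13, 16, 14], ![13, 11, 14]]

/-- The signs of the triangles. -/
def genusSign : Fin 36 → ℤ :=
  ![-1, 1, 1, 1, 1, -1, 1, -1, 1, 1, 1, -1, -1, 1, -1, 1, -1, 1,
    1, -1, -1, -1, -1, 1, -1, 1, -1, -1, -1, 1, 1, -1, 1, -1, 1, -1]

/-- Levels of the vertices; cyclically ordered triangles have the same level. -/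
def genusLevel : Fin 17 → ℕ := ![0, 0, 0, 1, 1, 1, 2, 3, 4, 5, 6, 7, 7, 7, 8, 8, 8]

/-- The cyclic successor of a vertex in its level. -/
def genusNext : Fin 17 → Fin 17 := ![1, 2, 0, 4, 5, 3, 0, 0, 0, 0, 0, 12, 13, 11, 15, 16, 14]

/-- The boundary circles. -/
def genusCircle (σ : Bool) (i : ZMod 3) : Fin 17 :=
  (bif σ then ![11, 12, 13] else ![0, 1, 2] : Fin 3 → Fin 17) i

/-- The position of a vertex on its boundary circle. -/
def genusIdx : Fin 17 → ZMod 3 := ![0, 1, 2, 0, 0, 0, 0, 0, 0, 0, 0, 0, 1, 2, 0, 0, 0]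

/-- The edges crossed by a path that joins the boundary circles. -/
def genusCut : List (Fin 17 × Fin 17) :=
  [(0, 1), (0, 4), (3, 4), (3, 8), (6, 8), (14, 8), (14, 15), (14, 11), (13, 11)]

/-- A potential. -/
def genusPot : Fin 17 → ℤ := ![0, -2, -1, 0, 0, 0, 0, 0, 0, 0, 0, 0, 1, 2, 0, 0, 0]

/-- A surface of genus two with two boundary circles. -/
def genusBand : Band (Fin 17) (Fin 36) where
  tri := genusTri
  sgn := genusSign
  c := genusCircle
  idx := genusIdx
  lt x y := genusLevel x < genusLevel y ∨ genusLevel x = genusLevel y ∧ genusNext x = y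
  -- Counting crossings with a path between the two boundary circles gives a closed cochain; each
  -- circle is crossed once, so the factor 3 gives period 3. The potential redistributes it to 1 on
  -- each boundary edge.
  η x y := genusPot y - genusPot x +
    3 * ((if (x, y) ∈ genusCut then 1 else 0) - if (y, x) ∈ genusCut then 1 else 0)
  c_inj := by decide
  idx_c := by decide
  tri_inj := by decide +kernel
  tri_dist T T' h := by
    have key : ∀ T T', (∀ p, ∃ q, genusTri T' q = genusTri T p) → T = T' := by decide +kernel
    exact key T T' fun p => (h ▸ Set.mem_range_self p : genusTri T p ∈ Set.range (genusTri T'))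
  cover := by decide +kernel
  lt_asymm := by decide +kernel
  tri_lt := by decide +kernel
  c_edge := by decide +kernel
  sgn_eq := by decide +kernel
  bdry q hq := by
    have h := sum_eq_zero_of_antisymm (ι := Fin 36 × Fin 3 ⊕ Bool × ZMod 3)
      (a := Sum.elim (fun x => genusTri x.1 (![1, 0, 0] x.2)) fun x => genusCircle x.1 x.2)
      (b := Sum.elim (fun x => genusTri x.1 (![2, 2, 1] x.2)) fun x => genusCircle x.1 (x.2 + 1))
      (s := Sum.elim (fun x => genusSign x.1 * ![1, -1, 1] x.2) fun x => bif x.1 then 1 else -1)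
      (by decide +kernel) hq
    simp only [Fintype.sum_sum_type, Fintype.sum_prod_type, Fintype.sum_bool, Sum.elim_inl,
      Sum.elim_inr, Fin.sum_univ_three, cond_true, cond_false] at h
    simp only [Matrix.cons_val_zero, Matrix.cons_val_one, Matrix.cons_val] at h
    push_cast at h
    simp only [mul_one, one_mul, neg_mul, mul_neg, sum_neg_distrib] at h
    rw [← sub_eq_zero, ← h]
    have e : ∀ T, (genusSign T : ℝ) * (q (genusTri T 1) (genusTri T 2) -
        q (genusTri T 0) (genusTri T 2) + q (genusTri T 0) (genusTri T 1)) =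
        genusSign T * q (genusTri T 1) (genusTri T 2) +
        -(genusSign T * q (genusTri T 0) (genusTri T 2)) +
        genusSign T * q (genusTri T 0) (genusTri T 1) := fun T => by ring
    simp only [e]
    ring
  η_anti x y := by ring
  η_closed := by decide +kernel
  η_c := by decide +kernel

/-- The collars of the boundary circles. -/
def genusCollar (σ : Bool) : Collar genusBand σ where
  col x := bif x.1 then
      (bif σ then ![14, 15, 16] else ![3, 4, 5] : Fin 3 → Fin 17) x.2
    else genusCircle σ x.2
  col_inj := by revert σ; decide +kernel
  col_false _ := rfl
  col_true := by revert σ; decide +kernel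

/-- The apices of the cones. -/
def genusPole (σ : Bool) : Fin 19 := bif σ then 18 else 0

/-- The inclusion of the vertices of the band. -/
def genusIncl (w : Fin 17) : Fin 19 := w.succ.castSucc

/-- The triangles of the closed surface of genus two. -/
abbrev genusCap : Fin 36 ⊕ Bool × ZMod 3 → Fin 3 → Fin 19 := capTri genusBand genusPole genusIncl

theorem genusCap_cover : ∀ v, ∃ i p, genusCap i p = v := by decide +kernel

/-- The closed surface of genus two. -/
abbrev genusSurface : AbstractSimplicialComplex (Fin 19) := facetComplex genusCap genusCap_cover

theorem genusCap_injective : ∀ x, Function.Injective (genusCap x) := by decide +kernel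

theorem isOrientation_genusSurface :
    IsOrientation genusSurface 2 (signedChain genusCap (capSign genusBand)) :=
  isOrientation_cap _ _ _ genusCap_injective (by decide +kernel)

theorem eulerChar_genusSurface : eulerChar genusSurface = -2 := by
  rw [eulerChar_facetComplex]
  decide +kernel

/-- The links of the vertices. -/
def genusLink : Fin 19 → List (Fin 19) :=
  ![[1, 2, 3], [0, 3, 4, 5, 2], [0, 1, 5, 6, 3],
    [0, 2, 6, 4, 1], [1, 3, 6, 8, 10, 7, 9, 5], [1, 4, 9, 10, 8, 7, 6, 2],
    [2, 5, 7, 10, 9, 8, 4, 3], [4, 10, 6, 5, 8, 16, 17, 11, 15, 9], [4, 6, 9, 17, 15, 11, 16, 7, 5, 10],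
    [4, 7, 15, 16, 11, 17, 8, 6, 10, 5], [4, 8, 5, 9, 6, 7], [7, 17, 9, 16, 8, 15],
    [13, 16, 15, 14, 18], [12, 18, 14, 17, 16], [12, 15, 17, 13, 18],
    [7, 11, 8, 17, 14, 12, 16, 9], [7, 8, 11, 9, 15, 12, 13, 17], [7, 16, 13, 14, 15, 8, 9, 11],
    [12, 14, 13]]

theorem locEuc_genusSurface : LocEuc (ℝ × ℝ) (realization genusSurface) :=
  locEuc_of_links (d := fun v => (genusLink v).length) (ℓ := fun v k => (genusLink v).getD k 0)
    (by decide +kernel) (by decide +kernel) (by decide +kernel) (by decide +kernel)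
    (by decide +kernel)

/-- An induction principle from a rank function on the vertices. -/
theorem forall_of_rank {V ι : Type} {n : ℕ} {τ : ι → Fin n → V} {v₀ : V} {r : V → ℕ}
    (hr : ∀ v, v = v₀ ∨ ∃ i p q, τ i q = v ∧ r (τ i p) < r v) {P : V → Prop} (h₀ : P v₀)
    (h : ∀ i p q, P (τ i p) → P (τ i q)) (v : V) : P v := by
  induction hv : r v using Nat.strong_induction_on generalizing v with
  | _ k ih =>
    rcases hr v with rfl | ⟨i, p, q, rfl, hlt⟩
    · exact h₀
    · exact h i p q (ih _ (hv ▸ hlt) _ rfl)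

theorem isConnected_genusSurface : IsConnected (realization genusSurface) :=
  isConnected_realization 0 fun _ h₀ h v => forall_of_rank (r := fun v : Fin 19 =>
    if v = 18 then 40 else if 12 ≤ v ∧ v ≤ 14 then v + 10 else (v : ℕ)) (by decide +kernel) h₀ h v

end GenusTwo
end HopfBound
end

noncomputable section
namespace HopfBound
open Finset

/-! ### Filled bands are manifolds -/

section Manifold

variable {W Tri : Type} [Fintype W] [Fintype Tri] (D : Band W Tri) (n : ℕ)

/-- The vertices of a layered solid torus. -/
def IsLayerVert (σ : Bool) (v : Vert W n) : Prop :=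
  (∃ j, v = .core σ j) ∨ ∃ k ≤ n, ∃ i j, v = lv D n σ k i j

variable {D n}

theorem isLayerVert_base {σ : Bool} {w : W} {j : ZMod 3} :
    IsLayerVert D n σ (.base w j) ↔ ∃ i, w = D.c σ i := by
  constructor
  · rintro (⟨j, h⟩ | ⟨k, hk, i, j, h⟩)
    · simp at h
    · exact ⟨i, lv_eq_base D n h⟩
  · rintro ⟨i, rfl⟩
    exact .inr ⟨n, le_rfl, i, j, (lv_last ..).symm⟩

theorem IsLayerVert.unique {σ σ' : Bool} {v : Vert W n} (h : IsLayerVert D n σ v)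
    (h' : IsLayerVert D n σ' v) : σ = σ' := by
  rcases h with ⟨j, rfl⟩ | ⟨k, hk, i, j, rfl⟩ <;> rcases h' with ⟨j', e⟩ | ⟨k', hk', i', j', e⟩
  · rw [Vert.core.injEq] at e
    exact e.1
  · rw [lv] at e
    split_ifs at e
  · rw [lv] at e
    split_ifs at e
  · exact (lv_inj hk hk' e).1

theorem layered_apply_eq_zero_of_not {σ : Bool} {x : Vert W n → ℝ} (hx : x ∈ layered D n σ n)
    {v : Vert W n} (hv : ¬ IsLayerVert D n σ v) : x v = 0 :=
  layered_apply_eq_zero le_rfl hx (fun j h => hv (.inl ⟨j, h⟩)) fun k hk i j h =>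
    hv (.inr ⟨k, hk, i, j, h⟩)

theorem layered_subset_realization (σ : Bool) : layered D n σ n ⊆ realization (filling D n) := by
  rw [realization_filling]
  cases σ
  exacts [fun x hx => .inr (.inl hx), fun x hx => .inr (.inr hx)]

theorem mem_stdSimplex_of_mem_realization {V : Type} [Fintype V] {K : AbstractSimplicialComplex V}
    {x : V → ℝ} (hx : x ∈ realization K) : x ∈ stdSimplex ℝ V := by
  obtain ⟨s, -, hs⟩ := hx
  exact hs.1

theorem exists_pos_of_mem_stdSimplex {V : Type} [Fintype V] {x : V → ℝ} (hx : x ∈ stdSimplex ℝ V) :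
    ∃ v, 0 < x v := by
  by_contra! h
  have h1 := hx.2
  have h2 := sum_nonpos fun i (_ : i ∈ univ) => h i
  linarith

theorem Collar.emb_comp_prodTet {σ : Bool} (C : Collar D σ) {y : ZMod 3 × Bool} {T : Tri}
    (h : D.tri T = C.col ∘ colTri y) (j : ZMod 3) (m : Fin 3) :
    C.emb n ∘ prodTet colTri (y, j, m) = baseEmb n ∘ prodTet D.tri (T, j, m) := by
  funext p
  simp only [Function.comp_apply, Collar.emb, prodTet, baseEmb, h]

theorem Collar.solid_subset {σ : Bool} {C : Collar D σ}
    (h : ∀ y, ∃ T, D.tri T = C.col ∘ colTri y) : C.solid n ⊆ realization (filling D n) := by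
  refine Set.union_subset (layered_subset_realization σ) ?_
  rw [realization_filling, prodUnion, prodUnion, pushf_image_iUnion_cell (C.emb_injective n),
    pushf_image_iUnion_cell (baseEmb_injective n)]
  refine Set.iUnion_subset fun ⟨y, j, m⟩ x hx => .inl ?_
  obtain ⟨T, hT⟩ := h y
  rw [C.emb_comp_prodTet hT] at hx
  exact Set.mem_iUnion.2 ⟨_, hx⟩

/-- By `h` every band triangle that touches the boundary circle belongs to the collar, so a simplex
meeting a vertex of the solid torus stays inside solid torus and collar. -/
theorem Collar.mem_solid {σ : Bool} {C : Collar D σ}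
    (h : ∀ T p i, D.tri T p = D.c σ i → ∃ y, D.tri T = C.col ∘ colTri y) {x : Vert W n → ℝ}
    (hx : x ∈ realization (filling D n)) {v : Vert W n} (hv : IsLayerVert D n σ v)
    (hxv : x v ≠ 0) : x ∈ C.solid n := by
  rw [realization_filling] at hx
  have hl : ∀ τ, x ∈ layered D n τ n → x ∈ C.solid n := fun τ hx => by
    obtain rfl : τ = σ := by
      by_contra hne
      exact hxv (layered_apply_eq_zero_of_not hx fun h => hne (h.unique hv))
    exact .inl hx
  rcases hx with hx | hx | hx
  · rw [prodUnion, pushf_image_iUnion_cell (baseEmb_injective n)] at hx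
    obtain ⟨⟨T, j, m⟩, hx⟩ := Set.mem_iUnion.1 hx
    obtain ⟨p, hp⟩ : ∃ p, (baseEmb n ∘ prodTet D.tri (T, j, m)) p = v := by
      by_contra! hp
      exact hxv (hx.2 v hp)
    rw [← hp] at hv
    obtain ⟨i, hi⟩ := isLayerVert_base.1 hv
    obtain ⟨y, hy⟩ := h T _ i hi
    rw [← C.emb_comp_prodTet hy] at hx
    refine .inr ?_
    rw [prodUnion, pushf_image_iUnion_cell (C.emb_injective n)]
    exact Set.mem_iUnion.2 ⟨_, hx⟩
  · exact hl _ hx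
  · exact hl _ hx

theorem Collar.not_isLayerVert_outer {σ : Bool} (C : Collar D σ) (u : ZMod 3 × ZMod 3) :
    ¬ IsLayerVert D n σ (C.outer n u) := fun h => by
  obtain ⟨i, hi⟩ := isLayerVert_base.1 h
  exact C.col_true _ _ hi

/-- All mass off the layer vertices means height 1 in the collar. So the open star of the layer
vertices is exactly the interior of the enlarged solid torus. -/
theorem Collar.exists_pos_iff {σ : Bool} (C : Collar D σ) {x : Vert W n → ℝ}
    (hx : x ∈ C.solid n) (h0 : x ∈ stdSimplex ℝ (Vert W n)) :
    (∃ v, IsLayerVert D n σ v ∧ 0 < x v) ↔ x ∉ pushf (C.outer n) '' tor := by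
  constructor
  · rintro ⟨v, hv, hxv⟩ ⟨u, -, rfl⟩
    refine hxv.ne' (pushf_eq_zero fun w hw => absurd hv ?_)
    rw [← hw]
    exact C.not_isLayerVert_outer w
  · intro hxo
    by_contra! hz
    have hz : ∀ v, IsLayerVert D n σ v → x v = 0 := fun v hv => le_antisymm (hz v hv) (h0.1 v)
    rcases hx with hx | ⟨w, hw, rfl⟩
    · obtain ⟨v, hv⟩ := exists_pos_of_mem_stdSimplex h0
      refine hv.ne' ?_
      by_cases hlv : IsLayerVert D n σ v
      · exact hz v hlv
      · exact layered_apply_eq_zero_of_not hx hlv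
    · have h1 := height_add (mem_stdSimplex_of_mem_prodUnion hw)
      rw [pushf_eq_zero, add_zero] at h1
      · obtain ⟨u, hu, rfl⟩ := (isSlab_colTri.height_eq_one_iff hw).1 h1
        refine hxo ⟨u, hu, ?_⟩
        rw [pushf_comp]
        rfl
      · rintro ⟨⟨b, i⟩, j⟩ hb
        obtain rfl : b = false := hb
        rw [← pushf_apply_of_injective (C.emb_injective n) w]
        refine hz _ (isLayerVert_base.2 ⟨i, C.col_false i⟩)

/-- The enlarged solid torus maps into plane × circle, and the open star of the layer vertices
corresponds to radius below n + 2, an open set. The collar is needed for charts at points of the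
boundary torus of the layers. -/
theorem exists_chart_layer {σ : Bool} {C : Collar D σ}
    (h1 : ∀ T p i, D.tri T p = D.c σ i → ∃ y, D.tri T = C.col ∘ colTri y)
    (h2 : ∀ y, ∃ T, D.tri T = C.col ∘ colTri y) (x : realization (filling D n)) {v : Vert W n}
    (hv : IsLayerVert D n σ v) (hxv : 0 < x.1 v) :
    ∃ e : OpenPartialHomeomorph (realization (filling D n)) ((ℝ × ℝ) × ℝ), x ∈ e.source := by
  obtain ⟨χ, -, -, -, h⟩ := isSolid_collar (D := D) n
  obtain ⟨f, hf⟩ := h σ C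
  have hB : LocEuc ((ℝ × ℝ) × ℝ) (plane ×ˢ circ : Set _) :=
    ((LocEuc.of_homeomorph planeHomeomorph).prod locEuc_circ).congr (Homeomorph.Set.prod _ _)
  have hUK : ∀ y ∈ realization (filling D n), (∃ v, IsLayerVert D n σ v ∧ 0 < y v) →
      y ∈ C.solid n := fun y hy ⟨v, hv, hyv⟩ => C.mem_solid h1 hy hv hyv.ne'
  have hO : IsOpen {y : Vert W n → ℝ | ∃ v, IsLayerVert D n σ v ∧ 0 < y v} := by
    simp only [Set.ofPred_exists]
    refine isOpen_iUnion fun v => ?_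
    by_cases hv : IsLayerVert D n σ v
    · simpa [hv] using isOpen_lt continuous_const (continuous_apply v)
    · simp [hv]
  refine hB.exists_chart (f := f) (K := C.solid n)
    (U := realization (filling D n) ∩ {y | ∃ v, IsLayerVert D n σ v ∧ 0 < y v})
    (P := {z | ∑ i, z.1 i < (n : ℝ) + 2}) (C.solid_subset h2) hf.isCompact hf.continuousOn
    hf.bijOn.injOn (fun y hy => ?_) hO rfl (fun y hy => hUK y hy.1 hy.2)
    (isOpen_lt (by fun_prop) continuous_const) ?_ x ⟨x.2, v, hv, hxv⟩
  · exact ⟨(hf.bijOn.mapsTo hy).1, (hf.bijOn.mapsTo hy).2.2⟩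
  · ext z
    constructor
    · rintro ⟨y, ⟨hyA, hyO⟩, rfl⟩
      have hyK := hUK y hyA hyO
      have hz := hf.bijOn.mapsTo hyK
      refine ⟨⟨hz.1, hz.2.2⟩, hz.2.1.lt_of_ne fun e => ?_⟩
      exact (C.exists_pos_iff hyK (mem_stdSimplex_of_mem_realization hyA)).1 hyO
        ((hf.mem_iff y hyK).1 e)
    · rintro ⟨⟨hz1, hz2⟩, hz3⟩
      obtain ⟨y, hyK, rfl⟩ := hf.bijOn.surjOn ⟨hz1, le_of_lt hz3, hz2⟩
      have hyA := C.solid_subset h2 hyK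
      refine ⟨y, ⟨hyA, ?_⟩, rfl⟩
      refine (C.exists_pos_iff hyK (mem_stdSimplex_of_mem_realization hyA)).2 fun hT => ?_
      exact (ne_of_lt hz3) ((hf.mem_iff y hyK).2 hT)

/-- Charts are borrowed from capped surface × circle. A point with positive mass at an interior
vertex of the band avoids the layered tori, and its image avoids the added cones, so the
identification is one of open sets. -/
theorem exists_chart_base {W' : Type} [Fintype W'] {pole : Bool → W'} {ψ : W → W'}
    {hτ : ∀ v, ∃ i p, capTri D pole ψ i p = v}
    (hS : LocEuc (ℝ × ℝ) (realization (facetComplex (capTri D pole ψ) hτ)))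
    (hψ : Function.Injective ψ) (hp : ∀ σ w, ψ w ≠ pole σ) (x : realization (filling D n)) {w : W}
    {j : ZMod 3} (hw : ∀ σ i, w ≠ D.c σ i) (hxw : 0 < x.1 (.base w j)) :
    ∃ e : OpenPartialHomeomorph (realization (filling D n)) ((ℝ × ℝ) × ℝ), x ∈ e.source := by
  have hB : LocEuc ((ℝ × ℝ) × ℝ)
      (realization (facetComplex (capTri D pole ψ) hτ) ×ˢ circ : Set _) :=
    (hS.prod locEuc_circ).congr (Homeomorph.Set.prod _ _)
  have hbij := bijOn_marg D.lt_asymm D.tri_lt D.tri_inj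
  have hinj := baseEmb_injective (W := W) n
  have hUK : ∀ y ∈ realization (filling D n),
      (∃ w, (∀ σ i, w ≠ D.c σ i) ∧ ∃ j, 0 < y (.base w j)) →
      y ∈ pushf (baseEmb n) '' prodUnion D.tri := by
    rintro y hy ⟨w, hw, j, hyw⟩
    have hl : ∀ σ, y ∉ layered D n σ n := fun σ hy =>
      hyw.ne' (layered_apply_eq_zero_of_not hy fun h =>
        let ⟨i, hi⟩ := isLayerVert_base.1 h
        hw σ i hi)
    rw [realization_filling] at hy
    rcases hy with hy | hy | hy
    exacts [hy, absurd hy (hl _), absurd hy (hl _)]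
  have hO : IsOpen {y : Vert W n → ℝ | ∃ w, (∀ σ i, w ≠ D.c σ i) ∧ ∃ j, 0 < y (.base w j)} := by
    simp only [Set.ofPred_exists]
    refine isOpen_iUnion fun w => ?_
    by_cases hw : ∀ σ i, w ≠ D.c σ i
    · simp only [hw, ne_eq, not_false_eq_true, implies_true, true_and, Set.ofPred_exists]
      exact isOpen_iUnion fun j => isOpen_lt continuous_const (continuous_apply _)
    · have : {y : Vert W n → ℝ | (∀ σ i, w ≠ D.c σ i) ∧ ∃ j, 0 < y (.base w j)} = ∅ := by
        ext y
        simp only [Set.mem_ofPred_eq, Set.mem_empty_iff_false, iff_false]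
        exact fun h => hw h.1
      rw [this]
      exact isOpen_empty
  have hP : IsOpen {z : (W' → ℝ) × (ZMod 3 → ℝ) | ∃ w, (∀ σ i, w ≠ D.c σ i) ∧ 0 < z.1 (ψ w)} := by
    simp only [Set.ofPred_exists]
    refine isOpen_iUnion fun w => ?_
    by_cases hw : ∀ σ i, w ≠ D.c σ i
    · simp only [hw, ne_eq, not_false_eq_true, implies_true, true_and]
      exact isOpen_lt continuous_const (by fun_prop)
    · have : {z : (W' → ℝ) × (ZMod 3 → ℝ) | (∀ σ i, w ≠ D.c σ i) ∧ 0 < z.1 (ψ w)} = ∅ := by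
        ext y
        simp only [Set.mem_ofPred_eq, Set.mem_empty_iff_false, iff_false]
        exact fun h => hw h.1
      rw [this]
      exact isOpen_empty
  have hA : realization (facetComplex (capTri D pole ψ) hτ) = ⋃ i, cell (capTri D pole ψ i) :=
    realization_facetComplex
  have hfB : ∀ u ∈ prodUnion D.tri, (pushf ψ (pushf Prod.fst u), pushf Prod.snd u) ∈
      realization (facetComplex (capTri D pole ψ) hτ) ×ˢ circ := fun u hu => by
    obtain ⟨hu1, hu2⟩ := hbij.mapsTo hu
    obtain ⟨T, hT⟩ := Set.mem_iUnion.1 hu1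
    refine ⟨?_, hu2⟩
    rw [hA]
    exact Set.mem_iUnion.2 ⟨.inl T, pushf_mem_cell ψ hT⟩
  refine hB.exists_chart (K := pushf (baseEmb n) '' prodUnion D.tri)
    (f := fun y => (pushf ψ (pushf Prod.fst (y ∘ baseEmb n)), pushf Prod.snd (y ∘ baseEmb n)))
    (U := realization (filling D n) ∩ _) ?_ ?_ ?_ ?_ ?_ hO rfl (fun y hy => hUK y hy.1 hy.2) hP ?_ x
    ⟨x.2, w, hw, j, hxw⟩
  · rw [realization_filling]
    exact Set.subset_union_left
  · exact (isCompact_prodUnion D.tri).image (continuous_pushf _)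
  · have h1 : Continuous fun y : Vert W n → ℝ => y ∘ baseEmb n := by
      exact continuous_pi fun _ => continuous_apply _
    exact (((continuous_pushf ψ).comp ((continuous_pushf _).comp h1)).prodMk
      ((continuous_pushf _).comp h1)).continuousOn
  · rintro _ ⟨u, hu, rfl⟩ _ ⟨u', hu', rfl⟩ h
    simp only [pushf_comp_eq hinj, Prod.mk.injEq] at h
    rw [hbij.injOn hu hu' (Prod.ext (pushf_injective hψ h.1) h.2)]
  · rintro _ ⟨u, hu, rfl⟩
    simp only [pushf_comp_eq hinj]
    exact hfB u hu
  · ext z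
    constructor
    · rintro ⟨y, ⟨hyA, hyO⟩, rfl⟩
      obtain ⟨u, hu, rfl⟩ := hUK y hyA hyO
      simp only [pushf_comp_eq hinj]
      refine ⟨hfB u hu, ?_⟩
      obtain ⟨w, hw, j, hj⟩ := hyO
      refine ⟨w, hw, ?_⟩
      change 0 < pushf (baseEmb n) u (baseEmb n (w, j)) at hj
      rw [pushf_apply_of_injective hinj] at hj
      dsimp only
      rw [pushf_apply_of_injective hψ, pushf_fst]
      have h0 := (mem_stdSimplex_of_mem_prodUnion hu).1
      exact hj.trans_le (single_le_sum (f := fun j => u (w, j)) (fun i _ => h0 _) (mem_univ j))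
    · rintro ⟨⟨hz1, hz2⟩, w, hw, hzw⟩
      rw [hA] at hz1
      obtain ⟨T | ⟨σ, i⟩, hT⟩ := Set.mem_iUnion.1 hz1
      · have hT' : z.1 ∈ pushf ψ '' ⋃ (_ : Unit), cell (D.tri T) := by
          rw [pushf_image_iUnion_cell hψ]
          exact Set.mem_iUnion.2 ⟨(), hT⟩
        obtain ⟨β, hβ, hβz⟩ := hT'
        have hβ : β ∈ triUnion D.tri := Set.mem_iUnion.2 ⟨T, by simpa using hβ⟩
        obtain ⟨u, hu, huz⟩ := hbij.surjOn (a := (β, z.2)) ⟨hβ, hz2⟩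
        have e1 : pushf Prod.fst u = β := congrArg Prod.fst huz
        have e2 : pushf Prod.snd u = z.2 := congrArg Prod.snd huz
        refine ⟨pushf (baseEmb n) u, ⟨?_, w, hw, ?_⟩, ?_⟩
        · rw [realization_filling]
          exact .inl ⟨u, hu, rfl⟩
        · rw [← hβz, pushf_apply_of_injective hψ, ← e1, pushf_fst] at hzw
          obtain ⟨j, -, hj⟩ := exists_lt_of_sum_lt (f := fun _ => (0 : ℝ)) (by simpa using hzw)
          exact ⟨j, by
            change 0 < pushf (baseEmb n) u (baseEmb n (w, j))
            rwa [pushf_apply_of_injective hinj]⟩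
        · simp only [pushf_comp_eq hinj, e1, e2, hβz]
      · exfalso
        refine hzw.ne' (hT.2 _ fun q => ?_)
        fin_cases q
        · exact (hp σ w).symm
        · exact fun h => hw σ i (hψ h).symm
        · exact fun h => hw σ (i + 1) (hψ h).symm

/-- Every point has some positive coordinate, and each vertex belongs to a layered torus or to the
interior of the band; the two chart constructions therefore cover everything. -/
theorem locEuc_filling {C : ∀ σ, Collar D σ}
    (h1 : ∀ σ T p i, D.tri T p = D.c σ i → ∃ y, D.tri T = (C σ).col ∘ colTri y)
    (h2 : ∀ σ y, ∃ T, D.tri T = (C σ).col ∘ colTri y) {W' : Type} [Fintype W'] {pole : Bool → W'}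
    {ψ : W → W'} {hτ : ∀ v, ∃ i p, capTri D pole ψ i p = v}
    (hS : LocEuc (ℝ × ℝ) (realization (facetComplex (capTri D pole ψ) hτ)))
    (hψ : Function.Injective ψ) (hp : ∀ σ w, ψ w ≠ pole σ) :
    LocEuc ((ℝ × ℝ) × ℝ) (realization (filling D n)) := by
  intro x
  obtain ⟨v, hv⟩ := exists_pos_of_mem_stdSimplex (mem_stdSimplex_of_mem_realization x.2)
  by_cases hl : ∃ σ, IsLayerVert D n σ v
  · obtain ⟨σ, hl⟩ := hl
    exact exists_chart_layer (h1 σ) (h2 σ) x hl hv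
  · rcases v with ⟨w, j⟩ | ⟨σ, k, i, j⟩ | ⟨σ, j⟩
    · exact exists_chart_base hS hψ hp x
        (fun σ i h => hl ⟨σ, isLayerVert_base.2 ⟨i, h⟩⟩) hv
    · exact absurd ⟨σ, .inr ⟨k, k.2.le, i, j, (lv_of_lt k.2 i j).symm⟩⟩ hl
    · exact absurd ⟨σ, .inl ⟨j, rfl⟩⟩ hl

/-- Filled bands are connected. -/
theorem isConnected_filling {v₀ : W}
    (h : ∀ P : W → Prop, P v₀ → (∀ T p q, P (D.tri T p) → P (D.tri T q)) → ∀ w, P w) :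
    IsConnected (realization (filling D n)) := by
  refine isConnected_realization (.base v₀ 0) fun P h₀ hP => ?_
  have key : ∀ (T : Tag Tri n) p j q j', P (prism D n T p j) → P (prism D n T q j') := by
    intro T
    have s : ∀ m j p q, P (prism D n T (stair m j p).1 (stair m j p).2) →
        P (prism D n T (stair m j q).1 (stair m j q).2) := fun m j p q => hP (T, j, m) p q
    -- The staircase tetrahedron with m = 2 contains the whole triangle at j, and its last edge
    -- advances one step around the circle.
    have a : ∀ p q j, P (prism D n T p j) → P (prism D n T q j) := by
      intro p q j
      have := s 2 j (p.castSucc) (q.castSucc)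
      fin_cases p <;> fin_cases q <;> exact this
    have b : ∀ j, P (prism D n T 2 j) → P (prism D n T 2 (j + 1)) := fun j => s 2 j 2 3
    have b' : ∀ j j', P (prism D n T 2 j) → P (prism D n T 2 j') := fun j j' hj => by
      rcases zmod_three_cases j' j with rfl | rfl | rfl
      · exact hj
      · exact b _ hj
      · have := b _ (b _ hj)
        rwa [add_assoc] at this
    exact fun p j q j' hj => a _ _ _ (b' _ _ (a _ _ _ hj))
  have hbase : ∀ w j, P (.base w j) := by
    have h1 := h (fun w => ∀ j, P (.base w j)) (fun j => ?_) fun T p q hT j =>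
      key (.inl T) p j q j (hT j)
    · exact h1
    · obtain ⟨T, p, rfl⟩ := D.cover v₀
      exact key (.inl T) p 0 p j h₀
  have hlv : ∀ σ, ∀ m ≤ n, ∀ i j, P (lv D n σ (n - m) i j) := by
    intro σ m
    induction m with
    | zero =>
      intro _ i j
      rw [Nat.sub_zero, lv_last]
      exact hbase _ _
    | succ m ih =>
      intro hm i j
      have hk : n - (m + 1) < n := by omega
      have h1 := key (.inr (.inl (σ, ⟨n - (m + 1), hk⟩, j - i, true))) 1 0 0 i
      have e1 : n - (m + 1) + 1 = n - m := by omega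
      have h2 : P (lv D n σ (n - (m + 1)) i (j - i + i)) := h1 (by
        change P (lv D n σ (n - (m + 1) + 1) (j - i) 0)
        rw [e1]
        exact ih (by omega) _ _)
      rwa [sub_add_cancel] at h2
  have hlv' : ∀ σ, ∀ k ≤ n, ∀ i j, P (lv D n σ k i j) := fun σ k hk i j => by
    have := hlv σ (n - k) (by omega) i j
    rwa [Nat.sub_sub_self hk] at this
  rintro (⟨w, j⟩ | ⟨σ, k, i, j⟩ | ⟨σ, j⟩)
  · exact hbase w j
  · have := hlv' σ k k.2.le i j
    rwa [lv_of_lt k.2] at this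
  · cases σ
    · exact key (.inr (.inr (false, 0))) 1 0 0 j (hlv' false 0 (Nat.zero_le _) 0 0)
    · exact key (.inr (.inr (true, 0))) 1 0 0 j (hlv' true 0 (Nat.zero_le _) 0 0)

theorem isClosedOrientable_realization {V ι : Type} [Fintype V] [LinearOrder V] [Finite ι] {d : ℕ}
    {τ : ι → Fin (d + 1) → V} {hτ : ∀ v, ∃ i p, τ i p = v} {o : (Fin (d + 1) → V) → ℝ}
    (hc : IsConnected (realization (facetComplex τ hτ)))
    (hl : LocEuc (EuclideanSpace ℝ (Fin d)) (realization (facetComplex τ hτ)))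
    (ho : IsOrientation (facetComplex τ hτ) d o) :
    IsClosedOrientable d (realization (facetComplex τ hτ)) where
  t2 := inferInstance
  compact := by
    rw [← isCompact_iff_compactSpace, realization_facetComplex]
    exact isCompact_iUnion fun i => isCompact_cell _
  connected := isConnected_iff_connectedSpace.1 hc
  charted := hl.nonempty_chartedSpace
  orientable := ⟨_, _, _, _, _, ⟨Homeomorph.refl _⟩, ho⟩

end Manifold
end HopfBound
end

noncomputable section
namespace HopfBound
open Finset

/-! ### Maps to the surface of genus two -/

section GenusTwoMaps

theorem isSurfaceOfGenus_genusSurface : IsSurfaceOfGenus 2 (realization genusSurface) :=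
  ⟨isClosedOrientable_realization isConnected_genusSurface
    (locEuc_genusSurface.transHomeomorph
      (ContinuousLinearEquiv.ofFinrankEq (𝕜 := ℝ) (by simp)).toHomeomorph)
    isOrientation_genusSurface, _, _, _, ⟨Homeomorph.refl _⟩, by
      rw [eulerChar_genusSurface]
      norm_num⟩

theorem isClosedOrientable_filling_genusBand (n : ℕ) :
    IsClosedOrientable 3 (realization (filling genusBand n)) := by
  let : LinearOrder (Vert (Fin 17) n) := inducedLinearOrder (fun _ => (0 : ℕ))
  refine isClosedOrientable_realization (isConnected_filling (v₀ := 0) fun P h₀ h w =>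
      forall_of_rank (r := fun v : Fin 17 => if 11 ≤ v ∧ v ≤ 13 then v + 10 else (v : ℕ))
        (by decide +kernel) h₀ h w)
    ((locEuc_filling (C := genusCollar) (by decide +kernel) (by decide +kernel)
      locEuc_genusSurface (by decide +kernel) (by decide +kernel)).transHomeomorph
      (ContinuousLinearEquiv.ofFinrankEq (𝕜 := ℝ) (by simp)).toHomeomorph)
    (isOrientation_filling _ _)

/-- The Hopf invariant of maps to a surface of genus two grows exponentially. -/
theorem exists_exp_le_hopfInvariant : ∃ c : ℝ, 0 < c ∧ ∃ N₀ : ℕ,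
    ∃ (S : Type) (_ : TopologicalSpace S), IsSurfaceOfGenus 2 S ∧
      ∀ N : ℕ, N₀ ≤ N →
        ∃ (V : Type) (_ : Fintype V) (K : AbstractSimplicialComplex V),
          IsClosedOrientable 3 (realization K) ∧ numSimplices K ≤ N ∧
          ∃ (f : C(realization K, S)) (h : ℝ),
            IsHopfInvariant f h ∧ Real.exp (c * N) ≤ |h| := by
  obtain ⟨c, hc, N₀, h⟩ := exists_exp_lt 1 one_pos (Fintype.card (Fin 36))
  refine ⟨c, hc, N₀, realization genusSurface, _, isSurfaceOfGenus_genusSurface, fun N hN => ?_⟩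
  obtain ⟨l, hl, hexp⟩ := h N hN
  refine ⟨_, _, filling genusBand (l + 1), isClosedOrientable_filling_genusBand _,
    (numSimplices_filling_le _ _).trans hl, ?_⟩
  obtain ⟨hφ, h, hh, hfib⟩ := exists_isHopfInvariant genusBand (pole := genusPole)
    (ψ := genusIncl) (hτ := genusCap_cover) (fun T => ⟨.inl T, fun p => ⟨p, rfl⟩⟩)
    (fun σ i => ⟨.inr (σ, i), ⟨0, rfl⟩, ⟨1, rfl⟩, 2, rfl⟩) (by decide +kernel) (by decide +kernel)
    (by decide +kernel) (by decide +kernel) isOrientation_genusSurface genusCap_injective (by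
      rw [Fintype.sum_sum_type, Fintype.sum_prod_type, Fintype.sum_bool]
      have h0 : ∀ x, (∀ q, genusCap x q ≠ 0) →
          coneForm (genusPole false) (fun i => genusIncl (genusBand.c false i)) (genusCap x) = 0 :=
        fun x hx => by
          by_contra h
          obtain ⟨q, hq⟩ := exists_eq_of_coneForm_ne_zero h
          exact hx q hq
      have h1 : ∀ i, coneForm (genusPole false) (fun i => genusIncl (genusBand.c false i))
          (genusCap (.inr (false, i))) = 1 / 3 := fun i =>
        coneForm_cone (s := genusPole false) (c := fun i => genusIncl (genusBand.c false i))
          (by decide +kernel) (by decide +kernel) i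
      have h2 : ∀ T q, genusCap (.inl T) q ≠ 0 := by decide +kernel
      have h3 : ∀ i q, genusCap (.inr (true, i)) q ≠ 0 := by decide +kernel
      simp only [h1, fun T => h0 (.inl T) (h2 T), fun i => h0 (.inr (true, i)) (h3 i), capSign]
      simp) (Homeomorph.refl _) l
  refine ⟨_, h, hh, ?_⟩
  rw [hfib]
  simpa using hexp.le

end GenusTwoMaps
end HopfBound
end

theorem mainTheorem10 :
    (∃ c : ℝ, 0 < c ∧ ∃ N₀ : ℕ,
      ∃ (S : Type) (_ : TopologicalSpace S), HopfBound.IsSurfaceOfGenus 2 S ∧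
        ∀ N : ℕ, N₀ ≤ N →
          ∃ (V : Type) (_ : Fintype V) (K : AbstractSimplicialComplex V),
            HopfBound.IsClosedOrientable 3 (HopfBound.realization K) ∧
            HopfBound.numSimplices K ≤ N ∧
            ∃ (f : C(HopfBound.realization K, S)) (h : ℝ),
              HopfBound.IsHopfInvariant f h ∧ Real.exp (c * N) ≤ |h|) ∧
    (∃ c : ℝ, 0 < c ∧ ∃ N₀ : ℕ, ∀ N : ℕ, N₀ ≤ N →
      ∃ (V : Type) (_ : Fintype V) (K : AbstractSimplicialComplex V),
        Nonempty (HopfBound.realization K ≃ₜ HopfBound.UnitSphere 3) ∧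
        HopfBound.numSimplices K ≤ N ∧
        ENNReal.ofReal (Real.exp (c * N)) < HopfBound.hopfSize K) :=
  ⟨HopfBound.exists_exp_le_hopfInvariant, HopfBound.exists_exp_lt_hopfSize⟩
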